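/- Let $\mathbb G$ be a second countable locally compact group, $\mu$ a Borel probability measure on $\mathbb G$, $\Omega=\mathbb G^{\mathbb N^*}$, $\mathbb P=\mu^{\otimes\mathbb N^*}$ (with expectation $\mathbb E$), and write $\omega=(g_1,g_2,\dots)\in\Omega$. Let $\mathbb X$ be a second countable locally compact space with a continuous action of $\mathbb G$ and a $\mu$-stationary Borel probability measure $\nu$. Let $\sigma:\mathbb G\times\mathbb X\to\mathbb R$ be a continuous cocycle, i.e. $\sigma(g_2g_1,x)=\sigma(g_2,g_1x)+\sigma(g_1,x)$, such that (i) $\int_{\mathbb G} e^{\alpha_0\sup_{x\in\mathbb X}|\sigma(g,x)|}\,\mu(dg)<\infty$ for some $\alpha_0>0$; (ii) $\int_{\mathbb G}\sigma(g,x)\,\mu(dg)=0$ for every $x\in\mathbb X$; (iii) setting $S_n^x=\sigma(g_n\cdots g_1,x)$, there are constants $c,\mathbf v,\epsilon>0$ such that for all $a_1<a_2$, $x\in\mathbb X$ and $n\ge1$, $$\Big|\mathbb P\Big(\tfrac{S_n^x}{\sqrt n}\in[a_1,a_2]\Big)-\int_{a_1}^{a_2}\phi_{\mathbf v^2}(u)\,du\Big|\le\frac{c}{n^\epsilon},$$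 where $\phi_{\mathbf v^2}$ is the density of the centered normal law of variance $\mathbf v^2$. For a function $h$ on $\Omega$ and $p\ge0$ let $h_p(\omega)=\int_\Omega h(g_1,\dots,g_p,g'_{p+1},g'_{p+2},\dots)\,\mathbb P(d\omega')$, that is, $h_p=\mathbb E(h\mid g_1,\dots,g_p)$. Let $\mathfrak f=(f_n)_{n\ge0}$ be a sequence of measurable functions $f_n:\Omega\times\mathbb X\to\mathbb R$, and let $f_{n,p}(\cdot,x)=(f_n(\cdot,x))_p$. Assume that there are $\alpha,\beta>0$ with $$\sup_{n\ge0}\int_{\mathbb X}\int_\Omega e^{\alpha|f_n(\omega,x)|}\,\mathbb P(d\omega)\,\nu(dx)<\infty,$$ $$\sup_{n\ge0}\sup_{p\ge0}e^{\beta p}\Big(\int_{\mathbb X}\int_\Omega e^{\alpha|f_n(\omega,x)-f_{n,p}(\omega,x)|}\,\mathbb P(d\omega)\,\nu(dx)-1\Big)<\infty.$$ Let $\theta\in L^\infty(\Omega,\mathbb P)$ be non-negative and such that $\sup_{p\ge0}e^{\beta p}\,\mathbb E|\theta-\theta_p|<\infty$ for some $\beta>0$. With $T(\omega,x)=((g_2,g_3,\dots),g_1x)$,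 set for $n\ge1$ and $t\in\mathbb R$ $$\widetilde S_n^x(\omega)=S_n^x(\omega)+f_n(T^n(\omega,x))-f_0(\omega,x),\qquad \tau_{x,t}^{\mathfrak f}=\min\{k\ge1:\ t+\widetilde S_k^x<0\}\in\mathbb N\cup\{\infty\},$$ $$U_n^{\mathfrak f,\theta}(t)=\int_{\mathbb X}\mathbb E\big((t+\widetilde S_n^x)\,\theta;\ \tau_{x,t}^{\mathfrak f}>n\big)\,\nu(dx).$$ Then, for every $n\ge1$, the expectations defining $U_n^{\mathfrak f,\theta}(t)$ converge absolutely and $U_n^{\mathfrak f,\theta}$ is locally integrable on $\mathbb R$, and there exists a measurable, locally integrable function $U^{\mathfrak f,\theta}:\mathbb R\to[0,\infty)$ such that for every continuous compactly supported function $\varphi:\mathbb R\to\mathbb R$, $$\lim_{n\to\infty}\int_{\mathbb R}\varphi(t)\,U_n^{\mathfrak f,\theta}(t)\,dt=\int_{\mathbb R}\varphi(t)\,U^{\mathfrak f,\theta}(t)\,dt,$$ and moreover $$\lim_{t\to\infty}\frac1t\,U^{\mathfrak f,\theta}(t)=\mathbb E\,\theta.$$ -/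

import Mathlib

open MeasureTheory Filter Topology
open scoped ENNReal NNReal

noncomputable section

namespace FutureWalk

variable {G X : Type*}

/-- The law `μ^{⊗ ℕ*}` on the path space `Ω = (ℕ → G)`.
The coordinate `ω i` of a path is the group element usually written `g_{i+1}`. -/
def pathMeasure [MeasurableSpace G] (μ : Measure G) [IsProbabilityMeasure μ] :
    Measure (ℕ → G) :=
  Measure.infinitePi (fun _ : ℕ => μ)

/-- The left product `g_n ⋯ g_1`. -/
def leftProd [Monoid G] (ω : ℕ → G) : ℕ → G
  | 0 => 1
  | n + 1 => ω n * leftProd ω n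

/-- The map `T (ω, x) = ((g_2, g_3, …), g_1 x)`. -/
def skewShift [SMul G X] (z : (ℕ → G) × X) : (ℕ → G) × X :=
  (fun i => z.1 (i + 1), z.1 0 • z.2)

/-- `ν` is `μ`-stationary: `μ * ν = ν`. -/
def IsStationary [SMul G X] [MeasurableSpace G] [MeasurableSpace X]
    (μ : Measure G) (ν : Measure X) : Prop :=
  Measure.map (fun p : G × X => p.1 • p.2) (μ.prod ν) = ν

/-- The cocycle identity `σ(g₂ g₁, x) = σ(g₂, g₁ x) + σ(g₁, x)`. -/
def IsCocycle [Mul G] [SMul G X] (σ : G → X → ℝ) : Prop :=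
  ∀ (g₂ g₁ : G) (x : X), σ (g₂ * g₁) x = σ g₂ (g₁ • x) + σ g₁ x

/-- Uniform exponential moment: for some `α₀ > 0`,
`∫ exp (α₀ sup_x |σ(g,x)|) μ(dg) < ∞` (the supremum, possibly infinite, is taken after the
exponential, in `[0, ∞]`). -/
def HasExpMoment [MeasurableSpace G] (μ : Measure G) (σ : G → X → ℝ) : Prop :=
  ∃ α₀ : ℝ, 0 < α₀ ∧
    ∫⁻ g, ⨆ x : X, ENNReal.ofReal (Real.exp (α₀ * |σ g x|)) ∂μ < ∞

/-- Strong centering: `∫ σ(g,x) μ(dg) = 0` for every `x`. -/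
def IsCentered [MeasurableSpace G] (μ : Measure G) (σ : G → X → ℝ) : Prop :=
  ∀ x : X, ∫ g, σ g x ∂μ = 0

/-- The random walk `S_n^x(ω) = σ(g_n ⋯ g_1, x)`. -/
def walk [Monoid G] (σ : G → X → ℝ) (n : ℕ) (ω : ℕ → G) (x : X) : ℝ :=
  σ (leftProd ω n) x

/-- Effective central limit theorem: there are `c, v, ε > 0` such that, for all `a₁ < a₂`, all `x`
and all `n ≥ 1`, `P(S_n^x / √n ∈ [a₁, a₂])` is within `c / n^ε` of the mass that the centered normal
law of variance `v²` gives to `[a₁, a₂]`. -/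
def EffectiveCLT [Monoid G] [MeasurableSpace G] (μ : Measure G) [IsProbabilityMeasure μ]
    (σ : G → X → ℝ) : Prop :=
  ∃ (c ε : ℝ) (v : ℝ≥0), 0 < c ∧ 0 < ε ∧ 0 < v ∧
    ∀ (a₁ a₂ : ℝ), a₁ < a₂ → ∀ (x : X) (n : ℕ), 1 ≤ n →
      |(pathMeasure μ).real {ω | walk σ n ω x / Real.sqrt n ∈ Set.Icc a₁ a₂}
          - ∫ u in a₁..a₂, ProbabilityTheory.gaussianPDFReal 0 (v ^ 2) u|
        ≤ c / (n : ℝ) ^ ε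

/-- The perturbed walk `S_n^x(ω) + f_n(T^n(ω,x)) - f_0(ω,x)`. -/
def perturbedWalk [Monoid G] [SMul G X] (σ : G → X → ℝ) (f : ℕ → (ℕ → G) × X → ℝ)
    (n : ℕ) (ω : ℕ → G) (x : X) : ℝ :=
  walk σ n ω x + f n (skewShift^[n] (ω, x)) - f 0 (ω, x)

/-- The first time `k ≥ 1` at which `t +` (perturbed walk at time `k`) is negative;
it is `⊤` if there is no such time. -/
def exitTime [Monoid G] [SMul G X] (σ : G → X → ℝ) (f : ℕ → (ℕ → G) × X → ℝ)
    (t : ℝ) (ω : ℕ → G) (x : X) : ℕ∞ :=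
  ⨅ (k : ℕ) (_ : 1 ≤ k ∧ t + perturbedWalk σ f k ω x < 0), (k : ℕ∞)

theorem lt_exitTime_iff [Monoid G] [SMul G X] (σ : G → X → ℝ) (f : ℕ → (ℕ → G) × X → ℝ)
    (t : ℝ) (ω : ℕ → G) (x : X) (n : ℕ) :
    (n : ℕ∞) < exitTime σ f t ω x ↔
      ∀ k : ℕ, 1 ≤ k → k ≤ n → 0 ≤ t + perturbedWalk σ f k ω x := by
  constructor
  · intro h k hk hkn
    by_contra hneg
    have h1 : exitTime σ f t ω x ≤ (k : ℕ∞) := iInf₂_le k ⟨hk, not_le.mp hneg⟩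
    have h2 : (n : ℕ∞) < (k : ℕ∞) := lt_of_lt_of_le h h1
    exact absurd (Nat.cast_lt.mp h2) (not_lt.mpr hkn)
  · intro h
    have h1 : ((n + 1 : ℕ) : ℕ∞) ≤ exitTime σ f t ω x := by
      refine le_iInf₂ fun k hk => ?_
      refine Nat.cast_le.mpr ?_
      by_contra hlt
      exact absurd (h k hk.1 (by omega)) (not_le.mpr hk.2)
    exact lt_of_lt_of_le (Nat.cast_lt.mpr (Nat.lt_succ_self n)) h1

/-- `U_n^{f,θ}(t) = ∫_X E[(t + perturbed walk at time n) θ ; exit time > n] ν(dx)`. -/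
def twistedU [Monoid G] [SMul G X] [MeasurableSpace G] [MeasurableSpace X]
    (μ : Measure G) [IsProbabilityMeasure μ] (ν : Measure X)
    (σ : G → X → ℝ) (f : ℕ → (ℕ → G) × X → ℝ) (θ : (ℕ → G) → ℝ) (n : ℕ) (t : ℝ) : ℝ :=
  ∫ x, ∫ ω in {ω | (n : ℕ∞) < exitTime σ f t ω x},
    (t + perturbedWalk σ f n ω x) * θ ω ∂(pathMeasure μ) ∂ν

/-- The path `(g_1, …, g_p, g'_{p+1}, g'_{p+2}, …)`. -/
def splice (p : ℕ) (ω ω' : ℕ → G) : ℕ → G :=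
  fun i => if i < p then ω i else ω' i

/-- Conditional expectation of `h` given the first `p` coordinates: the remaining coordinates are
integrated out. -/
def finiteApprox [MeasurableSpace G] (μ : Measure G) [IsProbabilityMeasure μ]
    (p : ℕ) (h : (ℕ → G) → ℝ) (ω : ℕ → G) : ℝ :=
  ∫ ω', h (splice p ω ω') ∂(pathMeasure μ)

/-- `C_α(f) = sup_n ∫∫ exp (α |f_n|) dP dν`. -/
def perturbMoment [MeasurableSpace G] [MeasurableSpace X] (μ : Measure G) [IsProbabilityMeasure μ]
    (ν : Measure X) (f : ℕ → (ℕ → G) × X → ℝ) (α : ℝ) : ℝ≥0∞ :=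
  ⨆ n : ℕ, ∫⁻ x, ∫⁻ ω, ENNReal.ofReal (Real.exp (α * |f n (ω, x)|)) ∂(pathMeasure μ) ∂ν

/-- `D_{α,β}(f) = sup_{n,p} exp (β p) (∫∫ exp (α |f_n - f_{n,p}|) dP dν - 1)`, where `f_{n,p}(·, x)`
is the conditional expectation of `f_n(·, x)` given the first `p` coordinates. -/
def perturbApprox [MeasurableSpace G] [MeasurableSpace X] (μ : Measure G) [IsProbabilityMeasure μ]
    (ν : Measure X) (f : ℕ → (ℕ → G) × X → ℝ) (α β : ℝ) : ℝ≥0∞ :=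
  ⨆ (n : ℕ) (p : ℕ), ENNReal.ofReal (Real.exp (β * p)) *
    ((∫⁻ x, ∫⁻ ω, ENNReal.ofReal
        (Real.exp (α * |f n (ω, x) - finiteApprox μ p (fun ω' => f n (ω', x)) ω|))
          ∂(pathMeasure μ) ∂ν) - 1)

/-- `N_β(θ) = sup_{p ≥ 0} exp (β p) E|θ - θ_p|`, where `θ_p` is the conditional expectation of `θ`
given the first `p` coordinates. -/
def twistApprox [MeasurableSpace G] (μ : Measure G) [IsProbabilityMeasure μ]
    (θ : (ℕ → G) → ℝ) (β : ℝ) : ℝ≥0∞ :=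
  ⨆ p : ℕ, ENNReal.ofReal (Real.exp (β * p)) *
    ∫⁻ ω, ENNReal.ofReal |θ ω - finiteApprox μ p θ ω| ∂(pathMeasure μ)

end FutureWalk

end

/-! Without perturbation or twist, optional stopping gives E(t + S_n; τ > n) = t − E(t + S_τ; τ ≤
n), which is nondecreasing in n. Here `f n ∘ T^n` and `θ` look into the future of the path, which
destroys the martingale property. The proof restores it approximately, scale by scale, and shows
that U_n is Cauchy in mean over unit intervals of t.

Between the times r^11 and (r + 1)^11, the perturbation and `θ` are replaced by their conditional
expectations looking only r steps ahead. The error is exponentially small in r, so it beats every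
power of r. For such a short perturbation, survival up to time k is known at time k + r. Replacing t
+ S̃_k by t + S_{k+r} then gives a martingale up to boundary terms of size r·H on the survival
event, where H bounds increments and perturbations (`abs_survivalMean_sub_le`). A gambler's ruin
estimate, `measureReal_survivors_le`, bounds the survival probability at time r^11 by a multiple of
(1 + |t|)/r^4. The variation of the mean over the block is therefore O((1 + |t|)/r^2), which is
summable in r (`exists_abs_survivalMean_sub_le`).

At a fixed t a small change of the walk may change the exit time. For a given path, however, this
affects only those t in an interval whose length is twice the error, so it is harmless after
averaging over t in [a, a + 1] (`integral_abs_survivalMean_sub_le`). This is why convergence is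
obtained in mean over t.

As `θ ≥ 0`, each U_n with n ≥ 1 is monotone in t, and so is the limit U (`exists_monotone_limit`).
The error is at most e_n (1 + |a|) on [a, a + 1] with e_n → 0, so U(t)/t inherits the limit E θ that
dominated convergence gives for each U_n(t)/t.

The argument runs on an abstract filtered probability space, using only sixteenth moments, a uniform
spreading property of the walk and the exponential approximation rates. The last sections verify
these for paths under `(pathMeasure μ).prod ν`. -/

noncomputable section

namespace FutureWalk

/-! ### Monotone functions converging in mean on unit intervals. -/

section MonotoneLimits

variable {u : ℕ → ℝ → ℝ} {e : ℕ → ℝ}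

theorem le_integral_of_monotone {g : ℝ → ℝ} (hg : Monotone g) (a : ℝ) :
    g a ≤ ∫ t in a..a + 1, g t := by
  have h := intervalIntegral.integral_mono_on (μ := volume) (a := a) (b := a + 1)
    (f := fun _ => g a) (g := g) (by linarith)
    (by simp) hg.intervalIntegrable (fun x hx => hg hx.1)
  simpa using h

theorem integral_le_of_monotone {g : ℝ → ℝ} (hg : Monotone g) (a : ℝ) :
    ∫ t in a..a + 1, g t ≤ g (a + 1) := by
  have h := intervalIntegral.integral_mono_on (μ := volume) (a := a) (b := a + 1)
    (f := g) (g := fun _ => g (a + 1)) (by linarith)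
    hg.intervalIntegrable (by simp) (fun x hx => hg hx.2)
  simpa using h

theorem intervalIntegrable_abs_sub {g h : ℝ → ℝ} (hg : Monotone g) (hh : Monotone h) (a b : ℝ) :
    IntervalIntegrable (fun t => |g t - h t|) volume a b :=
  (hg.intervalIntegrable.sub hh.intervalIntegrable).abs

/-- The average of a monotone function over `[a, a + 1]` lies between its end values, so closeness
in mean becomes a pointwise bound at the cost of a unit shift. -/
theorem le_of_integral_abs_sub_le {g h : ℝ → ℝ} (hg : Monotone g) (hh : Monotone h) {a c : ℝ}
    (hc : ∫ t in a..a + 1, |g t - h t| ≤ c) : g a ≤ h (a + 1) + c := by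
  have h1 := le_integral_of_monotone hg a
  have h2 := integral_le_of_monotone hh a
  have h3 : ∫ t in a..a + 1, g t ≤ ∫ t in a..a + 1, (h t + |g t - h t|) := by
    refine intervalIntegral.integral_mono_on (by linarith) hg.intervalIntegrable
      (hh.intervalIntegrable.add (intervalIntegrable_abs_sub hg hh _ _)) (fun x _ => ?_)
    linarith [le_abs_self (g x - h x)]
  rw [intervalIntegral.integral_add hh.intervalIntegrable
    (intervalIntegrable_abs_sub hg hh _ _)] at h3
  linarith

/-- A sequence of monotone functions that is Cauchy in mean on unit intervals has a monotone
limit in mean on unit intervals. -/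
theorem exists_monotone_limit (hmono : ∀ n, Monotone (u n))
    (hnonneg : ∀ n t, 0 ≤ u n t) (he : Tendsto e atTop (𝓝 0))
    (hcau : ∀ n n', n ≤ n' → ∀ a, ∫ t in a..a + 1, |u n t - u n' t| ≤ e n * (1 + |a|)) :
    ∃ U : ℝ → ℝ, Monotone U ∧ (∀ t, 0 ≤ U t) ∧
      ∀ n a, ∫ t in a..a + 1, |u n t - U t| ≤ e n * (1 + |a|) := by
  -- Along this subsequence the distances in mean are dominated by a geometric series, which forces
  -- convergence almost everywhere.
  obtain ⟨κ, hκ, hκe⟩ := extraction_forall_of_eventually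
    (P := fun j n => e n < (1 / 2 : ℝ) ^ j)
    (fun j => he.eventually_lt_const (by positivity))
  -- This bound, uniform in `j`, makes the limsup finite at every point and later provides the
  -- dominating constant.
  have hbd : ∀ j t, u (κ j) t ≤ u 0 (t + 1) + e 0 * (1 + |t|) := by
    intro j t
    refine le_of_integral_abs_sub_le (hmono _) (hmono _) ?_
    simpa only [abs_sub_comm] using hcau 0 (κ j) (Nat.zero_le _) t
  have hae : ∀ a : ℝ, ∀ᵐ t ∂(volume.restrict (Set.Ioc a (a + 1))),
      ∃ l : ℝ, Tendsto (fun j => u (κ j) t) atTop (𝓝 l) := by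
    intro a
    refine Lp.ae_tendsto_of_cauchy_eLpNorm (p := 1)
      (B := fun j => ENNReal.ofReal ((1 / 2 : ℝ) ^ j * (1 + |a|)))
      (fun n => (hmono _).measurable.aestronglyMeasurable) le_rfl ?_ ?_
    · exact ((summable_geometric_two).mul_right (1 + |a|)).tsum_ofReal_ne_top
    · have key : ∀ N n m : ℕ, N ≤ n → n ≤ m →
          eLpNorm (u (κ n) - u (κ m)) 1 (volume.restrict (Set.Ioc a (a + 1))) <
            ENNReal.ofReal ((1 / 2 : ℝ) ^ N * (1 + |a|)) := by
        intro N n m hN hnm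
        rw [eLpNorm_one_eq_lintegral_enorm]
        have hint := intervalIntegrable_abs_sub (hmono (κ n)) (hmono (κ m)) a (a + 1)
        rw [intervalIntegrable_iff_integrableOn_Ioc_of_le (by linarith)] at hint
        have hcongr : ∀ t, ‖(u (κ n) - u (κ m)) t‖ₑ
            = ENNReal.ofReal |u (κ n) t - u (κ m) t| := by
          intro t
          rw [Pi.sub_apply, Real.enorm_eq_ofReal_abs]
        simp_rw [hcongr]
        rw [← ofReal_integral_eq_lintegral_ofReal hint (ae_of_all _ fun _ => abs_nonneg _)]
        refine (ENNReal.ofReal_lt_ofReal_iff (by positivity)).mpr ?_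
        rw [← intervalIntegral.integral_of_le (by linarith)]
        refine (hcau _ _ (hκ.monotone hnm) a).trans_lt ?_
        have : e (κ n) < (1 / 2 : ℝ) ^ N :=
          (hκe n).trans_le (pow_le_pow_of_le_one (by norm_num) (by norm_num) hN)
        exact mul_lt_mul_of_pos_right this (by positivity)
      intro N n m hn hm
      rcases le_total n m with h | h
      · exact key N n m hn h
      · rw [eLpNorm_sub_comm]
        exact key N m n hm h
  have hae' : ∀ᵐ t : ℝ, ∃ l : ℝ, Tendsto (fun j => u (κ j) t) atTop (𝓝 l) := by
    rw [← Measure.restrict_univ (μ := (volume : Measure ℝ)), ← iUnion_Ioc_intCast ℝ,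
      ae_restrict_iUnion_iff]
    exact fun i => hae i
  have hbu : ∀ t, IsBoundedUnder (· ≤ ·) atTop (fun j => u (κ j) t) :=
    fun t => isBoundedUnder_of ⟨_, fun j => hbd j t⟩
  have hcb : ∀ t, IsCoboundedUnder (· ≤ ·) atTop (fun j => u (κ j) t) :=
    fun t => (isBoundedUnder_of (r := (· ≥ ·)) ⟨0, fun j => hnonneg _ t⟩).isCoboundedUnder_le
  have hlim : ∀ᵐ t : ℝ, Tendsto (fun j => u (κ j) t) atTop
      (𝓝 (limsup (fun j => u (κ j) t) atTop)) := by
    filter_upwards [hae'] with t ⟨l, hl⟩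
    rwa [hl.limsup_eq]
  -- Taking the limsup at every `t`, not only where the limit exists, yields a function that is
  -- monotone everywhere.
  have hUmono : Monotone fun t => limsup (fun j => u (κ j) t) atTop := fun s t hst =>
    limsup_le_limsup (Eventually.of_forall fun j => hmono _ hst) (hcb s) (hbu t)
  refine ⟨_, hUmono, fun t => ?_, fun n a => ?_⟩
  · exact le_limsup_of_frequently_le (Frequently.of_forall fun j => hnonneg _ t) (hbu t)
  · have hT : Tendsto (fun j => ∫ t in a..a + 1, |u n t - u (κ j) t|) atTop
        (𝓝 (∫ t in a..a + 1, |u n t - limsup (fun j => u (κ j) t) atTop|)) := by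
      refine intervalIntegral.tendsto_integral_filter_of_dominated_convergence
        (fun _ => u n (a + 1) + (u 0 (a + 1 + 1) + e 0 * (1 + |a + 1|)))
        (Eventually.of_forall fun j => ?_) (Eventually.of_forall fun j => ?_) (by simp) ?_
      · exact ((hmono n).measurable.sub (hmono _).measurable).abs.aestronglyMeasurable
      · refine ae_of_all _ fun t ht => ?_
        rw [Set.uIoc_of_le (by linarith)] at ht
        rw [Real.norm_eq_abs, abs_abs, abs_le]
        have h1 := hnonneg n t
        have h2 := hnonneg (κ j) t
        have h3 := hmono n ht.2
        have h4 := hmono (κ j) ht.2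
        have h5 := hbd j (a + 1)
        have h6 := hnonneg n (a + 1)
        have h7 := hnonneg (κ j) (a + 1)
        constructor <;> linarith
      · filter_upwards [hlim] with t ht _
        exact (tendsto_const_nhds.sub ht).abs
    refine le_of_tendsto hT ?_
    filter_upwards [eventually_ge_atTop n] with j hj
    exact hcau n (κ j) (hj.trans hκ.le_apply) a

theorem tendsto_integral_mul_of_mean {U φ : ℝ → ℝ} (hmono : ∀ n, Monotone (u n))
    (hU : Monotone U) (he : Tendsto e atTop (𝓝 0))
    (h : ∀ n a, ∫ t in a..a + 1, |u n t - U t| ≤ e n * (1 + |a|))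
    (hφ : Continuous φ) (hφc : HasCompactSupport φ) :
    Tendsto (fun n => ∫ t, φ t * u n t) atTop (𝓝 (∫ t, φ t * U t)) := by
  obtain ⟨B, hB⟩ := hφ.bounded_above_of_compact_support hφc
  obtain ⟨N, hN⟩ : ∃ N : ℕ, tsupport φ ⊆ Set.Ioc (-(N : ℝ)) N := by
    obtain ⟨r, hr⟩ := hφc.isBounded.subset_closedBall (0 : ℝ)
    obtain ⟨N, hN⟩ := exists_nat_gt r
    refine ⟨N, fun t ht => ?_⟩
    have := hr ht
    rw [mem_closedBall_zero_iff, Real.norm_eq_abs, abs_le] at this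
    exact ⟨by linarith, by linarith⟩
  have hint : ∀ g : ℝ → ℝ, Monotone g → Integrable fun t => φ t * g t := fun g hg =>
    hg.locallyIntegrable.integrable_smul_left_of_hasCompactSupport hφ hφc
  rw [tendsto_iff_norm_sub_tendsto_zero]
  have hB0 : 0 ≤ B := (norm_nonneg _).trans (hB 0)
  have hmain : ∀ n, ‖(∫ t, φ t * u n t) - ∫ t, φ t * U t‖ ≤
      B * ∑ i ∈ Finset.range (2 * N), e n * (1 + |(-N + i : ℝ)|) := by
    intro n
    rw [← integral_sub (hint _ (hmono n)) (hint _ hU)]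
    have hset : ∫ t, (φ t * u n t - φ t * U t) =
        ∫ t in (-(N : ℝ))..N, (φ t * u n t - φ t * U t) := by
      rw [intervalIntegral.integral_of_le (by linarith [(Nat.cast_nonneg N : (0 : ℝ) ≤ N)])]
      refine (setIntegral_eq_integral_of_forall_compl_eq_zero fun t ht => ?_).symm
      have : φ t = 0 := image_eq_zero_of_notMem_tsupport fun h => ht (hN h)
      simp [this]
    rw [hset]
    have hab : ∀ a b, IntervalIntegrable (fun t => |u n t - U t|) volume a b :=
      intervalIntegrable_abs_sub (hmono n) hU
    calc ‖∫ t in (-(N : ℝ))..N, (φ t * u n t - φ t * U t)‖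
        ≤ ∫ t in (-(N : ℝ))..N, B * |u n t - U t| := by
          refine intervalIntegral.norm_integral_le_of_norm_le
            (by linarith [(Nat.cast_nonneg N : (0 : ℝ) ≤ N)]) (ae_of_all _ fun t _ => ?_)
            ((hab _ _).const_mul B)
          rw [← mul_sub, norm_mul, Real.norm_eq_abs (u n t - U t)]
          exact mul_le_mul_of_nonneg_right (hB t) (abs_nonneg _)
      _ = B * ∫ t in (-(N : ℝ))..N, |u n t - U t| := intervalIntegral.integral_const_mul _ _
      _ = B * ∑ i ∈ Finset.range (2 * N), ∫ t in (-N + i : ℝ)..(-N + i + 1), |u n t - U t| := by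
          congr 1
          have := intervalIntegral.sum_integral_adjacent_intervals (μ := volume)
            (f := fun t => |u n t - U t|) (a := fun i : ℕ => (-N + i : ℝ)) (n := 2 * N)
            (fun k _ => hab _ _)
          simp only [Nat.cast_mul, Nat.cast_ofNat, Nat.cast_zero, add_zero, Nat.cast_add,
            Nat.cast_one, ← add_assoc] at this
          rw [this]
          congr 1
          ring
      _ ≤ _ := by
          refine mul_le_mul_of_nonneg_left (Finset.sum_le_sum fun i _ => h n _) hB0
  refine squeeze_zero (fun _ => norm_nonneg _) hmain ?_
  have : Tendsto (fun n => B * ∑ i ∈ Finset.range (2 * N), e n * (1 + |(-N + i : ℝ)|)) atTop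
      (𝓝 (B * ∑ i ∈ Finset.range (2 * N), 0 * (1 + |(-N + i : ℝ)|))) :=
    (tendsto_finsetSum _ fun i _ => he.mul_const _).const_mul B
  simpa using this

/-- Monotonicity sandwiches `U t` between `u n (t - 1)` and `u n (t + 1)` up to `e n * (1 + t)`.
After division by `t` the defect tends to `e n`, and `n` is arbitrary. -/
theorem tendsto_div_of_mean {U : ℝ → ℝ} {L : ℝ} (hmono : ∀ n, Monotone (u n))
    (hU : Monotone U) (he : Tendsto e atTop (𝓝 0))
    (h : ∀ n a, ∫ t in a..a + 1, |u n t - U t| ≤ e n * (1 + |a|))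
    (hL : ∀ n, Tendsto (fun t => u n t / t) atTop (𝓝 L)) :
    Tendsto (fun t => U t / t) atTop (𝓝 L) := by
  have hid : Tendsto (fun t : ℝ => 1 / t) atTop (𝓝 0) := by
    simpa using tendsto_inv_atTop_zero (𝕜 := ℝ)
  have hup : ∀ n, Tendsto (fun t => u n (t + 1) / (t + 1) * (1 + 1 / t) + e n * (1 + 1 / t))
      atTop (𝓝 (L * (1 + 0) + e n * (1 + 0))) := fun n =>
    (((hL n).comp (tendsto_atTop_add_const_right _ 1 tendsto_id)).mul
      (tendsto_const_nhds.add hid)).add ((tendsto_const_nhds.add hid).const_mul _)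
  have hlo : ∀ n, Tendsto (fun t => u n (t - 1) / (t - 1) * (1 - 1 / t) - e n * (1 + 1 / t))
      atTop (𝓝 (L * (1 - 0) - e n * (1 + 0))) := fun n =>
    (((hL n).comp (tendsto_atTop_add_const_right _ (-1) tendsto_id)).mul
      (tendsto_const_nhds.sub hid)).sub ((tendsto_const_nhds.add hid).const_mul _)
  have he0 : ∀ n, 0 ≤ e n := by
    intro n
    have h1 := h n 0
    have h2 : 0 ≤ ∫ t in (0 : ℝ)..0 + 1, |u n t - U t| :=
      intervalIntegral.integral_nonneg (by norm_num) fun _ _ => abs_nonneg _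
    simp only [abs_zero, add_zero, mul_one] at h1
    exact h2.trans h1
  rw [Metric.tendsto_nhds]
  intro ε hε
  obtain ⟨n, hn⟩ := (he.eventually_lt_const (show (0 : ℝ) < ε by exact hε)).exists
  filter_upwards [(hup n).eventually_lt_const (show L * (1 + 0) + e n * (1 + 0) < L + ε by linarith),
    (hlo n).eventually_const_lt (show L - ε < L * (1 - 0) - e n * (1 + 0) by linarith),
    eventually_gt_atTop 1] with t h1 h2 ht
  have ht0 : (0 : ℝ) < t := by linarith
  have hA : U t ≤ u n (t + 1) + e n * (1 + t) := by
    have h3 := h n t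
    simp_rw [abs_sub_comm (u n _)] at h3
    rw [abs_of_pos ht0] at h3
    exact le_of_integral_abs_sub_le hU (hmono n) h3
  have hB : u n (t - 1) ≤ U t + e n * (1 + t) := by
    have h3 := h n (t - 1)
    rw [abs_of_pos (by linarith : 0 < t - 1)] at h3
    have h4 := le_of_integral_abs_sub_le (hmono n) hU h3
    rw [sub_add_cancel] at h4
    nlinarith [he0 n]
  have hA' : U t / t ≤ u n (t + 1) / (t + 1) * (1 + 1 / t) + e n * (1 + 1 / t) := by
    have h5 : u n (t + 1) / (t + 1) * (1 + 1 / t) + e n * (1 + 1 / t)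
      = (u n (t + 1) + e n * (1 + t)) / t := by
      field_simp
      ring
    rw [h5]
    exact div_le_div_of_nonneg_right hA ht0.le
  have hB' : u n (t - 1) / (t - 1) * (1 - 1 / t) - e n * (1 + 1 / t) ≤ U t / t := by
    have h5 : u n (t - 1) / (t - 1) * (1 - 1 / t) - e n * (1 + 1 / t)
      = (u n (t - 1) - e n * (1 + t)) / t := by
      have : t - 1 ≠ 0 := by linarith
      field_simp
      ring
    rw [h5]
    exact div_le_div_of_nonneg_right (by linarith) ht0.le
  rw [Real.dist_eq, abs_lt]
  constructor <;> linarith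

end MonotoneLimits

/-! ### Survival of a centered walk: gambler's ruin. -/

section FluctuatingWalk

variable {Z : Type*}

/-- The points at which `t + W k` is non-negative for all `1 ≤ k ≤ n`. -/
def survivors (W : ℕ → Z → ℝ) (n : ℕ) (t : ℝ) : Set Z :=
  {z | ∀ k, 1 ≤ k → k ≤ n → 0 ≤ t + W k z}

/-- The mean of `(t + W n) θ` over the survivors. -/
def survivalMean [MeasurableSpace Z] (m : Measure Z) (θ : Z → ℝ) (W : ℕ → Z → ℝ) (n : ℕ) (t : ℝ) : ℝ :=
  ∫ z in survivors W n t, (t + W n z) * θ z ∂m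

theorem measurableSet_survivors {m' : MeasurableSpace Z} {W : ℕ → Z → ℝ} {n : ℕ} (t : ℝ)
    (hW : ∀ k, k ≤ n → Measurable[m'] (W k)) : MeasurableSet[m'] (survivors W n t) := by
  have : survivors W n t = ⋂ k ∈ Finset.Icc 1 n, {z | 0 ≤ t + W k z} := by
    ext z
    simp [survivors]
  rw [this]
  refine Finset.measurableSet_biInter _ fun k hk => ?_
  exact measurableSet_le measurable_const ((hW k (Finset.mem_Icc.mp hk).2).const_add t)

theorem survivors_anti {W : ℕ → Z → ℝ} {t : ℝ} {n n' : ℕ} (h : n ≤ n') :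
    survivors W n' t ⊆ survivors W n t := fun _ hz k h1 h2 => hz k h1 (h2.trans h)

variable [mZ : MeasurableSpace Z]

/-- A centered random walk with bounded sixteenth moments, adapted to a filtration, whose
increments over long time intervals of length `l` exceed `√l` with a uniformly positive
conditional probability. -/
structure IsFluctuatingWalk (m : Measure Z) (ℱ : Filtration ℕ mZ) (S : ℕ → Z → ℝ)
    (C ρ : ℝ) (l₀ : ℕ) : Prop where
  zero : ∀ z, S 0 z = 0
  adapted : ∀ k, Measurable[ℱ k] (S k)
  centered : ∀ k (h : Z → ℝ), Measurable[ℱ k] h → (∃ B, ∀ z, |h z| ≤ B) →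
    ∫ z, h z * (S (k + 1) z - S k z) ∂m = 0
  integrable_pow : ∀ k, Integrable (fun z => (S (k + 1) z - S k z) ^ 16) m
  moment : ∀ k, ∫ z, (S (k + 1) z - S k z) ^ 16 ∂m ≤ C
  ratio_nonneg : 0 ≤ ρ
  ratio_lt_one : ρ < 1
  spread : ∀ l, l₀ ≤ l → ∀ n A, MeasurableSet[ℱ n] A →
    m.real (A ∩ {z | |S (n + l) z - S n z| ≤ √(l : ℝ)}) ≤ ρ * m.real A

variable {m : Measure Z} {ℱ : Filtration ℕ mZ} {S : ℕ → Z → ℝ}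
  {C ρ : ℝ} {l₀ : ℕ}

theorem integrable_of_integrable_pow [IsFiniteMeasure m] {g : Z → ℝ} (hg : AEStronglyMeasurable g m)
    {q : ℕ} (hq : Even q) (hq' : q ≠ 0) (h : Integrable (fun z => g z ^ q) m) :
    Integrable g m := by
  refine Integrable.mono' ((integrable_const (1 : ℝ)).add h) hg (ae_of_all _ fun z => ?_)
  rw [Pi.add_apply, Real.norm_eq_abs, ← hq.pow_abs]
  rcases le_total |g z| 1 with h1 | h1
  · have := pow_nonneg (abs_nonneg (g z)) q
    linarith
  · have := le_self_pow₀ h1 hq'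
    linarith

namespace IsFluctuatingWalk

variable (hS : IsFluctuatingWalk m ℱ S C ρ l₀)
include hS

theorem measurable (k : ℕ) : Measurable (S k) := (hS.adapted k).mono (ℱ.le k) le_rfl

theorem adapted_of_le {k l : ℕ} (h : k ≤ l) : Measurable[ℱ l] (S k) :=
  (hS.adapted k).mono (ℱ.mono h) le_rfl

variable [IsProbabilityMeasure m]

theorem integrable_increment (k : ℕ) : Integrable (fun z => S (k + 1) z - S k z) m :=
  integrable_of_integrable_pow ((hS.measurable _).sub (hS.measurable _)).aestronglyMeasurable
    (by decide) (by decide) (hS.integrable_pow k)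

theorem integrable (k : ℕ) : Integrable (S k) m := by
  induction k with
  | zero =>
    rw [show S 0 = fun _ => 0 from funext hS.zero]
    exact integrable_zero _ _ _
  | succ k ih =>
    refine (ih.add (hS.integrable_increment k)).congr (ae_of_all _ fun z => ?_)
    simp

/-- The event for the first `J` blocks is known at time `J * l`, so `spread` makes each further
block cost a factor `ρ`. -/
theorem measureReal_blocks_le {l : ℕ} (hl : l₀ ≤ l) (J : ℕ) :
    m.real {z | ∀ j < J, |S (j * l + l) z - S (j * l) z| ≤ √(l : ℝ)} ≤ ρ ^ J := by
  induction J with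
  | zero => simp
  | succ J ih =>
    have hmeas : MeasurableSet[ℱ (J * l)]
        {z | ∀ j < J, |S (j * l + l) z - S (j * l) z| ≤ √(l : ℝ)} := by
      have : {z | ∀ j < J, |S (j * l + l) z - S (j * l) z| ≤ √(l : ℝ)} =
          ⋂ j ∈ Finset.range J, {z | |S (j * l + l) z - S (j * l) z| ≤ √(l : ℝ)} := by
        ext z
        simp
      rw [this]
      refine Finset.measurableSet_biInter _ fun j hj => ?_
      have hj' : j * l + l ≤ J * l := by
        have := Nat.mul_le_mul_right l (Finset.mem_range.mp hj)
        linarith [Nat.succ_mul j l]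
      have h1 : Measurable[ℱ (J * l)] fun z => |S (j * l + l) z - S (j * l) z| :=
        continuous_abs.measurable.comp
          ((hS.adapted_of_le hj').sub (hS.adapted_of_le ((Nat.le_add_right _ _).trans hj')))
      exact h1 measurableSet_Iic
    have hsub : {z | ∀ j < J + 1, |S (j * l + l) z - S (j * l) z| ≤ √(l : ℝ)} ⊆
        {z | ∀ j < J, |S (j * l + l) z - S (j * l) z| ≤ √(l : ℝ)} ∩
          {z | |S (J * l + l) z - S (J * l) z| ≤ √(l : ℝ)} := fun z hz =>
      ⟨fun j hj => hz j (by omega), hz J (by omega)⟩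
    calc _ ≤ _ := measureReal_mono hsub
      _ ≤ _ := hS.spread l hl _ _ hmeas
      _ ≤ ρ * ρ ^ J := mul_le_mul_of_nonneg_left ih hS.ratio_nonneg
      _ = ρ ^ (J + 1) := by ring

/-- A gambler's ruin estimate: the walk leaves the interval `[0, R]` before time `n` with high
probability, and it leaves through the top with probability at most of order `y / R`. -/
theorem measureReal_survivors_le {y R : ℝ} (hy : 0 ≤ y) (hR : 0 ≤ R) {n l J : ℕ} (hl : l₀ ≤ l)
    (hlR : R ≤ √(l : ℝ)) (hJ : J * l ≤ n) {H : Z → ℝ} (hH : Integrable H m)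
    (hXH : ∀ k < n, ∀ z, |S (k + 1) z - S k z| ≤ H z) (hH0 : ∀ z, 0 ≤ H z) :
    R * m.real (survivors S n y) ≤ y + ∫ z, H z ∂m + R * ρ ^ J := by
  classical
  have hHint : 0 ≤ ∫ z, H z ∂m := integral_nonneg hH0
  have hρJ : 0 ≤ R * ρ ^ J := mul_nonneg hR (pow_nonneg hS.ratio_nonneg _)
  rcases lt_or_ge R y with hyR | hyR
  · have : R * m.real (survivors S n y) ≤ R * 1 :=
      mul_le_mul_of_nonneg_left measureReal_le_one hR
    linarith
  -- `D k`: the walk from `y` has stayed in `[0, R]`. `A k`: it has merely stayed non-negative.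
  let D : ℕ → Set Z := fun k => {z | ∀ j ≤ k, 0 ≤ y + S j z ∧ y + S j z ≤ R}
  let A : ℕ → Set Z := fun k => survivors S k y
  have hDA : ∀ k, D k ⊆ A k := fun k z hz j _ hj => (hz j hj).1
  have hAm : ∀ k, MeasurableSet (A k) := fun k =>
    measurableSet_survivors y fun j _ => hS.measurable j
  have hDm' : ∀ k, MeasurableSet[ℱ k] (D k) := by
    intro k
    have : D k = ⋂ j ∈ Finset.range (k + 1), {z | y + S j z ∈ Set.Icc 0 R} := by
      ext z
      simp [D]
    rw [this]
    refine Finset.measurableSet_biInter _ fun j hj => ?_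
    exact ((hS.adapted_of_le (Nat.lt_succ_iff.mp (Finset.mem_range.mp hj))).const_add y)
      measurableSet_Icc
  have hDm : ∀ k, MeasurableSet (D k) := fun k => ℱ.le k _ (hDm' k)
  -- A supermartingale: the walk while in `[0, R]`, frozen at `R` after an upward exit, and set to
  -- `-H` on becoming negative. An upward exit lands above `R`; a downward one lands above `-H`,
  -- because a single step is at most `H`. So `Ψ` never exceeds the walk at the exit.
  let Ψ : ℕ → Z → ℝ := fun k z =>
    if z ∈ D k then y + S k z else if z ∈ A k then R else -H z
  have hΨi : ∀ k, Integrable (Ψ k) m := by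
    intro k
    have : Ψ k = fun z => (D k).indicator (fun z => y + S k z) z +
        ((A k \ D k).indicator (fun _ => R) z + (A k)ᶜ.indicator (fun z => -H z) z) := by
      ext z
      by_cases h1 : z ∈ D k
      · simp [Ψ, h1, hDA k h1]
      · by_cases h2 : z ∈ A k <;> simp [Ψ, h1, h2]
    rw [this]
    exact (((integrable_const y).add (hS.integrable k)).indicator (hDm k)).add
      (((integrable_const R).indicator ((hAm k).diff (hDm k))).add
        (hH.neg.indicator (hAm k).compl))
  have hstep : ∀ k < n, ∫ z, Ψ (k + 1) z ∂m ≤ ∫ z, Ψ k z ∂m := by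
    intro k hk
    have hc := hS.centered k ((D k).indicator fun _ => (1 : ℝ))
      (measurable_const.indicator (hDm' k)) ⟨1, fun z => by
        by_cases h : z ∈ D k <;> simp [h]⟩
    have hXi : Integrable (fun z => (D k).indicator (fun _ => (1 : ℝ)) z *
        (S (k + 1) z - S k z)) m := by
      refine ((hS.integrable_increment k).indicator (hDm k)).congr (ae_of_all _ fun z => ?_)
      by_cases h : z ∈ D k <;> simp [h]
    have hle : ∫ z, Ψ (k + 1) z ∂m ≤ ∫ z, (Ψ k z + (D k).indicator (fun _ => (1 : ℝ)) z *
        (S (k + 1) z - S k z)) ∂m := by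
      refine integral_mono (hΨi _) ((hΨi k).add hXi) fun z => ?_
      have hX := abs_le.mp (hXH k hk z)
      have hH0z := hH0 z
      have hAs : z ∈ A (k + 1) → z ∈ A k := fun h => survivors_anti (Nat.le_succ k) h
      have hDs : z ∈ D (k + 1) → z ∈ D k := fun h j hj => h j (by omega)
      by_cases h1 : z ∈ D k
      · have h1k := h1 k le_rfl
        have hA1 : 0 ≤ y + S (k + 1) z → z ∈ A (k + 1) := by
          intro h0 j hj1 hj
          rcases Nat.lt_or_ge j (k + 1) with h | h
          · exact (h1 j (by omega)).1
          · rwa [show j = k + 1 by omega]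
        have hA2 : z ∈ A (k + 1) → 0 ≤ y + S (k + 1) z := fun h => h (k + 1) (by omega) le_rfl
        have hD1 : 0 ≤ y + S (k + 1) z → y + S (k + 1) z ≤ R → z ∈ D (k + 1) := by
          intro h0 h0' j hj
          rcases Nat.lt_or_ge j (k + 1) with h | h
          · exact h1 j (by omega)
          · rw [show j = k + 1 by omega]
            exact ⟨h0, h0'⟩
        by_cases h2 : z ∈ D (k + 1)
        · simp [Ψ, h1, h2]
        · by_cases h3 : z ∈ A (k + 1)
          · simp only [Ψ, h1, h2, h3, if_true, if_false, Set.indicator_of_mem, one_mul]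
            by_contra h4
            exact h2 (hD1 (hA2 h3) (by linarith))
          · simp only [Ψ, h1, h2, h3, if_true, if_false, Set.indicator_of_mem, one_mul]
            linarith
      · have h2 : z ∉ D (k + 1) := fun h => h1 (hDs h)
        by_cases h3 : z ∈ A (k + 1)
        · simp [Ψ, h1, h2, h3, hAs h3]
        · by_cases h4 : z ∈ A k
          · simp [Ψ, h1, h2, h3, h4]
            linarith
          · simp [Ψ, h1, h2, h3, h4]
    rw [integral_add (hΨi k) hXi, hc, add_zero] at hle
    exact hle
  have h0 : ∫ z, Ψ 0 z ∂m = y := by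
    have : Ψ 0 = fun _ => y := by
      ext z
      have : z ∈ D 0 := by
        intro j hj
        rw [Nat.le_zero.mp hj, hS.zero]
        constructor <;> linarith
      simp [Ψ, this, hS.zero]
    simp [this]
  have hΨle : ∀ k, k ≤ n → ∫ z, Ψ k z ∂m ≤ y := by
    intro k
    induction k with
    | zero => exact fun _ => h0.le
    | succ k ih => exact fun hk => (hstep k (by omega)).trans (ih (by omega))
  have hlow : ∫ z, ((A n \ D n).indicator (fun _ => R) z - H z) ∂m ≤ ∫ z, Ψ n z ∂m := by
    refine integral_mono (((integrable_const R).indicator ((hAm n).diff (hDm n))).sub hH)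
      (hΨi n) fun z => ?_
    have hH0z := hH0 z
    by_cases h1 : z ∈ D n
    · have := (h1 n le_rfl).1
      simp [Ψ, h1]
      linarith
    · by_cases h2 : z ∈ A n <;> simp [Ψ, h1, h2, hH0z]
  rw [integral_sub ((integrable_const R).indicator ((hAm n).diff (hDm n))) hH,
    integral_indicator_const _ ((hAm n).diff (hDm n)), smul_eq_mul] at hlow
  -- Two points of `[0, R]` differ by at most `R ≤ √l`, so staying there makes every block increment
  -- small.
  have hDρ : m.real (D n) ≤ ρ ^ J := by
    suffices hsub : D n ⊆ {z | ∀ j < J, |S (j * l + l) z - S (j * l) z| ≤ √(l : ℝ)} from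
      (measureReal_mono hsub).trans (hS.measureReal_blocks_le hl J)
    intro z hz j hj
    have hj' : j * l + l ≤ n := by
      have := Nat.mul_le_mul_right l hj
      linarith [Nat.succ_mul j l]
    have h1 := hz (j * l + l) hj'
    have h2 := hz (j * l) (by omega)
    rw [abs_le]
    constructor <;> linarith
  have hAD : m.real (A n) ≤ m.real (A n \ D n) + m.real (D n) := by
    refine le_trans (measureReal_mono fun z hz => ?_) (measureReal_union_le _ _)
    by_cases h : z ∈ D n
    · exact Or.inr h
    · exact Or.inl ⟨hz, h⟩
  have h1 := hΨle n le_rfl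
  have h2 : R * m.real (A n) ≤ R * (m.real (A n \ D n) + ρ ^ J) :=
    mul_le_mul_of_nonneg_left (by linarith) hR
  have h3 : R * m.real (A n) ≤ m.real (A n \ D n) * R + R * ρ ^ J := by linarith
  change R * m.real (A n) ≤ _
  linarith

end IsFluctuatingWalk

end FluctuatingWalk

/-! ### Perturbations looking a bounded number of steps ahead. -/

section Perturbation

variable {Z : Type*}

/-- The walk `S` perturbed by `Y k - Y 0`. -/
def perturbed (S Y : ℕ → Z → ℝ) (k : ℕ) (z : Z) : ℝ := S k z + Y k z - Y 0 z

/-- The sum of the sixteenth powers of the first `N` increments of `S` and of the first `N`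
values of `Y`. -/
def envelopeMass (S Y : ℕ → Z → ℝ) (N : ℕ) (z : Z) : ℝ :=
  ∑ j ∈ Finset.range N, ((S (j + 1) z - S j z) ^ 16 + Y j z ^ 16)

/-- A bound for the first `N` increments of `S` and the first `N` values of `Y` which is
mostly equal to `r`. -/
def envelope (S Y : ℕ → Z → ℝ) (N r : ℕ) (z : Z) : ℝ := r + envelopeMass S Y N z / (r : ℝ) ^ 15

theorem envelopeMass_nonneg (S Y : ℕ → Z → ℝ) (N : ℕ) (z : Z) : 0 ≤ envelopeMass S Y N z :=
  Finset.sum_nonneg fun j _ => add_nonneg (Even.pow_nonneg (by decide) _)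
    (Even.pow_nonneg (by decide) _)

theorem envelope_nonneg (S Y : ℕ → Z → ℝ) (N r : ℕ) (z : Z) : 0 ≤ envelope S Y N r z :=
  add_nonneg (Nat.cast_nonneg _) (div_nonneg (envelopeMass_nonneg S Y N z) (by positivity))

theorem pow_le_envelopeMass (S Y : ℕ → Z → ℝ) {N j : ℕ} (hj : j < N) (z : Z) :
    (S (j + 1) z - S j z) ^ 16 + Y j z ^ 16 ≤ envelopeMass S Y N z :=
  Finset.single_le_sum (f := fun j => (S (j + 1) z - S j z) ^ 16 + Y j z ^ 16)
    (fun j _ => add_nonneg (Even.pow_nonneg (by decide) _) (Even.pow_nonneg (by decide) _))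
    (Finset.mem_range.mpr hj)

/-- If `|a| > r` then `|a| ≤ |a| ^ 16 / r ^ 15`. The sixteenth moment thus makes the excess over
`r`, summed over a window of order `r ^ 11`, of mean order `r ^ (-4)`. -/
theorem abs_le_of_pow_le {a g r : ℝ} (hr : 0 < r) (h : a ^ 16 ≤ g) : |a| ≤ r + g / r ^ 15 := by
  rw [← Even.pow_abs (by decide : Even 16)] at h
  have hg : 0 ≤ g := (pow_nonneg (abs_nonneg a) _).trans h
  rcases le_total |a| r with h1 | h1
  · have : 0 ≤ g / r ^ 15 := by positivity
    linarith
  · have h2 : |a| ≤ g / r ^ 15 := by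
      rw [le_div_iff₀ (by positivity)]
      calc |a| * r ^ 15 ≤ |a| * |a| ^ 15 := by gcongr
        _ = |a| ^ 16 := by ring
        _ ≤ g := h
    linarith

theorem abs_increment_le_envelope (S Y : ℕ → Z → ℝ) {N r j : ℕ} (hr : 1 ≤ r) (hj : j < N) (z : Z) :
    |S (j + 1) z - S j z| ≤ envelope S Y N r z :=
  abs_le_of_pow_le (by exact_mod_cast hr) <| le_trans
    (le_add_of_nonneg_right (Even.pow_nonneg (by decide) _)) (pow_le_envelopeMass S Y hj z)

theorem abs_le_envelope (S Y : ℕ → Z → ℝ) {N r j : ℕ} (hr : 1 ≤ r) (hj : j < N) (z : Z) :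
    |Y j z| ≤ envelope S Y N r z :=
  abs_le_of_pow_le (by exact_mod_cast hr) <| le_trans
    (le_add_of_nonneg_left (Even.pow_nonneg (by decide) _)) (pow_le_envelopeMass S Y hj z)

theorem abs_sub_le_mul {S : ℕ → Z → ℝ} {N : ℕ} {z : Z} {H : ℝ}
    (h : ∀ j < N, |S (j + 1) z - S j z| ≤ H) (k p : ℕ) (hkp : k + p ≤ N) :
    |S (k + p) z - S k z| ≤ p * H := by
  induction p with
  | zero => simp
  | succ p ih =>
    have h1 := abs_le.mp (ih (by omega))
    have h2 := abs_le.mp (h (k + p) (by omega))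
    rw [← add_assoc, abs_le]
    push_cast
    constructor <;> linarith

variable [mZ : MeasurableSpace Z]

/-- A perturbation that looks at most `p` steps into the future. -/
structure IsShortPerturbation (m : Measure Z) (ℱ : Filtration ℕ mZ) (Y : ℕ → Z → ℝ)
    (C : ℝ) (p : ℕ) : Prop where
  adapted : ∀ k, Measurable[ℱ (k + p)] (Y k)
  integrable_pow : ∀ k, Integrable (fun z => Y k z ^ 16) m
  moment : ∀ k, ∫ z, Y k z ^ 16 ∂m ≤ C

namespace IsShortPerturbation

variable {m : Measure Z} {ℱ : Filtration ℕ mZ} {Y : ℕ → Z → ℝ} {C : ℝ} {p : ℕ}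
  (hY : IsShortPerturbation m ℱ Y C p)
include hY

theorem measurable (k : ℕ) : Measurable (Y k) := (hY.adapted k).mono (ℱ.le _) le_rfl

theorem integrable [IsProbabilityMeasure m] (k : ℕ) : Integrable (Y k) m :=
  integrable_of_integrable_pow (hY.measurable k).aestronglyMeasurable (by decide) (by decide)
    (hY.integrable_pow k)

end IsShortPerturbation

/-- The length of the time window used at scale `r`. -/
def window (r : ℕ) : ℕ := (r + 1) ^ 11 + r + 1

/-- The constant is 2050 = 2^11 + 1 + 1. -/
theorem window_le {r : ℕ} (hr : 1 ≤ r) : (window r : ℝ) ≤ 2050 * (r : ℝ) ^ 11 := by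
  have h1 : (1 : ℝ) ≤ r := by exact_mod_cast hr
  have h2 : (r + 1 : ℝ) ^ 11 ≤ (2 * r) ^ 11 := by
    gcongr
    linarith
  have h3 : (r : ℝ) ≤ (r : ℝ) ^ 11 := le_self_pow₀ h1 (by norm_num)
  have h4 : (1 : ℝ) ≤ (r : ℝ) ^ 11 := one_le_pow₀ h1
  rw [mul_pow] at h2
  rw [window]
  push_cast
  norm_num at h2 ⊢
  linarith

variable {m : Measure Z} {ℱ : Filtration ℕ mZ} {S Y : ℕ → Z → ℝ}
  {C ρ : ℝ} {l₀ : ℕ} {θ : Z → ℝ} {B : ℝ} {r : ℕ}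

theorem integrable_envelopeMass (hS : IsFluctuatingWalk m ℱ S C ρ l₀)
    (hY : IsShortPerturbation m ℱ Y C r) (N : ℕ) : Integrable (envelopeMass S Y N) m :=
  integrable_finsetSum _ fun j _ => (hS.integrable_pow j).add (hY.integrable_pow j)

theorem measurable_perturbed_adapted (hS : IsFluctuatingWalk m ℱ S C ρ l₀)
    (hY : IsShortPerturbation m ℱ Y C r) {k l : ℕ} (h : k + r ≤ l) :
    Measurable[ℱ l] (perturbed S Y k) :=
  ((hS.adapted_of_le ((Nat.le_add_right k r).trans h)).add
    ((hY.adapted k).mono (ℱ.mono h) le_rfl)).sub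
      ((hY.adapted 0).mono (ℱ.mono (by omega)) le_rfl)

theorem integral_envelopeMass_le (hS : IsFluctuatingWalk m ℱ S C ρ l₀)
    (hY : IsShortPerturbation m ℱ Y C r) (hr : 1 ≤ r) :
    ∫ z, envelopeMass S Y (window r) z ∂m ≤ 4100 * C * (r : ℝ) ^ 11 := by
  have hC : 0 ≤ C := (integral_nonneg fun z => Even.pow_nonneg (by decide) _).trans (hY.moment 0)
  have hi : ∀ j, Integrable (fun z => (S (j + 1) z - S j z) ^ 16 + Y j z ^ 16) m := fun j =>
    (hS.integrable_pow j).add (hY.integrable_pow j)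
  unfold envelopeMass
  rw [integral_finsetSum _ fun j _ => hi j]
  calc _ ≤ ∑ j ∈ Finset.range (window r), (C + C) := by
        refine Finset.sum_le_sum fun j _ => ?_
        rw [integral_add (hS.integrable_pow j) (hY.integrable_pow j)]
        exact add_le_add (hS.moment j) (hY.moment j)
    _ = window r * (2 * C) := by
        rw [Finset.sum_const, Finset.card_range, nsmul_eq_mul]
        ring
    _ ≤ 2050 * (r : ℝ) ^ 11 * (2 * C) :=
        mul_le_mul_of_nonneg_right (window_le hr) (by linarith)
    _ = _ := by ring

variable [IsProbabilityMeasure m]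

theorem integrable_envelope (hS : IsFluctuatingWalk m ℱ S C ρ l₀)
    (hY : IsShortPerturbation m ℱ Y C r) (N : ℕ) : Integrable (envelope S Y N r) m :=
  (integrable_const _).add ((integrable_envelopeMass hS hY N).div_const _)

theorem setIntegral_envelope_le (hS : IsFluctuatingWalk m ℱ S C ρ l₀)
    (hY : IsShortPerturbation m ℱ Y C r) (hr : 1 ≤ r) {A : Set Z} :
    ∫ z in A, envelope S Y (window r) r z ∂m ≤ r * m.real A + 4100 * C / (r : ℝ) ^ 4 := by
  have hG := integrable_envelopeMass hS hY (window r)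
  have h1 : ∫ z in A, envelopeMass S Y (window r) z ∂m ≤ 4100 * C * (r : ℝ) ^ 11 :=
    (setIntegral_le_integral hG (ae_of_all _ fun z => envelopeMass_nonneg S Y _ z)).trans
      (integral_envelopeMass_le hS hY hr)
  have hr0 : (0 : ℝ) < r := by exact_mod_cast hr
  unfold envelope
  rw [integral_add (integrable_const _) (hG.integrableOn.div_const _), integral_div,
    setIntegral_const, smul_eq_mul, mul_comm]
  refine add_le_add le_rfl ?_
  calc _ ≤ 4100 * C * (r : ℝ) ^ 11 / (r : ℝ) ^ 15 :=
        div_le_div_of_nonneg_right h1 (by positivity)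
    _ = 4100 * C / (r : ℝ) ^ 4 := by
      rw [div_eq_div_iff (by positivity) (by positivity)]
      ring

/-- Unless the envelope mass reaches `r ^ 16`, an event of probability O(r^(-5)) by Markov, all
perturbation values are at most `r`, so survival of the perturbed walk implies survival of `S`
started at `|t| + 2 * r`. Gambler's ruin with height `r ^ 5` then gives order r / r^5. -/
theorem exists_measureReal_survivors_perturbed_le (hS : IsFluctuatingWalk m ℱ S C ρ l₀) :
    ∃ K, 0 ≤ K ∧ ∀ r, 1 ≤ r → ∀ Y, IsShortPerturbation m ℱ Y C r → ∀ t,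
      m.real (survivors (perturbed S Y) (r ^ 11) t) * (r : ℝ) ^ 4 ≤ K * (1 + |t|) := by
  -- `K₁` absorbs the term `R * ρ ^ J` of the ruin estimate, with `R = r ^ 5` and `J = r`.
  obtain ⟨K₁, hK₁⟩ := (tendsto_pow_const_mul_const_pow_of_abs_lt_one 5
    (by rw [abs_of_nonneg hS.ratio_nonneg]; exact hS.ratio_lt_one)).bddAbove_range
  have hK₁' : ∀ r : ℕ, (r : ℝ) ^ 5 * ρ ^ r ≤ K₁ := fun r => hK₁ ⟨r, rfl⟩
  have hK₁0 : 0 ≤ K₁ := by simpa using hK₁' 0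
  have hC : 0 ≤ C := (integral_nonneg fun z => Even.pow_nonneg (by decide) _).trans (hS.moment 0)
  refine ⟨3 + 8200 * C + K₁ + (l₀ : ℝ) ^ 4, by positivity, fun r hr Y hY t => ?_⟩
  have hr1 : (1 : ℝ) ≤ r := by exact_mod_cast hr
  have hr0 : (0 : ℝ) < r := by linarith
  have ht := abs_nonneg t
  -- For the finitely many `r < l₀` the trivial bound 1 on the probability suffices, whence `l₀ ^ 4`
  -- in the constant.
  rcases lt_or_ge r l₀ with hrl | hrl
  · have h1 : (r : ℝ) ^ 4 ≤ (l₀ : ℝ) ^ 4 := by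
      gcongr
    have h2 : m.real (survivors (perturbed S Y) (r ^ 11) t) * (r : ℝ) ^ 4 ≤ 1 * (r : ℝ) ^ 4 :=
      mul_le_mul_of_nonneg_right measureReal_le_one (by positivity)
    have h3 : 0 ≤ (3 + 8200 * C + K₁ + (l₀ : ℝ) ^ 4) * |t| := by positivity
    nlinarith
  let G := envelopeMass S Y (window r)
  have hsub : survivors (perturbed S Y) (r ^ 11) t ⊆
      survivors S (r ^ 11) (|t| + 2 * r) ∪ {z | (r : ℝ) ^ 16 ≤ G z} := by
    intro z hz
    by_cases hG : (r : ℝ) ^ 16 ≤ G z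
    · exact Or.inr hG
    · refine Or.inl fun k hk1 hk => ?_
      push Not at hG
      have hb : ∀ j < window r, |Y j z| ≤ r := by
        intro j hj
        have h1 : |Y j z| ^ 16 ≤ (r : ℝ) ^ 16 := by
          rw [Even.pow_abs (by decide)]
          refine le_trans ?_ hG.le
          exact (le_add_of_nonneg_left (Even.pow_nonneg (by decide) _)).trans
            (pow_le_envelopeMass S Y hj z)
        exact le_of_pow_le_pow_left₀ (by norm_num) hr0.le h1
      have hkw : k < window r := by
        have : r ^ 11 ≤ (r + 1) ^ 11 := Nat.pow_le_pow_left (Nat.le_succ r) 11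
        unfold window
        omega
      have h1 := abs_le.mp (hb k hkw)
      have h2 := abs_le.mp (hb 0 (by unfold window; omega))
      have h3 := hz k hk1 hk
      unfold perturbed at h3
      linarith [le_abs_self t]
  have h1 : m.real (survivors (perturbed S Y) (r ^ 11) t) ≤
      m.real (survivors S (r ^ 11) (|t| + 2 * r)) + m.real {z | (r : ℝ) ^ 16 ≤ G z} :=
    (measureReal_mono hsub).trans (measureReal_union_le _ _)
  have h2 : (r : ℝ) ^ 16 * m.real {z | (r : ℝ) ^ 16 ≤ G z} ≤ 4100 * C * (r : ℝ) ^ 11 :=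
    (mul_meas_ge_le_integral_of_nonneg (ae_of_all _ fun z => envelopeMass_nonneg S Y _ z)
      (integrable_envelopeMass hS hY _) _).trans (integral_envelopeMass_le hS hY hr)
  have h2' : (r : ℝ) ^ 5 * m.real {z | (r : ℝ) ^ 16 ≤ G z} ≤ 4100 * C := by
    refine le_of_mul_le_mul_left (a := (r : ℝ) ^ 11) ?_ (by positivity)
    calc _ = (r : ℝ) ^ 16 * m.real {z | (r : ℝ) ^ 16 ≤ G z} := by ring
      _ ≤ _ := h2
      _ = _ := by ring
  have hsqrt : √((r ^ 10 : ℕ) : ℝ) = (r : ℝ) ^ 5 := by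
    rw [Nat.cast_pow, show (r : ℝ) ^ 10 = ((r : ℝ) ^ 5) ^ 2 by ring]
    exact Real.sqrt_sq (by positivity)
  -- Time `r ^ 11` is cut into `r` blocks of length `r ^ 10`, whose square root `r ^ 5` is the
  -- height of the interval.
  have h3 := hS.measureReal_survivors_le (y := |t| + 2 * r) (R := (r : ℝ) ^ 5) (n := r ^ 11)
    (l := r ^ 10) (J := r) (H := envelope S Y (window r) r) (by positivity) (by positivity)
    (hrl.trans (Nat.le_self_pow (by norm_num) r)) hsqrt.ge (by rw [← pow_succ'])
    (integrable_envelope hS hY _)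
    (fun k hk z => abs_increment_le_envelope S Y hr (by
      have : r ^ 11 ≤ (r + 1) ^ 11 := Nat.pow_le_pow_left (Nat.le_succ r) 11
      unfold window
      omega) z)
    (envelope_nonneg S Y _ _)
  have h4 := setIntegral_envelope_le hS hY hr (A := Set.univ)
  rw [setIntegral_univ, probReal_univ, mul_one] at h4
  have h5 : 4100 * C / (r : ℝ) ^ 4 ≤ 4100 * C := div_le_self (by positivity) (one_le_pow₀ hr1)
  have h6 := hK₁' r
  have h7 : (r : ℝ) ^ 5 * m.real (survivors (perturbed S Y) (r ^ 11) t) ≤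
      |t| + 3 * r + 8200 * C + K₁ := by
    have := mul_le_mul_of_nonneg_left h1 (show (0 : ℝ) ≤ (r : ℝ) ^ 5 by positivity)
    linarith
  refine le_of_mul_le_mul_left (a := (r : ℝ)) ?_ hr0
  calc (r : ℝ) * (m.real (survivors (perturbed S Y) (r ^ 11) t) * (r : ℝ) ^ 4)
      = (r : ℝ) ^ 5 * m.real (survivors (perturbed S Y) (r ^ 11) t) := by ring
    _ ≤ |t| + 3 * r + 8200 * C + K₁ := h7
    _ ≤ r * (|t| + 3 + 8200 * C + K₁) := by nlinarith
    _ ≤ r * ((3 + 8200 * C + K₁ + (l₀ : ℝ) ^ 4) * (1 + |t|)) := by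
        have : 0 ≤ (2 + 8200 * C + K₁ + (l₀ : ℝ) ^ 4) * |t| := by positivity
        have : 0 ≤ (l₀ : ℝ) ^ 4 := by positivity
        gcongr
        nlinarith

/-- Optional stopping delayed by `r`: survival at time `k` and `θ` are both `ℱ (k + r)`-measurable,
so the next increment of `S` integrates to zero against them. Only the paths that exit contribute,
with overshoot at most `(r + 3) * H`. The factor 3 counts the two replacements of the perturbed walk
by `S (k + r)` and the telescoped exits. -/
theorem abs_survivalMean_sub_le (hS : IsFluctuatingWalk m ℱ S C ρ l₀)
    (hY : IsShortPerturbation m ℱ Y C r) (hθ : Measurable[ℱ r] θ) (hθB : ∀ z, |θ z| ≤ B)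
    {H : Z → ℝ} (hH : Integrable H m) (hH0 : ∀ z, 0 ≤ H z) {N : ℕ}
    (hXH : ∀ j < N, ∀ z, |S (j + 1) z - S j z| ≤ H z) (hYH : ∀ j < N, ∀ z, |Y j z| ≤ H z)
    (t : ℝ) {n n' : ℕ} (hn : 1 ≤ n) (hnn' : n ≤ n') (hN : n' + r < N) :
    |survivalMean m θ (perturbed S Y) n' t - survivalMean m θ (perturbed S Y) n t| ≤
      3 * B * (r + 3) * ∫ z in survivors (perturbed S Y) n t, H z ∂m := by
  have hB0 : 0 ≤ B := by
    obtain ⟨z⟩ := nonempty_of_isProbabilityMeasure m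
    exact (abs_nonneg _).trans (hθB z)
  have hθm : Measurable θ := hθ.mono (ℱ.le _) le_rfl
  have hAm' : ∀ k, MeasurableSet[ℱ (k + r)] (survivors (perturbed S Y) k t) := fun k =>
    measurableSet_survivors t fun j hj => measurable_perturbed_adapted hS hY (by omega)
  have hAm : ∀ k, MeasurableSet (survivors (perturbed S Y) k t) := fun k => ℱ.le _ _ (hAm' k)
  have hmul : ∀ g : Z → ℝ, Integrable g m → Integrable (fun z => g z * θ z) m := fun g hg =>
    hg.mul_bdd (c := B) hθm.aestronglyMeasurable (ae_of_all _ hθB)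
  have hFi : ∀ k l, IntegrableOn (fun z => (t + S l z) * θ z)
      (survivors (perturbed S Y) k t) m := fun k l =>
    (hmul _ ((integrable_const t).add (hS.integrable l))).integrableOn
  have hWi : ∀ k, Integrable (perturbed S Y k) m := fun k =>
    ((hS.integrable k).add (hY.integrable k)).sub (hY.integrable 0)
  have hMi : ∀ k l, IntegrableOn (fun z => (t + perturbed S Y l z) * θ z)
      (survivors (perturbed S Y) k t) m := fun k l =>
    (hmul _ ((integrable_const t).add (hWi l))).integrableOn
  let b : ℕ → ℝ := fun k => ∫ z in survivors (perturbed S Y) k t, (t + S (k + r) z) * θ z ∂m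
  let I : ℕ → ℝ := fun k => ∫ z in survivors (perturbed S Y) k t, H z ∂m
  have hI : ∀ k, n ≤ k → I k ≤ I n := fun k hk =>
    setIntegral_mono_set hH.integrableOn (ae_of_all _ hH0)
      (LE.le.eventuallyLE (survivors_anti hk))
  have hI0 : ∀ k, 0 ≤ I k := fun k => setIntegral_nonneg (hAm k) fun z _ => hH0 z
  have hcomp : ∀ k, k + r < N → |survivalMean m θ (perturbed S Y) k t - b k| ≤
      B * (r + 3) * I k := by
    intro k hk
    simp only [survivalMean, b, I]
    rw [← integral_sub (hMi k k) (hFi k (k + r)), ← integral_const_mul, ← Real.norm_eq_abs]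
    refine norm_integral_le_of_norm_le (hH.integrableOn.const_mul _) (ae_of_all _ fun z => ?_)
    rw [← sub_mul, norm_mul, Real.norm_eq_abs, Real.norm_eq_abs]
    have h1 := abs_le.mp (abs_sub_le_mul (S := S) (z := z) (fun j hj => hXH j hj z) k r hk.le)
    have h2 := abs_le.mp (hYH k (by omega) z)
    have h3 := abs_le.mp (hYH 0 (by omega) z)
    have h4 : |t + perturbed S Y k z - (t + S (k + r) z)| ≤ (r + 3) * H z := by
      have := hH0 z
      unfold perturbed
      rw [abs_le]
      constructor <;> linarith
    calc _ ≤ ((r + 3) * H z) * B :=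
          mul_le_mul h4 (hθB z) (abs_nonneg _) (mul_nonneg (by positivity) (hH0 z))
      _ = _ := by ring
  -- The condition `1 ≤ k` is needed because `survivors` puts no constraint on time 0, while the
  -- overshoot bound uses non-negativity at time `k`.
  have hstep : ∀ k, 1 ≤ k → k + 1 + r < N → |b (k + 1) - b k| ≤ B * (r + 3) * (I k - I (k + 1)) := by
    intro k hk1 hk
    have hc := hS.centered (k + r) ((survivors (perturbed S Y) k t).indicator θ)
      ((hθ.mono (ℱ.mono (by omega)) le_rfl).indicator (hAm' k))
      ⟨B, fun z => by
        by_cases h : z ∈ survivors (perturbed S Y) k t <;> simp [h, hθB z, hB0]⟩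
    have hXi : Integrable (fun z => (survivors (perturbed S Y) k t).indicator θ z *
        (S (k + r + 1) z - S (k + r) z)) m := by
      refine ((hmul _ (hS.integrable_increment (k + r))).indicator (hAm k)).congr
        (ae_of_all _ fun z => ?_)
      by_cases h : z ∈ survivors (perturbed S Y) k t <;> simp [h, mul_comm]
    have hb : ∀ k, b k = ∫ z, (survivors (perturbed S Y) k t).indicator
        (fun z => (t + S (k + r) z) * θ z) z ∂m := fun k => (integral_indicator (hAm k)).symm
    have hIk : ∀ k, I k = ∫ z, (survivors (perturbed S Y) k t).indicator H z ∂m :=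
      fun k => (integral_indicator (hAm k)).symm
    have hbi : ∀ k, Integrable ((survivors (perturbed S Y) k t).indicator
        (fun z => (t + S (k + r) z) * θ z)) m := fun k =>
      (integrable_indicator_iff (hAm k)).mpr (hFi k _)
    have e1 : b (k + 1) - b k = ∫ z, ((survivors (perturbed S Y) (k + 1) t).indicator
        (fun z => (t + S (k + 1 + r) z) * θ z) z - (survivors (perturbed S Y) k t).indicator
        (fun z => (t + S (k + r) z) * θ z) z - (survivors (perturbed S Y) k t).indicator θ z *
        (S (k + r + 1) z - S (k + r) z)) ∂m := by
      have hd := (hbi (k + 1)).sub (hbi k)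
      simp only [Pi.sub_def] at hd
      rw [integral_sub hd hXi, hc, sub_zero, integral_sub (hbi _) (hbi _), hb, hb]
    rw [e1, hIk, hIk, ← integral_sub (hH.indicator (hAm _)) (hH.indicator (hAm _)),
      ← integral_const_mul, ← Real.norm_eq_abs]
    refine norm_integral_le_of_norm_le
      (((hH.indicator (hAm _)).sub (hH.indicator (hAm _))).const_mul _) (ae_of_all _ fun z => ?_)
    by_cases h1 : z ∈ survivors (perturbed S Y) k t
    · by_cases h2 : z ∈ survivors (perturbed S Y) (k + 1) t
      · simp only [h1, h2, Set.indicator_of_mem, sub_self, mul_zero]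
        rw [show k + 1 + r = k + r + 1 by omega, norm_le_zero_iff]
        ring
      · simp only [h1, h2, Set.indicator_of_mem, Set.indicator_of_notMem, not_false_eq_true,
          sub_zero, zero_sub]
        have h3 := h1 k hk1 le_rfl
        have h4 : t + perturbed S Y (k + 1) z < 0 := by
          by_contra h5
          refine h2 fun j hj1 hj => ?_
          rcases Nat.lt_or_ge j (k + 1) with h | h
          · exact h1 j hj1 (by omega)
          · rw [show j = k + 1 by omega]
            exact not_lt.mp h5
        unfold perturbed at h3 h4
        have h5 := abs_le.mp (hXH k (by omega) z)
        have h6 := abs_le.mp (hYH k (by omega) z)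
        have h7 := abs_le.mp (hYH 0 (by omega) z)
        have h8 := abs_le.mp (hYH (k + 1) (by omega) z)
        have h9 := abs_le.mp (abs_sub_le_mul (S := S) (z := z) (fun j hj => hXH j hj z)
          (k + 1) r hk.le)
        -- The perturbed walk changes sign between `k` and `k + 1`. One increment and two values of
        -- `Y` bound `t + S (k + 1)` by `3 * H`, and `r` further increments add `r * H`.
        have h10 : |t + S (k + 1 + r) z| ≤ (r + 3) * H z := by
          rw [abs_le]
          constructor <;> linarith
        have e2 : -((t + S (k + r) z) * θ z) - θ z * (S (k + r + 1) z - S (k + r) z) =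
            -((t + S (k + 1 + r) z) * θ z) := by
          rw [show k + 1 + r = k + r + 1 by omega]
          ring
        rw [e2, norm_neg, norm_mul, Real.norm_eq_abs, Real.norm_eq_abs]
        calc _ ≤ ((r + 3) * H z) * B :=
              mul_le_mul h10 (hθB z) (abs_nonneg _) (mul_nonneg (by positivity) (hH0 z))
          _ = _ := by ring
    · have h2 : z ∉ survivors (perturbed S Y) (k + 1) t := fun h =>
        h1 (survivors_anti (Nat.le_succ k) h)
      simp [h1, h2]
  have htel : ∀ k, n ≤ k → k + r < N → |b k - b n| ≤ B * (r + 3) * (I n - I k) := by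
    intro k hk
    induction k, hk using Nat.le_induction with
    | base => simp
    | succ k hk ih =>
      intro hkN
      have h1 := abs_le.mp (ih (by omega))
      have h2 := abs_le.mp (hstep k (hn.trans hk) hkN)
      rw [abs_le]
      constructor <;> linarith
  have h1 := abs_le.mp (hcomp n (by omega))
  have h2 := abs_le.mp (hcomp n' hN)
  have h3 := abs_le.mp (htel n' hnn' hN)
  have h4 : B * (r + 3) * I n' ≤ B * (r + 3) * I n :=
    mul_le_mul_of_nonneg_left (hI n' hnn') (by positivity)
  have h5 : 0 ≤ B * (r + 3) * I n' := mul_nonneg (by positivity) (hI0 n')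
  change _ ≤ 3 * B * (r + 3) * I n
  rw [abs_le]
  constructor <;> linarith

/-- The factor `r + 3` multiplies `r * P + O(r^(-4))`, where `P` is the survival probability, of
order `(1 + |t|) / r ^ 4`. The product is of order `(1 + |t|) / r ^ 2`. -/
theorem exists_abs_survivalMean_sub_le (hS : IsFluctuatingWalk m ℱ S C ρ l₀) (hB : 0 ≤ B) :
    ∃ K, 0 ≤ K ∧ ∀ r, 1 ≤ r → ∀ Y, IsShortPerturbation m ℱ Y C r → ∀ θ : Z → ℝ,
      Measurable[ℱ r] θ → (∀ z, |θ z| ≤ B) → ∀ n, r ^ 11 ≤ n → n ≤ (r + 1) ^ 11 → ∀ t,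
      |survivalMean m θ (perturbed S Y) n t - survivalMean m θ (perturbed S Y) (r ^ 11) t| *
        (r : ℝ) ^ 2 ≤ K * (1 + |t|) := by
  obtain ⟨K, hK0, hK⟩ := exists_measureReal_survivors_perturbed_le hS
  have hC : 0 ≤ C := (integral_nonneg fun z => Even.pow_nonneg (by decide) _).trans (hS.moment 0)
  refine ⟨12 * B * (K + 4100 * C), by positivity, fun r hr Y hY θ hθ hθB n hn hn' t => ?_⟩
  have hr1 : (1 : ℝ) ≤ r := by exact_mod_cast hr
  have hr0 : (0 : ℝ) < r := by linarith
  have h1 := abs_survivalMean_sub_le hS hY hθ hθB (integrable_envelope hS hY (window r))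
    (envelope_nonneg S Y _ _) (N := window r)
    (fun j hj z => abs_increment_le_envelope S Y hr hj z)
    (fun j hj z => abs_le_envelope S Y hr hj z) t (Nat.one_le_pow _ _ hr) hn
    (by unfold window; omega)
  have h2 := setIntegral_envelope_le hS hY hr (A := survivors (perturbed S Y) (r ^ 11) t)
  have h3 := hK r hr Y hY t
  set P := m.real (survivors (perturbed S Y) (r ^ 11) t)
  have hP : 0 ≤ P := measureReal_nonneg
  have h4 : (r * P + 4100 * C / (r : ℝ) ^ 4) * (r : ℝ) ^ 3 ≤ (K + 4100 * C) * (1 + |t|) := by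
    have e : (r * P + 4100 * C / (r : ℝ) ^ 4) * (r : ℝ) ^ 3 = P * (r : ℝ) ^ 4 + 4100 * C / r := by
      field_simp
    rw [e]
    have h5 : 4100 * C / r ≤ 4100 * C := div_le_self (by positivity) hr1
    have h6 : 0 ≤ 4100 * C * |t| := by positivity
    linarith
  calc _ ≤ (3 * B * (r + 3) * (r * P + 4100 * C / (r : ℝ) ^ 4)) * (r : ℝ) ^ 2 := by
        refine mul_le_mul_of_nonneg_right (h1.trans ?_) (by positivity)
        exact mul_le_mul_of_nonneg_left h2 (by positivity)
    _ ≤ (3 * B * (4 * r) * (r * P + 4100 * C / (r : ℝ) ^ 4)) * (r : ℝ) ^ 2 := by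
        gcongr
        linarith
    _ = 12 * B * ((r * P + 4100 * C / (r : ℝ) ^ 4) * (r : ℝ) ^ 3) := by ring
    _ ≤ 12 * B * ((K + 4100 * C) * (1 + |t|)) := by gcongr
    _ = _ := by ring

end Perturbation

/-! ### Stability of the survival mean, averaged over the starting level. -/

section Approximation

variable {Z : Type*}

/-- For a given path, survival is a threshold condition on `t`, the threshold being the maximum of
`-W k`. -/
theorem exists_mem_survivors_iff_le (W : ℕ → Z → ℝ) {n : ℕ} (hn : 1 ≤ n) (z : Z) :
    ∃ M, ∀ t, z ∈ survivors W n t ↔ M ≤ t := by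
  refine ⟨(Finset.Icc 1 n).sup' (Finset.nonempty_Icc.mpr hn) fun k => -W k z, fun t => ?_⟩
  rw [Finset.sup'_le_iff]
  simp only [survivors, Set.mem_ofPred_eq, Finset.mem_Icc, and_imp]
  refine forall_congr' fun k => forall_congr' fun _ => forall_congr' fun _ => ?_
  constructor <;> intro h <;> linarith

theorem survivors_mono (W : ℕ → Z → ℝ) (n : ℕ) {s t : ℝ} (h : s ≤ t) :
    survivors W n s ⊆ survivors W n t := fun z hz k h1 h2 => by linarith [hz k h1 h2]

/-- The values of `t` for which exactly one of two nearby walks survives form a short interval. -/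
theorem exists_subset_Icc_of_survivors_ne {W W' : ℕ → Z → ℝ} {n : ℕ} (hn : 1 ≤ n) {z : Z} {δ : ℝ}
    (h : ∀ k, k ≤ n → |W k z - W' k z| ≤ δ) :
    ∃ M, {t | ¬(z ∈ survivors W n t ↔ z ∈ survivors W' n t)} ⊆ Set.Icc (M - δ) (M + δ) := by
  obtain ⟨M, hM⟩ := exists_mem_survivors_iff_le W' hn z
  have h1 : ∀ t, z ∈ survivors W n t → z ∈ survivors W' n (t + δ) := fun t ht k hk1 hk => by
    have := ht k hk1 hk
    linarith [(abs_le.mp (h k hk)).2]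
  have h2 : ∀ t, z ∈ survivors W' n (t - δ) → z ∈ survivors W n t := fun t ht k hk1 hk => by
    have := ht k hk1 hk
    linarith [(abs_le.mp (h k hk)).1]
  refine ⟨M, fun t ht => ?_⟩
  have hδ : 0 ≤ δ := (abs_nonneg _).trans (h 1 hn)
  rw [Set.mem_ofPred_eq] at ht
  by_contra hc
  rw [Set.mem_Icc, not_and_or, not_le, not_le] at hc
  rcases hc with hc | hc
  · have h3 : z ∉ survivors W' n t := fun h => by linarith [(hM t).mp h]
    have h4 : z ∉ survivors W n t := fun h => by linarith [(hM _).mp (h1 t h)]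
    exact ht (iff_of_false h4 h3)
  · have h3 : z ∈ survivors W' n t := (hM t).mpr (by linarith)
    have h4 : z ∈ survivors W n t := h2 t ((hM _).mpr (by linarith))
    exact ht (iff_of_true h4 h3)

variable [mZ : MeasurableSpace Z] {m : Measure Z} {W W' : ℕ → Z → ℝ} {θ θ' : Z → ℝ} {n : ℕ}
  {B : ℝ}

theorem survivalMean_eq_integral_indicator (hW : ∀ k, Measurable (W k)) (t : ℝ) :
    survivalMean m θ W n t =
      ∫ z, (survivors W n t).indicator (fun z => (t + W n z) * θ z) z ∂m :=
  (integral_indicator (measurableSet_survivors t fun k _ => hW k)).symm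

theorem survivalMean_nonneg (hn : 1 ≤ n) (hW : ∀ k, Measurable (W k)) (hθ0 : ∀ z, 0 ≤ θ z)
    (t : ℝ) : 0 ≤ survivalMean m θ W n t :=
  setIntegral_nonneg (measurableSet_survivors t fun k _ => hW k)
    fun z hz => mul_nonneg (hz n hn le_rfl) (hθ0 z)

variable [IsProbabilityMeasure m]

theorem integrable_add_mul (hWi : Integrable (W n) m) (hθ : Measurable θ)
    (hθB : ∀ z, |θ z| ≤ B) (t : ℝ) : Integrable (fun z => (t + W n z) * θ z) m :=
  ((integrable_const t).add hWi).mul_bdd (c := B) hθ.aestronglyMeasurable (ae_of_all _ hθB)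

theorem integrable_indicator_survivors (hW : ∀ k, Measurable (W k)) (hWi : Integrable (W n) m)
    (hθ : Measurable θ) (hθB : ∀ z, |θ z| ≤ B) (t : ℝ) :
    Integrable ((survivors W n t).indicator (fun z => (t + W n z) * θ z)) m :=
  (integrable_add_mul hWi hθ hθB t).indicator (measurableSet_survivors t fun k _ => hW k)

/-- Raising `t` increases the integrand on survivors and enlarges the survival event, on which the
integrand is non-negative once `1 ≤ n`. -/
theorem monotone_survivalMean (hn : 1 ≤ n) (hW : ∀ k, Measurable (W k))
    (hWi : Integrable (W n) m) (hθ : Measurable θ) (hθ0 : ∀ z, 0 ≤ θ z) (hθB : ∀ z, |θ z| ≤ B) :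
    Monotone (survivalMean m θ W n) := by
  intro s t hst
  rw [survivalMean_eq_integral_indicator hW, survivalMean_eq_integral_indicator hW]
  refine integral_mono (integrable_indicator_survivors hW hWi hθ hθB s)
    (integrable_indicator_survivors hW hWi hθ hθB t) fun z => ?_
  by_cases h1 : z ∈ survivors W n s
  · simp only [h1, survivors_mono W n hst h1, Set.indicator_of_mem]
    exact mul_le_mul_of_nonneg_right (by linarith) (hθ0 z)
  · simp only [h1, Set.indicator_of_notMem, not_false_eq_true]
    exact Set.indicator_nonneg (fun z (hz : z ∈ survivors W n t) =>
      mul_nonneg (hz n hn le_rfl) (hθ0 z)) z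

/-- By Fubini, the disagreement between the two survival events costs, for each path, only the
length `2 * Δ z` of a set of levels `t`. The third `Δ` comes from replacing `W n` by `W' n` in the
integrand. -/
theorem integral_abs_survivalMean_sub_le (hn : 1 ≤ n) (hW : ∀ k, Measurable (W k))
    (hW' : ∀ k, Measurable (W' k)) (hWi : Integrable (W n) m) (hWi' : Integrable (W' n) m)
    (hθ : Measurable θ) (hθ' : Measurable θ') (hθB : ∀ z, |θ z| ≤ B) (hθB' : ∀ z, |θ' z| ≤ B)
    {Δ : Z → ℝ} (hΔ : ∀ k, k ≤ n → ∀ z, |W k z - W' k z| ≤ Δ z)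
    (hint : Integrable (fun z => (1 + |W' n z|) * Δ z) m) (a : ℝ) :
    ∫ t in a..a + 1, |survivalMean m θ W n t - survivalMean m θ' W' n t| ≤
      (1 + |a|) * ∫ z, (1 + |W' n z|) * (3 * B * Δ z + |θ z - θ' z|) ∂m := by
  classical
  have hB0 : 0 ≤ B := by
    obtain ⟨z⟩ := nonempty_of_isProbabilityMeasure m
    exact (abs_nonneg _).trans (hθB z)
  have hΔ0 : ∀ z, 0 ≤ Δ z := fun z => (abs_nonneg _).trans (hΔ n le_rfl z)
  set Q : Z → ℝ := fun z => 1 + |W' n z| with hQ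
  have hQm : Measurable Q := (continuous_abs.measurable.comp (hW' n)).const_add 1
  have hQi : Integrable Q m := (integrable_const _).add hWi'.abs
  have hQ1 : ∀ z, 1 ≤ Q z := fun z => le_add_of_nonneg_right (abs_nonneg _)
  have hη : Integrable (fun z => Q z * |θ z - θ' z|) m := by
    refine hQi.mul_bdd (c := 2 * B)
      (continuous_abs.measurable.comp (hθ.sub hθ')).aestronglyMeasurable (ae_of_all _ fun z => ?_)
    rw [Real.norm_eq_abs, abs_abs]
    have h1 := abs_le.mp (hθB z)
    have h2 := abs_le.mp (hθB' z)
    rw [abs_le]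
    constructor <;> linarith
  -- Pairs of a level and a path on which exactly one of the two walks survives.
  let V : Set (ℝ × Z) := {p | ¬(p.2 ∈ survivors W n p.1 ↔ p.2 ∈ survivors W' n p.1)}
  have hsm : ∀ W : ℕ → Z → ℝ, (∀ k, Measurable (W k)) →
      MeasurableSet {p : ℝ × Z | p.2 ∈ survivors W n p.1} := by
    intro W hW
    have : {p : ℝ × Z | p.2 ∈ survivors W n p.1} =
        survivors (fun k (p : ℝ × Z) => p.1 + W k p.2) n 0 := by
      ext p
      simp [survivors]
    rw [this]
    exact measurableSet_survivors 0 fun k _ => measurable_fst.add ((hW k).comp measurable_snd)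
  have hV : MeasurableSet V := ((hsm W hW).iff (hsm W' hW')).compl
  let E : ℝ × Z → ℝ := V.indicator fun p => Q p.2
  have hEi : Integrable E ((volume.restrict (Set.Ioc a (a + 1))).prod m) :=
    (hQi.comp_snd _).indicator hV
  let F : Z → ℝ := fun z => B * (Q z * Δ z) + (1 + |a|) * (Q z * |θ z - θ' z|)
  have hFi : Integrable F m := (hint.const_mul _).add (hη.const_mul _)
  have hpt : ∀ t ∈ Set.Ioc a (a + 1), ∀ z,
      |(survivors W n t).indicator (fun z => (t + W n z) * θ z) z -
        (survivors W' n t).indicator (fun z => (t + W' n z) * θ' z) z| ≤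
      F z + B * (1 + |a|) * E (t, z) := by
    intro t ht z
    have hta : |t + W' n z| ≤ (1 + |a|) * Q z := by
      have h1 := abs_add_le t (W' n z)
      have h2 : |t| ≤ 1 + |a| := by
        have := le_abs_self a
        have := neg_abs_le a
        rw [abs_le]
        constructor <;> linarith [ht.1, ht.2]
      have h3 : 0 ≤ |a| * |W' n z| := by positivity
      simp only [hQ]
      linarith
    have hd := hΔ n le_rfl z
    have hQΔ : Δ z ≤ Q z * Δ z := le_mul_of_one_le_left (hΔ0 z) (hQ1 z)
    have hf1 : B * Δ z ≤ B * (Q z * Δ z) := mul_le_mul_of_nonneg_left hQΔ hB0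
    have hη0 : 0 ≤ (1 + |a|) * (Q z * |θ z - θ' z|) := by
      have := (hQ1 z)
      positivity
    have hQ0 : 0 ≤ B * (1 + |a|) * Q z := by
      have := (hQ1 z)
      positivity
    have hBΔ : 0 ≤ B * Δ z := mul_nonneg hB0 (hΔ0 z)
    have hWθ : |(W n z - W' n z) * θ z| ≤ B * Δ z := by
      rw [abs_mul, mul_comm B]
      exact mul_le_mul hd (hθB z) (abs_nonneg _) (hΔ0 z)
    have hbound : ∀ c, |c| ≤ B → |(t + W' n z) * c| ≤ B * (1 + |a|) * Q z := by
      intro c hc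
      rw [abs_mul]
      calc _ ≤ (1 + |a|) * Q z * B := mul_le_mul hta hc (abs_nonneg _) ((abs_nonneg _).trans hta)
        _ = _ := by ring
    by_cases h1 : z ∈ survivors W n t <;> by_cases h2 : z ∈ survivors W' n t
    · have hE : E (t, z) = 0 := Set.indicator_of_notMem (by simp [V, h1, h2]) _
      rw [hE, mul_zero, add_zero, Set.indicator_of_mem h1, Set.indicator_of_mem h2,
        show (t + W n z) * θ z - (t + W' n z) * θ' z =
          (W n z - W' n z) * θ z + (t + W' n z) * (θ z - θ' z) by ring]
      refine (abs_add_le _ _).trans (add_le_add (hWθ.trans hf1) ?_)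
      rw [abs_mul, ← mul_assoc]
      exact mul_le_mul_of_nonneg_right hta (abs_nonneg _)
    · have hE : E (t, z) = Q z := Set.indicator_of_mem (by simp [V, h1, h2]) _
      rw [hE, Set.indicator_of_mem h1, Set.indicator_of_notMem h2, sub_zero,
        show (t + W n z) * θ z = (W n z - W' n z) * θ z + (t + W' n z) * θ z by ring]
      have h3 := (abs_add_le ((W n z - W' n z) * θ z) ((t + W' n z) * θ z)).trans
        (add_le_add hWθ (hbound _ (hθB z)))
      simp only [F]
      linarith
    · have hE : E (t, z) = Q z := Set.indicator_of_mem (by simp [V, h1, h2]) _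
      rw [hE, Set.indicator_of_notMem h1, Set.indicator_of_mem h2, zero_sub, abs_neg]
      have h3 := hbound _ (hθB' z)
      simp only [F]
      linarith
    · have hE : 0 ≤ E (t, z) := Set.indicator_nonneg (fun p _ => by linarith [hQ1 p.2]) _
      have : 0 ≤ B * (1 + |a|) * E (t, z) := by positivity
      rw [Set.indicator_of_notMem h1, Set.indicator_of_notMem h2, sub_zero, abs_zero]
      simp only [F]
      linarith
  have hEz : ∀ t, Integrable (fun z => E (t, z)) m := fun t =>
    hQi.indicator (measurable_prodMk_left hV)
  have hle : ∀ t ∈ Set.Ioc a (a + 1),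
      |survivalMean m θ W n t - survivalMean m θ' W' n t| ≤
        ∫ z, F z ∂m + B * (1 + |a|) * ∫ z, E (t, z) ∂m := by
    intro t ht
    rw [survivalMean_eq_integral_indicator hW, survivalMean_eq_integral_indicator hW',
      ← integral_sub (integrable_indicator_survivors hW hWi hθ hθB t)
        (integrable_indicator_survivors hW' hWi' hθ' hθB' t), ← integral_const_mul,
      ← integral_add hFi ((hEz t).const_mul _), ← Real.norm_eq_abs]
    exact norm_integral_le_of_norm_le (hFi.add ((hEz t).const_mul _))
      (ae_of_all _ fun z => hpt t ht z)
  have hswap : ∫ t in Set.Ioc a (a + 1), ∫ z, E (t, z) ∂m ≤ ∫ z, 2 * (Q z * Δ z) ∂m := by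
    rw [integral_integral_swap (f := fun t z => E (t, z)) hEi]
    refine integral_mono hEi.integral_prod_right (hint.const_mul 2) fun z => ?_
    obtain ⟨M, hM⟩ := exists_subset_Icc_of_survivors_ne hn (fun k hk => hΔ k hk z)
    have hVz : MeasurableSet {t | (t, z) ∈ V} := measurable_prodMk_right hV
    have e1 : ∀ t, E (t, z) = {t | (t, z) ∈ V}.indicator (fun _ => Q z) t := fun t => rfl
    simp_rw [e1]
    rw [integral_indicator_const _ hVz, smul_eq_mul]
    have h1 : (volume.restrict (Set.Ioc a (a + 1))).real {t | (t, z) ∈ V} ≤ 2 * Δ z := by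
      have h2 : (volume.restrict (Set.Ioc a (a + 1))) {t | (t, z) ∈ V} ≤
          ENNReal.ofReal (2 * Δ z) := by
        calc _ ≤ volume {t | (t, z) ∈ V} := Measure.restrict_le_self _
          _ ≤ volume (Set.Icc (M - Δ z) (M + Δ z)) := measure_mono hM
          _ = _ := by
            rw [Real.volume_Icc]
            congr 1
            ring
      exact ENNReal.toReal_le_of_le_ofReal (by linarith [hΔ0 z]) h2
    have hQz := hQ1 z
    calc _ ≤ 2 * Δ z * Q z := mul_le_mul_of_nonneg_right h1 (by linarith)
      _ = _ := by ring
  have hiI : IntegrableOn (fun t => ∫ z, F z ∂m + B * (1 + |a|) * ∫ z, E (t, z) ∂m)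
      (Set.Ioc a (a + 1)) := (integrable_const _).add (hEi.integral_prod_left.const_mul _)
  rw [intervalIntegral.integral_of_le (by linarith)]
  calc _ ≤ ∫ t in Set.Ioc a (a + 1), (∫ z, F z ∂m + B * (1 + |a|) * ∫ z, E (t, z) ∂m) := by
        refine integral_mono_of_nonneg (ae_of_all _ fun _ => abs_nonneg _) hiI ?_
        exact (ae_restrict_iff' measurableSet_Ioc).mpr (ae_of_all _ hle)
    _ = ∫ z, F z ∂m + B * (1 + |a|) * ∫ t in Set.Ioc a (a + 1), ∫ z, E (t, z) ∂m := by
        rw [integral_add (integrable_const _) (hEi.integral_prod_left.const_mul _),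
          integral_const_mul]
        simp
    _ ≤ ∫ z, F z ∂m + B * (1 + |a|) * ∫ z, 2 * (Q z * Δ z) ∂m := by gcongr
    _ = ∫ z, (F z + B * (1 + |a|) * (2 * (Q z * Δ z))) ∂m := by
        have h3 := (hint.const_mul 2).const_mul (B * (1 + |a|))
        rw [integral_add hFi h3, integral_const_mul (B * (1 + |a|))]
    _ ≤ ∫ z, (1 + |a|) * (Q z * (3 * B * Δ z + |θ z - θ' z|)) ∂m := by
        have h3 : Integrable (fun z => Q z * (3 * B * Δ z + |θ z - θ' z|)) m := by
          refine ((hint.const_mul (3 * B)).add hη).congr (ae_of_all _ fun z => ?_)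
          simp only [Pi.add_apply]
          ring
        refine integral_mono (hFi.add ((hint.const_mul 2).const_mul _)) (h3.const_mul _)
          fun z => ?_
        have h4 : 0 ≤ |a| * (B * (Q z * Δ z)) := by
          have := hΔ0 z
          have := hQ1 z
          positivity
        simp only [F]
        linarith
    _ = _ := integral_const_mul _ _

end Approximation

/-! ### Variation of the survival mean over one block of times. -/

section Convergence

variable {Z : Type*} [mZ : MeasurableSpace Z]

/-- A perturbation `Y` and a twist `θ` that are exponentially well approximated by quantities
looking only `p` steps into the future. -/
structure IsApproximable (m : Measure Z) (ℱ : Filtration ℕ mZ) (Y : ℕ → Z → ℝ)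
    (Yp : ℕ → ℕ → Z → ℝ) (θ : Z → ℝ) (θp : ℕ → Z → ℝ) (C B β : ℝ) : Prop where
  rate_pos : 0 < β
  measurable : ∀ k, Measurable (Y k)
  integrable : ∀ k, Integrable (Y k) m
  short : ∀ p, IsShortPerturbation m ℱ (Yp p) C p
  integrable_sq : ∀ p k, Integrable (fun z => (Y k z - Yp p k z) ^ 2) m
  error : ∀ p k, ∫ z, (Y k z - Yp p k z) ^ 2 ∂m ≤ C * Real.exp (-β * p)
  twist_measurable : Measurable θ
  twist_nonneg : ∀ z, 0 ≤ θ z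
  twist_le : ∀ z, θ z ≤ B
  twist_adapted : ∀ p, Measurable[ℱ p] (θp p)
  twist_approx_nonneg : ∀ p z, 0 ≤ θp p z
  twist_approx_le : ∀ p z, θp p z ≤ B
  twist_error : ∀ p, ∫ z, |θ z - θp p z| ∂m ≤ C * Real.exp (-β * p)

variable {m : Measure Z} {ℱ : Filtration ℕ mZ} {S Y : ℕ → Z → ℝ}
  {Yp : ℕ → ℕ → Z → ℝ} {θ : Z → ℝ} {θp : ℕ → Z → ℝ} {C ρ B β : ℝ} {l₀ : ℕ}

namespace IsApproximable

variable (hS : IsFluctuatingWalk m ℱ S C ρ l₀) (hA : IsApproximable m ℱ Y Yp θ θp C B β)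

include hA in
theorem abs_twist_le (z : Z) : |θ z| ≤ B := by
  rw [abs_of_nonneg (hA.twist_nonneg z)]
  exact hA.twist_le z

include hA in
theorem abs_twist_approx_le (p : ℕ) (z : Z) : |θp p z| ≤ B := by
  rw [abs_of_nonneg (hA.twist_approx_nonneg p z)]
  exact hA.twist_approx_le p z

include hA in
theorem twist_approx_measurable (p : ℕ) : Measurable (θp p) :=
  (hA.twist_adapted p).mono (ℱ.le _) le_rfl

include hS hA

theorem measurable_perturbed (k : ℕ) : Measurable (perturbed S Y k) :=
  ((hS.measurable k).add (hA.measurable k)).sub (hA.measurable 0)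

theorem measurable_perturbed_approx (p k : ℕ) : Measurable (perturbed S (Yp p) k) :=
  ((hS.measurable k).add ((hA.short p).measurable k)).sub ((hA.short p).measurable 0)

variable [IsProbabilityMeasure m]

omit hS in
theorem bound_nonneg : 0 ≤ B := by
  obtain ⟨z⟩ := nonempty_of_isProbabilityMeasure m
  exact (hA.twist_nonneg z).trans (hA.twist_le z)

theorem integrable_perturbed (k : ℕ) : Integrable (perturbed S Y k) m :=
  ((hS.integrable k).add (hA.integrable k)).sub (hA.integrable 0)

theorem integrable_perturbed_approx (p k : ℕ) : Integrable (perturbed S (Yp p) k) m :=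
  ((hS.integrable k).add ((hA.short p).integrable k)).sub ((hA.short p).integrable 0)

theorem monotone_mean {n : ℕ} (hn : 1 ≤ n) : Monotone (survivalMean m θ (perturbed S Y) n) :=
  monotone_survivalMean hn (hA.measurable_perturbed hS) (hA.integrable_perturbed hS n)
    hA.twist_measurable hA.twist_nonneg hA.abs_twist_le

theorem monotone_mean_approx (p : ℕ) {n : ℕ} (hn : 1 ≤ n) :
    Monotone (survivalMean m (θp p) (perturbed S (Yp p)) n) :=
  monotone_survivalMean hn (hA.measurable_perturbed_approx hS p)
    (hA.integrable_perturbed_approx hS p n) (hA.twist_approx_measurable p)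
    (hA.twist_approx_nonneg p) (hA.abs_twist_approx_le p)

/-- A weighted form of Cauchy–Schwarz: the weight `Q` has a second moment polynomial in `r`, while
the approximation errors have second moments of order `exp (-β r)` up to powers of `r`. Half the
exponential rate survives. -/
theorem integral_abs_mean_sub_approx_le {r n : ℕ} (hr : 1 ≤ r) (hn : 1 ≤ n)
    (hnr : n ≤ (r + 1) ^ 11) (a : ℝ) :
    ∫ t in a..a + 1, |survivalMean m θ (perturbed S Y) n t -
      survivalMean m (θp r) (perturbed S (Yp r)) n t| ≤
      (1 + |a|) * (Real.exp (-(β / 2)) ^ r * ((window r : ℝ) ^ 2 *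
        (9 * (1 + 4100 * C * (r : ℝ) ^ 11) + 72 * B ^ 2 * C + 2 * B * C))) := by
  have hB := hA.bound_nonneg
  have hC : 0 ≤ C := (integral_nonneg fun z => Even.pow_nonneg (by decide) _).trans (hS.moment 0)
  set N := window r with hN
  have hnN : n < N := by
    rw [hN, window]
    omega
  have hN1 : (1 : ℝ) ≤ N := by
    have : 1 ≤ N := by omega
    exact_mod_cast this
  let G := envelopeMass S (Yp r) N
  have hGi : Integrable G m := integrable_envelopeMass hS (hA.short r) N
  have hG0 : ∀ z, 0 ≤ G z := envelopeMass_nonneg S (Yp r) N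
  let d : Z → ℝ := fun z => ∑ j ∈ Finset.range N, |Y j z - Yp r j z|
  let D : Z → ℝ := fun z => ∑ j ∈ Finset.range N, (Y j z - Yp r j z) ^ 2
  have hDi : Integrable D m := integrable_finsetSum _ fun j _ => hA.integrable_sq r j
  have hdm : Measurable d := Finset.measurable_fun_sum _ fun j _ =>
    continuous_abs.measurable.comp ((hA.measurable j).sub ((hA.short r).measurable j))
  have hd0 : ∀ z, 0 ≤ d z := fun z => Finset.sum_nonneg fun j _ => abs_nonneg _
  have hdD : ∀ z, d z ^ 2 ≤ N * D z := fun z => by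
    have := sq_sum_le_card_mul_sum_sq (s := Finset.range N) (f := fun j => |Y j z - Yp r j z|)
    simpa [d, D] using this
  set Q : Z → ℝ := fun z => 1 + |perturbed S (Yp r) n z| with hQ
  have hQm : Measurable Q :=
    (continuous_abs.measurable.comp (hA.measurable_perturbed_approx hS r n)).const_add 1
  have hQ0 : ∀ z, 0 ≤ Q z := fun z => by positivity
  -- With `h = √(1 + G)` bounding every increment and every value of `Yp r` in the window, the walk
  -- at time `n < N` is at most `(N - 1) * h`, and the two perturbation terms add `2 * h`.
  have hQsq : ∀ z, Q z ^ 2 ≤ 9 * (N : ℝ) ^ 2 * (1 + G z) := by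
    intro z
    set h := √(1 + G z) with hh
    have hh2 : h ^ 2 = 1 + G z := Real.sq_sqrt (by linarith [hG0 z])
    have hh1 : 1 ≤ h := Real.one_le_sqrt.mpr (by linarith [hG0 z])
    have hroot : ∀ x : ℝ, x ^ 16 ≤ G z → |x| ≤ h := by
      intro x hx
      refine Real.le_sqrt_of_sq_le ?_
      rw [sq_abs]
      rcases le_total (x ^ 2) 1 with h1 | h1
      · linarith [hG0 z]
      · have : x ^ 2 ≤ (x ^ 2) ^ 8 := le_self_pow₀ h1 (by norm_num)
        rw [← pow_mul] at this
        norm_num at this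
        linarith
    have hX : ∀ j < N, |S (j + 1) z - S j z| ≤ h := fun j hj => hroot _ <| le_trans
      (le_add_of_nonneg_right (Even.pow_nonneg (by decide) _)) (pow_le_envelopeMass S (Yp r) hj z)
    have hYh : ∀ j < N, |Yp r j z| ≤ h := fun j hj => hroot _ <| le_trans
      (le_add_of_nonneg_left (Even.pow_nonneg (by decide) _)) (pow_le_envelopeMass S (Yp r) hj z)
    have h1 := abs_sub_le_mul (S := S) (z := z) hX 0 n (by omega)
    rw [zero_add, hS.zero, sub_zero] at h1
    have h2 := hYh n hnN
    have h3 := hYh 0 (by omega)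
    have hn' : (n : ℝ) ≤ N - 1 := by
      have : n + 1 ≤ N := hnN
      have : ((n + 1 : ℕ) : ℝ) ≤ N := by exact_mod_cast this
      push_cast at this
      linarith
    have h4 : Q z ≤ 3 * N * h := by
      have h5 : |perturbed S (Yp r) n z| ≤ |S n z| + |Yp r n z| + |Yp r 0 z| :=
        (abs_sub _ _).trans (add_le_add (abs_add_le _ _) le_rfl)
      have h6 : (n : ℝ) * h ≤ (N - 1) * h := mul_le_mul_of_nonneg_right hn' (by linarith)
      have h7 : h ≤ N * h := le_mul_of_one_le_left (by linarith) hN1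
      simp only [hQ]
      linarith
    calc Q z ^ 2 ≤ (3 * N * h) ^ 2 := pow_le_pow_left₀ (hQ0 z) h4 2
      _ = 9 * (N : ℝ) ^ 2 * h ^ 2 := by ring
      _ = _ := by rw [hh2]
  have hQbi : Integrable (fun z => 9 * (N : ℝ) ^ 2 * (1 + G z)) m :=
    ((integrable_const 1).add hGi).const_mul _
  have hint : Integrable (fun z => Q z * (2 * d z)) m := by
    refine Integrable.mono' (hQbi.add (hDi.const_mul N))
      (hQm.mul (hdm.const_mul 2)).aestronglyMeasurable (ae_of_all _ fun z => ?_)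
    rw [Real.norm_eq_abs, abs_of_nonneg (mul_nonneg (hQ0 z) (by linarith [hd0 z])), Pi.add_apply]
    have h1 := hQsq z
    have h2 := hdD z
    nlinarith [sq_nonneg (Q z - d z)]
  refine (integral_abs_survivalMean_sub_le hn (hA.measurable_perturbed hS)
    (hA.measurable_perturbed_approx hS r) (hA.integrable_perturbed hS n)
    (hA.integrable_perturbed_approx hS r n) hA.twist_measurable (hA.twist_approx_measurable r)
    hA.abs_twist_le (hA.abs_twist_approx_le r) (Δ := fun z => 2 * d z) (fun k hk z => ?_) hint
    a).trans ?_
  · have h1 : ∀ j < N, |Y j z - Yp r j z| ≤ d z := fun j hj =>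
      Finset.single_le_sum (f := fun j => |Y j z - Yp r j z|) (fun j _ => abs_nonneg _)
        (Finset.mem_range.mpr hj)
    have h2 := abs_le.mp (h1 k (by omega))
    have h3 := abs_le.mp (h1 0 (by omega))
    unfold perturbed
    rw [abs_le]
    constructor <;> linarith
  refine mul_le_mul_of_nonneg_left ?_ (by positivity)
  set ε := Real.exp (-(β / 2)) ^ r with hε
  have hε0 : 0 < ε := pow_pos (Real.exp_pos _) _
  have hε2 : Real.exp (-β * r) = ε ^ 2 := by
    rw [hε, ← Real.exp_nat_mul, ← Real.exp_nat_mul]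
    congr 1
    push_cast
    ring
  have hηi : Integrable (fun z => |θ z - θp r z|) m := by
    refine Integrable.mono' (integrable_const (2 * B)) (continuous_abs.measurable.comp
      (hA.twist_measurable.sub (hA.twist_approx_measurable r))).aestronglyMeasurable
      (ae_of_all _ fun z => ?_)
    have h1 := abs_le.mp (hA.abs_twist_le z)
    have h2 := abs_le.mp (hA.abs_twist_approx_le r z)
    rw [Real.norm_eq_abs, abs_abs, abs_le]
    constructor <;> linarith
  let V : Z → ℝ := fun z => 72 * B ^ 2 * (N * D z) + 2 * (B * |θ z - θp r z|)
  have hVi : Integrable V m :=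
    ((hDi.const_mul N).const_mul (72 * B ^ 2)).add ((hηi.const_mul B).const_mul 2)
  -- From `Q v ≤ ε Q² + ε⁻¹ v²`. The integral of `V` carries `ε ^ 2`, so both terms end up of order
  -- `ε`. The twist error enters `V` linearly, since its square is at most `B` times itself.
  have hpt : ∀ z, Q z * (3 * B * (2 * d z) + |θ z - θp r z|) ≤
      ε * (9 * (N : ℝ) ^ 2 * (1 + G z)) + ε⁻¹ * V z := by
    intro z
    set v := 3 * B * (2 * d z) + |θ z - θp r z| with hv
    have hη : |θ z - θp r z| ^ 2 ≤ B * |θ z - θp r z| := by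
      rw [sq]
      refine mul_le_mul_of_nonneg_right ?_ (abs_nonneg _)
      have h1 := hA.twist_nonneg z
      have h2 := hA.twist_le z
      have h3 := hA.twist_approx_nonneg r z
      have h4 := hA.twist_approx_le r z
      rw [abs_le]
      constructor <;> linarith
    have hvV : v ^ 2 ≤ V z := by
      have h1 : v ^ 2 ≤ 72 * B ^ 2 * d z ^ 2 + 2 * |θ z - θp r z| ^ 2 := by
        rw [hv]
        nlinarith [sq_nonneg (3 * B * (2 * d z) - |θ z - θp r z|)]
      have h2 : 72 * B ^ 2 * d z ^ 2 ≤ 72 * B ^ 2 * (N * D z) :=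
        mul_le_mul_of_nonneg_left (hdD z) (by positivity)
      simp only [V]
      linarith
    have h1 : Q z * v ≤ ε * Q z ^ 2 + ε⁻¹ * v ^ 2 := by
      have h2 : 0 ≤ ε⁻¹ * ((ε * Q z - v) ^ 2 + (ε * Q z) * v) := by
        have : 0 ≤ v := by
          have := hd0 z
          positivity
        have := hQ0 z
        positivity
      have h3 : ε⁻¹ * ((ε * Q z - v) ^ 2 + (ε * Q z) * v) =
          ε * Q z ^ 2 + ε⁻¹ * v ^ 2 - Q z * v := by
        field_simp
        ring
      linarith
    have h2 := mul_le_mul_of_nonneg_left (hQsq z) hε0.le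
    have h3 := mul_le_mul_of_nonneg_left hvV (inv_pos.mpr hε0).le
    linarith
  have hDint : ∫ z, D z ∂m ≤ N * (C * ε ^ 2) := by
    simp only [D]
    rw [integral_finsetSum _ fun j _ => hA.integrable_sq r j, ← hε2]
    calc _ ≤ ∑ j ∈ Finset.range N, C * Real.exp (-β * r) :=
          Finset.sum_le_sum fun j _ => hA.error r j
      _ = _ := by simp
  have hVint : ∫ z, V z ∂m ≤ ε ^ 2 * ((N : ℝ) ^ 2 * (72 * B ^ 2 * C + 2 * B * C)) := by
    simp only [V]
    rw [integral_add ((hDi.const_mul N).const_mul (72 * B ^ 2)) ((hηi.const_mul B).const_mul 2),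
      integral_const_mul, integral_const_mul, integral_const_mul, integral_const_mul]
    have h1 := hA.twist_error r
    rw [hε2] at h1
    have h2 : (1 : ℝ) ≤ (N : ℝ) ^ 2 := one_le_pow₀ hN1
    calc _ ≤ 72 * B ^ 2 * (N * (N * (C * ε ^ 2))) + 2 * (B * (C * ε ^ 2)) := by gcongr
      _ ≤ 72 * B ^ 2 * (N * (N * (C * ε ^ 2))) + (N : ℝ) ^ 2 * (2 * (B * (C * ε ^ 2))) := by
          have : 0 ≤ 2 * (B * (C * ε ^ 2)) := by positivity
          nlinarith
      _ = _ := by ring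
  have hGint : ∫ z, (1 + G z) ∂m ≤ 1 + 4100 * C * (r : ℝ) ^ 11 := by
    rw [integral_add (integrable_const 1) hGi]
    simp only [integral_const, probReal_univ, one_smul]
    exact add_le_add le_rfl (integral_envelopeMass_le hS (hA.short r) hr)
  calc _ ≤ ∫ z, (ε * (9 * (N : ℝ) ^ 2 * (1 + G z)) + ε⁻¹ * V z) ∂m := by
        refine integral_mono_of_nonneg (ae_of_all _ fun z => ?_)
          ((hQbi.const_mul ε).add (hVi.const_mul ε⁻¹)) (ae_of_all _ hpt)
        have := hQ0 z
        have := hd0 z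
        exact mul_nonneg (hQ0 z) (by positivity)
    _ = ε * (9 * (N : ℝ) ^ 2 * ∫ z, (1 + G z) ∂m) + ε⁻¹ * ∫ z, V z ∂m := by
        rw [integral_add (hQbi.const_mul ε) (hVi.const_mul ε⁻¹), integral_const_mul,
          integral_const_mul, integral_const_mul]
    _ ≤ ε * (9 * (N : ℝ) ^ 2 * (1 + 4100 * C * (r : ℝ) ^ 11)) +
        ε⁻¹ * (ε ^ 2 * ((N : ℝ) ^ 2 * (72 * B ^ 2 * C + 2 * B * C))) := by gcongr
    _ = _ := by
        field_simp
        ring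

theorem exists_integral_abs_mean_sub_approx_le :
    ∃ K, 0 ≤ K ∧ ∀ r, 1 ≤ r → ∀ n, 1 ≤ n → n ≤ (r + 1) ^ 11 → ∀ a : ℝ,
      ∫ t in a..a + 1, |survivalMean m θ (perturbed S Y) n t -
        survivalMean m (θp r) (perturbed S (Yp r)) n t| ≤ K / (r : ℝ) ^ 2 * (1 + |a|) := by
  have hB := hA.bound_nonneg
  have hC : 0 ≤ C := (integral_nonneg fun z => Even.pow_nonneg (by decide) _).trans (hS.moment 0)
  have hq : |Real.exp (-(β / 2))| < 1 := by
    rw [abs_of_pos (Real.exp_pos _), Real.exp_lt_one_iff]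
    linarith [hA.rate_pos]
  -- 35 = 22 + 11 + 2: the squared window, the envelope mass, and the desired gain `r ^ 2`.
  obtain ⟨K₁, hK₁⟩ := (tendsto_pow_const_mul_const_pow_of_abs_lt_one 35 hq).bddAbove_range
  have hK₁' : ∀ r : ℕ, (r : ℝ) ^ 35 * Real.exp (-(β / 2)) ^ r ≤ K₁ := fun r => hK₁ ⟨r, rfl⟩
  have hK₁0 : 0 ≤ K₁ := by simpa using hK₁' 0
  set M := 2050 ^ 2 * (9 * (1 + 4100 * C) + 72 * B ^ 2 * C + 2 * B * C) with hM
  refine ⟨K₁ * M, by positivity, fun r hr n hn hnr a => ?_⟩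
  have hr1 : (1 : ℝ) ≤ r := by exact_mod_cast hr
  refine (hA.integral_abs_mean_sub_approx_le hS hr hn hnr a).trans ?_
  rw [mul_comm]
  refine mul_le_mul_of_nonneg_right ?_ (by positivity)
  rw [le_div_iff₀ (by positivity)]
  have hp : (1 : ℝ) ≤ (r : ℝ) ^ 11 := one_le_pow₀ hr1
  calc _ ≤ Real.exp (-(β / 2)) ^ r * ((2050 * (r : ℝ) ^ 11) ^ 2 *
        (9 * ((r : ℝ) ^ 11 + 4100 * C * (r : ℝ) ^ 11) + 72 * B ^ 2 * C * (r : ℝ) ^ 11 +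
          2 * B * C * (r : ℝ) ^ 11)) * (r : ℝ) ^ 2 := by
        have h1 := window_le hr
        have h2 : 72 * B ^ 2 * C ≤ 72 * B ^ 2 * C * (r : ℝ) ^ 11 :=
          le_mul_of_one_le_right (by positivity) hp
        have h3 : 2 * B * C ≤ 2 * B * C * (r : ℝ) ^ 11 :=
          le_mul_of_one_le_right (by positivity) hp
        gcongr
    _ = (r : ℝ) ^ 35 * Real.exp (-(β / 2)) ^ r * M := by
        rw [hM]
        ring
    _ ≤ K₁ * M := mul_le_mul_of_nonneg_right (hK₁' r) (by positivity)

/-- Triangle inequality through the `r`-step approximations at times `n` and `r ^ 11`, between which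
the pointwise block estimate applies. -/
theorem exists_integral_abs_mean_sub_le :
    ∃ K, 0 ≤ K ∧ ∀ r, 1 ≤ r → ∀ n, r ^ 11 ≤ n → n ≤ (r + 1) ^ 11 → ∀ a : ℝ,
      ∫ t in a..a + 1, |survivalMean m θ (perturbed S Y) n t -
        survivalMean m θ (perturbed S Y) (r ^ 11) t| ≤ K / (r : ℝ) ^ 2 * (1 + |a|) := by
  obtain ⟨K₁, hK₁0, hK₁⟩ := hA.exists_integral_abs_mean_sub_approx_le hS
  obtain ⟨K₂, hK₂0, hK₂⟩ := exists_abs_survivalMean_sub_le hS hA.bound_nonneg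
  refine ⟨2 * K₁ + 2 * K₂, by positivity, fun r hr n hn hnr a => ?_⟩
  have hr0 : (0 : ℝ) < r := by exact_mod_cast hr
  have h1r : 1 ≤ r ^ 11 := Nat.one_le_pow _ _ hr
  have hr' : r ^ 11 ≤ (r + 1) ^ 11 := Nat.pow_le_pow_left (Nat.le_succ r) 11
  let u := fun n => survivalMean m θ (perturbed S Y) n
  let w := fun n => survivalMean m (θp r) (perturbed S (Yp r)) n
  have hu : ∀ k, 1 ≤ k → Monotone (u k) := fun k hk => hA.monotone_mean hS hk
  have hw : ∀ k, 1 ≤ k → Monotone (w k) := fun k hk => hA.monotone_mean_approx hS r hk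
  have i1 := intervalIntegrable_abs_sub (hu n (h1r.trans hn)) (hw n (h1r.trans hn)) a (a + 1)
  have i2 := intervalIntegrable_abs_sub (hw n (h1r.trans hn)) (hw _ h1r) a (a + 1)
  have i3 := intervalIntegrable_abs_sub (hu _ h1r) (hw _ h1r) a (a + 1)
  have h1 := hK₁ r hr n (h1r.trans hn) hnr a
  have h3 := hK₁ r hr _ h1r hr' a
  have h2 : ∫ t in a..a + 1, |w n t - w (r ^ 11) t| ≤ 2 * K₂ / (r : ℝ) ^ 2 * (1 + |a|) := by
    have h4 := intervalIntegral.integral_mono_on (μ := volume) (a := a) (b := a + 1)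
      (f := fun t => |w n t - w (r ^ 11) t|)
      (g := fun _ => 2 * K₂ / (r : ℝ) ^ 2 * (1 + |a|)) (by linarith) i2 (by simp) ?_
    · simpa using h4
    · intro t ht
      have h5 := hK₂ r hr (Yp r) (hA.short r) (θp r) (hA.twist_adapted r)
        (hA.abs_twist_approx_le r) n hn hnr t
      rw [← le_div_iff₀ (by positivity)] at h5
      refine h5.trans ?_
      rw [div_mul_eq_mul_div]
      refine div_le_div_of_nonneg_right ?_ (by positivity)
      have h6 : |t| ≤ 1 + |a| := by
        have := le_abs_self a
        have := neg_abs_le a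
        rw [abs_le]
        constructor <;> linarith [ht.1, ht.2]
      have : 0 ≤ K₂ * |a| := by positivity
      nlinarith
  calc _ ≤ ∫ t in a..a + 1, (|u n t - w n t| + |w n t - w (r ^ 11) t| +
          |u (r ^ 11) t - w (r ^ 11) t|) := by
        refine intervalIntegral.integral_mono_on (by linarith)
          (intervalIntegrable_abs_sub (hu n (h1r.trans hn)) (hu _ h1r) a (a + 1))
          ((i1.add i2).add i3) fun t _ => ?_
        have h4 := abs_sub_le (u n t) (w n t) (u (r ^ 11) t)
        have h5 := abs_sub_le (w n t) (w (r ^ 11) t) (u (r ^ 11) t)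
        rw [abs_sub_comm (w (r ^ 11) t)] at h5
        change |u n t - u (r ^ 11) t| ≤ _
        linarith
    _ ≤ K₁ / (r : ℝ) ^ 2 * (1 + |a|) + 2 * K₂ / (r : ℝ) ^ 2 * (1 + |a|) +
          K₁ / (r : ℝ) ^ 2 * (1 + |a|) := by
        rw [intervalIntegral.integral_add (i1.add i2) i3, intervalIntegral.integral_add i1 i2]
        exact add_le_add (add_le_add h1 h2) h3
    _ = _ := by ring

end IsApproximable

end Convergence

/-! ### Summation over scales and the limit function. -/

section Conclusion

/-- The largest `s` with `s ^ 11 ≤ n`. -/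
def scale (n : ℕ) : ℕ := Nat.findGreatest (fun s => s ^ 11 ≤ n) n

theorem scale_pow_le {n : ℕ} : scale n ^ 11 ≤ n :=
  Nat.findGreatest_spec (P := fun s => s ^ 11 ≤ n) (Nat.zero_le n) (by simp)

theorem le_scale {n s : ℕ} (h : s ^ 11 ≤ n) : s ≤ scale n :=
  Nat.le_findGreatest ((Nat.le_self_pow (by norm_num) s).trans h) h

theorem lt_scale_succ_pow (n : ℕ) : n < (scale n + 1) ^ 11 := by
  by_contra h
  have := le_scale (not_lt.mp h)
  omega

attribute [irreducible] scale

theorem tendsto_scale : Tendsto scale atTop atTop :=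
  tendsto_atTop.mpr fun s => (eventually_ge_atTop (s ^ 11)).mono fun _ h => le_scale h

variable {Z : Type*} [mZ : MeasurableSpace Z]
variable {m : Measure Z} [IsProbabilityMeasure m] {ℱ : Filtration ℕ mZ} {S Y W : ℕ → Z → ℝ}
  {Yp : ℕ → ℕ → Z → ℝ} {θ : Z → ℝ} {θp : ℕ → Z → ℝ} {C ρ B β : ℝ} {l₀ : ℕ}

/-- At fixed `n` every path survives for all large `t`, and then `(t + W n z) / t` tends to 1;
dominated convergence concludes. -/
theorem tendsto_survivalMean_div {n : ℕ} (hn : 1 ≤ n) (hW : ∀ k, Measurable (W k))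
    (hWi : Integrable (W n) m) (hθ : Measurable θ) (hθB : ∀ z, |θ z| ≤ B) :
    Tendsto (fun t => survivalMean m θ W n t / t) atTop (𝓝 (∫ z, θ z ∂m)) := by
  have hB : 0 ≤ B := by
    obtain ⟨z⟩ := nonempty_of_isProbabilityMeasure m
    exact (abs_nonneg _).trans (hθB z)
  have he : ∀ t, survivalMean m θ W n t / t =
      ∫ z, (survivors W n t).indicator (fun z => (t + W n z) * θ z) z / t ∂m := fun t => by
    rw [survivalMean_eq_integral_indicator hW, integral_div]
  simp_rw [he]
  refine tendsto_integral_filter_of_dominated_convergence (fun z => (1 + |W n z|) * B)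
    (Eventually.of_forall fun t =>
      ((integrable_indicator_survivors hW hWi hθ hθB t).div_const t).aestronglyMeasurable) ?_
    (((integrable_const 1).add hWi.abs).mul_const B) (ae_of_all _ fun z => ?_)
  · filter_upwards [eventually_ge_atTop 1] with t ht
    refine ae_of_all _ fun z => ?_
    have ht0 : (0 : ℝ) < t := by linarith
    rw [norm_div, Real.norm_eq_abs t, abs_of_pos ht0, div_le_iff₀ ht0]
    refine (norm_indicator_le_norm_self _ _).trans ?_
    rw [norm_mul, Real.norm_eq_abs, Real.norm_eq_abs]
    have h1 : |t + W n z| ≤ (1 + |W n z|) * t := by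
      have h2 := abs_add_le t (W n z)
      rw [abs_of_pos ht0] at h2
      nlinarith [abs_nonneg (W n z)]
    calc _ ≤ (1 + |W n z|) * t * B := mul_le_mul h1 (hθB z) (abs_nonneg _) (by positivity)
      _ = _ := by ring
  · obtain ⟨M, hM⟩ := exists_mem_survivors_iff_le W hn z
    have h1 : Tendsto (fun t : ℝ => (1 + W n z * t⁻¹) * θ z) atTop
        (𝓝 ((1 + W n z * 0) * θ z)) :=
      ((tendsto_inv_atTop_zero.const_mul _).const_add 1).mul_const _
    rw [mul_zero, add_zero, one_mul] at h1
    refine h1.congr' ?_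
    filter_upwards [eventually_ge_atTop M, eventually_gt_atTop 0] with t ht ht0
    rw [Set.indicator_of_mem ((hM t).mpr ht)]
    field_simp

namespace IsApproximable

variable (hS : IsFluctuatingWalk m ℱ S C ρ l₀) (hA : IsApproximable m ℱ Y Yp θ θp C B β)
include hS hA

theorem exists_integral_abs_mean_sub_le_scale :
    ∃ K, 0 ≤ K ∧ ∀ n n', 1 ≤ n → n ≤ n' → ∀ a : ℝ,
      ∫ t in a..a + 1, |survivalMean m θ (perturbed S Y) n t -
        survivalMean m θ (perturbed S Y) n' t| ≤ K / (scale n : ℝ) * (1 + |a|) := by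
  obtain ⟨K, hK0, hK⟩ := hA.exists_integral_abs_mean_sub_le hS
  refine ⟨3 * K, by positivity, fun n n' hn hnn' a => ?_⟩
  set u := fun n => survivalMean m θ (perturbed S Y) n with hu
  have hmono : ∀ k, 1 ≤ k → Monotone (u k) := fun k hk => hA.monotone_mean hS hk
  let δ : ℕ → ℕ → ℝ := fun k l => ∫ t in a..a + 1, |u k t - u l t|
  have hδ : ∀ k l, 1 ≤ k → 1 ≤ l → IntervalIntegrable (fun t => |u k t - u l t|) volume a (a + 1) :=
    fun k l hk hl => intervalIntegrable_abs_sub (hmono k hk) (hmono l hl) a (a + 1)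
  have hsymm : ∀ k l, δ k l = δ l k := fun k l => by
    simp only [δ]
    simp_rw [abs_sub_comm]
  have htri : ∀ i j k, 1 ≤ i → 1 ≤ j → 1 ≤ k → δ i k ≤ δ i j + δ j k := by
    intro i j k hi hj hk
    simp only [δ]
    rw [← intervalIntegral.integral_add (hδ i j hi hj) (hδ j k hj hk)]
    exact intervalIntegral.integral_mono_on (by linarith) (hδ i k hi hk)
      ((hδ i j hi hj).add (hδ j k hj hk)) fun t _ => abs_sub_le _ _ _
  have hpow : ∀ s, 1 ≤ s → 1 ≤ s ^ 11 := fun s hs => Nat.one_le_pow _ _ hs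
  have hK' : ∀ r, 1 ≤ r → ∀ n, r ^ 11 ≤ n → n ≤ (r + 1) ^ 11 →
      δ n (r ^ 11) ≤ K * (1 + |a|) / (r : ℝ) ^ 2 := fun r hr n h1 h2 => by
    rw [mul_div_right_comm]
    exact hK r hr n h1 h2 a
  have hKa : 0 ≤ K * (1 + |a|) := by positivity
  -- The block errors `1 / s ^ 2` are summed by comparison with the telescoping `2 / s - 2 / (s +
  -- 1)`.
  have hchain : ∀ r r', 1 ≤ r → r ≤ r' →
      δ (r ^ 11) (r' ^ 11) ≤ K * (1 + |a|) * (2 / r - 2 / r') := by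
    intro r r' hr hrr'
    induction r', hrr' using Nat.le_induction with
    | base => simp [δ]
    | succ s hs ih =>
      have hs1 : 1 ≤ s := hr.trans hs
      have hs0 : (1 : ℝ) ≤ s := by exact_mod_cast hs1
      have h1 := htri (r ^ 11) (s ^ 11) ((s + 1) ^ 11) (hpow r hr) (hpow s hs1)
        (hpow _ (Nat.le_add_left 1 s))
      have h2 := hK' s hs1 ((s + 1) ^ 11) (Nat.pow_le_pow_left (Nat.le_succ s) 11) le_rfl
      rw [hsymm] at h2
      have h3 : 1 / (s : ℝ) ^ 2 ≤ 2 / s - 2 / (s + 1) := by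
        rw [div_sub_div _ _ (by positivity) (by positivity),
          div_le_div_iff₀ (by positivity) (by positivity)]
        nlinarith
      have h4 : K * (1 + |a|) / (s : ℝ) ^ 2 ≤ K * (1 + |a|) * (2 / s - 2 / (s + 1)) := by
        rw [div_eq_mul_one_div]
        exact mul_le_mul_of_nonneg_left h3 hKa
      push_cast
      linarith
  have hr : 1 ≤ scale n := le_scale (by simpa using hn)
  have hrr' : scale n ≤ scale n' := le_scale (scale_pow_le.trans hnn')
  have hr' : 1 ≤ scale n' := hr.trans hrr'
  have hR : (1 : ℝ) ≤ scale n := by exact_mod_cast hr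
  have hR' : (1 : ℝ) ≤ scale n' := by exact_mod_cast hr'
  have h1 := hK' _ hr n scale_pow_le (lt_scale_succ_pow n).le
  have h2 := hK' _ hr' n' scale_pow_le (lt_scale_succ_pow n').le
  have h3 := hchain _ _ hr hrr'
  have h4 := htri n (scale n ^ 11) n' hn (hpow _ hr) (hn.trans hnn')
  have h5 := htri (scale n ^ 11) (scale n' ^ 11) n' (hpow _ hr) (hpow _ hr') (hn.trans hnn')
  rw [hsymm] at h2
  have h6 : K * (1 + |a|) / (scale n : ℝ) ^ 2 ≤ K * (1 + |a|) * (1 / scale n) := by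
    rw [mul_one_div]
    exact div_le_div_of_nonneg_left hKa (by positivity) (le_self_pow₀ hR (by norm_num))
  have h7 : K * (1 + |a|) / (scale n' : ℝ) ^ 2 ≤ K * (1 + |a|) * (2 / scale n') := by
    rw [mul_div_assoc']
    refine div_le_div₀ (by positivity) (by linarith) (by positivity)
      (le_self_pow₀ hR' (by norm_num))
  change δ n n' ≤ _
  calc δ n n' ≤ K * (1 + |a|) * (1 / scale n) + K * (1 + |a|) * (2 / scale n - 2 / scale n') +
        K * (1 + |a|) * (2 / scale n') := by linarith
    _ = _ := by ring

theorem exists_vague_limit :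
    ∃ U : ℝ → ℝ, Measurable U ∧ (∀ t, 0 ≤ U t) ∧ LocallyIntegrable U volume ∧
      (∀ φ : ℝ → ℝ, Continuous φ → HasCompactSupport φ →
        Tendsto (fun n : ℕ => ∫ t, φ t * survivalMean m θ (perturbed S Y) n t) atTop
          (𝓝 (∫ t, φ t * U t))) ∧
      Tendsto (fun t : ℝ => U t / t) atTop (𝓝 (∫ z, θ z ∂m)) := by
  obtain ⟨K, _, hK⟩ := hA.exists_integral_abs_mean_sub_le_scale hS
  -- Indices are shifted by one: at time 0 survival imposes nothing, so the mean may be negative.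
  have hmono : ∀ n, Monotone (survivalMean m θ (perturbed S Y) (n + 1)) := fun n =>
    hA.monotone_mean hS (Nat.le_add_left 1 n)
  have he : Tendsto (fun n => K / (scale (n + 1) : ℝ)) atTop (𝓝 0) := by
    have h1 : Tendsto (fun n => (scale (n + 1) : ℝ)) atTop atTop :=
      tendsto_natCast_atTop_atTop.comp (tendsto_scale.comp (tendsto_add_atTop_nat 1))
    exact tendsto_const_nhds.div_atTop h1
  have hcau : ∀ n n', n ≤ n' → ∀ a : ℝ,
      ∫ t in a..a + 1, |survivalMean m θ (perturbed S Y) (n + 1) t -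
        survivalMean m θ (perturbed S Y) (n' + 1) t| ≤
        K / (scale (n + 1) : ℝ) * (1 + |a|) := fun n n' h a =>
    hK (n + 1) (n' + 1) (Nat.le_add_left 1 n) (Nat.succ_le_succ h) a
  obtain ⟨U, hU, hU0, hUe⟩ := exists_monotone_limit hmono
    (fun n t => survivalMean_nonneg (Nat.le_add_left 1 n) (hA.measurable_perturbed hS)
      hA.twist_nonneg t) he hcau
  have hL : ∀ n, Tendsto (fun t => survivalMean m θ (perturbed S Y) (n + 1) t / t) atTop
      (𝓝 (∫ z, θ z ∂m)) := fun n =>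
    tendsto_survivalMean_div (Nat.le_add_left 1 n) (hA.measurable_perturbed hS)
      (hA.integrable_perturbed hS _) hA.twist_measurable hA.abs_twist_le
  refine ⟨U, hU.measurable, hU0, hU.locallyIntegrable, fun φ hφ hφc => ?_,
    tendsto_div_of_mean hmono hU he hUe hL⟩
  have h2 := tendsto_integral_mul_of_mean hmono hU he hUe hφ hφc
  rwa [tendsto_add_atTop_iff_nat (f := fun n =>
    ∫ t, φ t * survivalMean m θ (perturbed S Y) n t) 1] at h2

end IsApproximable

end Conclusion

variable {G X : Type*}

/-! ### Concatenation of paths and invariance of the path measure. -/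

section Concat

/-- The path which follows `ω` for `p` steps and then `ω'`. -/
def concat (p : ℕ) (ω ω' : ℕ → G) : ℕ → G :=
  fun i => if i < p then ω i else ω' (i - p)

theorem leftProd_congr [Monoid G] {ω ω' : ℕ → G} {n : ℕ} (h : ∀ i < n, ω i = ω' i) :
    leftProd ω n = leftProd ω' n := by
  induction n with
  | zero => rfl
  | succ n ih =>
    simp only [leftProd]
    rw [h n (Nat.lt_succ_self n), ih fun i hi => h i (by omega)]

theorem leftProd_splice [Monoid G] {n k : ℕ} (h : k ≤ n) (ω ω' : ℕ → G) :
    leftProd (splice n ω ω') k = leftProd ω k :=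
  leftProd_congr fun i hi => by simp [splice, hi.trans_le h]

theorem leftProd_concat [Monoid G] {n k : ℕ} (h : k ≤ n) (ω ω' : ℕ → G) :
    leftProd (concat n ω ω') k = leftProd ω k :=
  leftProd_congr fun i hi => by simp [concat, hi.trans_le h]

theorem leftProd_concat_add [Monoid G] (n l : ℕ) (ω ω' : ℕ → G) :
    leftProd (concat n ω ω') (n + l) = leftProd ω' l * leftProd ω n := by
  induction l with
  | zero => simp [leftProd, leftProd_concat le_rfl]
  | succ l ih =>
    rw [← add_assoc]
    simp only [leftProd]
    rw [ih, mul_assoc]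
    simp [concat]

theorem splice_concat (n : ℕ) (ω ω' ω'' : ℕ → G) :
    splice n (concat n ω ω') ω'' = splice n ω ω'' := by
  ext i
  by_cases h : i < n <;> simp [splice, concat, h]

theorem splice_splice {n k : ℕ} (h : n ≤ k) (ω ω' ω'' : ℕ → G) :
    splice n (splice k ω ω') ω'' = splice n ω ω'' := by
  ext i
  by_cases hi : i < n
  · simp [splice, hi, hi.trans_le h]
  · simp [splice, hi]

theorem splice_eq_of_splice_eq {n : ℕ} {ω₁ ω₂ c : ℕ → G} (h : splice n ω₁ c = splice n ω₂ c)
    (ω : ℕ → G) : splice n ω₁ ω = splice n ω₂ ω := by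
  rw [← splice_splice le_rfl ω₁ c, h, splice_splice le_rfl]

theorem iterate_skewShift [Monoid G] [MulAction G X] (k : ℕ) (ω : ℕ → G) (x : X) :
    skewShift^[k] (ω, x) = (fun i => ω (i + k), leftProd ω k • x) := by
  induction k with
  | zero => simp [leftProd]
  | succ k ih =>
    rw [Function.iterate_succ_apply', ih]
    simp only [skewShift, leftProd, mul_smul, zero_add]
    congr 1
    ext i
    congr 1
    ring

variable [MeasurableSpace G] (μ : Measure G) [IsProbabilityMeasure μ]

instance : IsProbabilityMeasure (pathMeasure μ) := by
  unfold pathMeasure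
  infer_instance

theorem measurable_concat (p : ℕ) :
    Measurable fun q : (ℕ → G) × (ℕ → G) => concat p q.1 q.2 := by
  refine measurable_pi_lambda _ fun i => ?_
  by_cases h : i < p
  · simp only [concat, h, if_true]
    fun_prop
  · simp only [concat, h, if_false]
    fun_prop

theorem measurable_splice (p : ℕ) :
    Measurable fun q : (ℕ → G) × (ℕ → G) => splice p q.1 q.2 := by
  refine measurable_pi_lambda _ fun i => ?_
  by_cases h : i < p
  · simp only [splice, h, if_true]
    fun_prop
  · simp only [splice, h, if_false]
    fun_prop

/-- This is the Markov property of the path: the steps after time `p` form an independent copy of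
the whole path. It is checked on cylinders, whose coordinates split at `p`. -/
theorem measurePreserving_concat (p : ℕ) :
    MeasurePreserving (fun q : (ℕ → G) × (ℕ → G) => concat p q.1 q.2)
      ((pathMeasure μ).prod (pathMeasure μ)) (pathMeasure μ) := by
  classical
  refine ⟨measurable_concat p, ?_⟩
  rw [pathMeasure]
  refine Measure.eq_infinitePi _ fun s t ht => ?_
  rw [Measure.map_apply (measurable_concat p) (.pi s.countable_toSet fun _ _ => ht _)]
  have : (fun q : (ℕ → G) × (ℕ → G) => concat p q.1 q.2) ⁻¹' (Set.pi s t) =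
      (Set.pi ↑(s.filter fun i => i < p) t) ×ˢ
        (Set.pi ↑((s.filter fun i => ¬ i < p).image fun i => i - p) fun j => t (j + p)) := by
    ext q
    simp only [Set.mem_preimage, Set.mem_pi, Set.mem_prod, Finset.coe_filter, Finset.coe_image,
      Set.mem_ofPred_eq, Set.mem_image, forall_exists_index, and_imp, Finset.mem_coe]
    constructor
    · refine fun h => ⟨fun i hi hip => by simpa [concat, hip] using h i hi, ?_⟩
      rintro j i hi hip rfl
      have := h i hi
      rw [Nat.sub_add_cancel (not_lt.mp hip)]
      simpa [concat, hip] using this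
    · rintro ⟨h1, h2⟩ i hi
      by_cases hip : i < p
      · simpa [concat, hip] using h1 i hi hip
      · have := h2 (i - p) i hi hip rfl
        rw [Nat.sub_add_cancel (not_lt.mp hip)] at this
        simpa [concat, hip] using this
  rw [this, Measure.prod_prod, Measure.infinitePi_pi _ (fun i _ => ht i),
    Measure.infinitePi_pi _ (fun i _ => ht _), Finset.prod_image, ←
    Finset.prod_filter_mul_prod_filter_not s (fun i => i < p)]
  · congr 1
    refine Finset.prod_congr rfl fun i hi => ?_
    rw [Nat.sub_add_cancel (not_lt.mp (Finset.mem_filter.mp hi).2)]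
  · intro i hi j hj hij
    have := (Finset.mem_filter.mp hi).2
    have := (Finset.mem_filter.mp hj).2
    simp only at hij
    omega

theorem measurePreserving_splice (p : ℕ) :
    MeasurePreserving (fun q : (ℕ → G) × (ℕ → G) => splice p q.1 q.2)
      ((pathMeasure μ).prod (pathMeasure μ)) (pathMeasure μ) := by
  classical
  refine ⟨measurable_splice p, ?_⟩
  rw [pathMeasure]
  refine Measure.eq_infinitePi _ fun s t ht => ?_
  rw [Measure.map_apply (measurable_splice p) (.pi s.countable_toSet fun _ _ => ht _)]
  have : (fun q : (ℕ → G) × (ℕ → G) => splice p q.1 q.2) ⁻¹' (Set.pi s t) =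
      (Set.pi ↑(s.filter fun i => i < p) t) ×ˢ (Set.pi ↑(s.filter fun i => ¬ i < p) t) := by
    ext q
    simp only [Set.mem_preimage, Set.mem_pi, Set.mem_prod, Finset.coe_filter,
      Set.mem_ofPred_eq, and_imp, Finset.mem_coe]
    constructor
    · exact fun h => ⟨fun i hi hip => by simpa [splice, hip] using h i hi,
        fun i hi hip => by simpa [splice, hip] using h i hi⟩
    · rintro ⟨h1, h2⟩ i hi
      by_cases hip : i < p
      · simpa [splice, hip] using h1 i hi hip
      · simpa [splice, hip] using h2 i hi hip
  rw [this, Measure.prod_prod, Measure.infinitePi_pi _ (fun i _ => ht i),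
    Measure.infinitePi_pi _ (fun i _ => ht _),
    Finset.prod_filter_mul_prod_filter_not s (fun i => i < p)]

variable [MeasurableSpace X] (ν : Measure X) [IsProbabilityMeasure ν]

theorem measurePreserving_concat_prod (p : ℕ) :
    MeasurePreserving (fun q : ((ℕ → G) × X) × (ℕ → G) => (concat p q.1.1 q.2, q.1.2))
      (((pathMeasure μ).prod ν).prod (pathMeasure μ)) ((pathMeasure μ).prod ν) := by
  have h1 := measurePreserving_prodAssoc (pathMeasure μ) ν (pathMeasure μ)
  have h2 := (MeasurePreserving.id (pathMeasure μ)).prod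
    (Measure.measurePreserving_swap (μ := ν) (ν := pathMeasure μ))
  have h3 := (measurePreserving_prodAssoc (pathMeasure μ) (pathMeasure μ) ν).symm
  have h4 := (measurePreserving_concat μ p).prod (MeasurePreserving.id ν)
  exact h4.comp (h3.comp (h2.comp h1))

variable {ν} [Monoid G] [MulAction G X]

theorem measurePreserving_skewShift (hsmul : Measurable fun p : G × X => p.1 • p.2)
    (hν : IsStationary μ ν) :
    MeasurePreserving (skewShift (G := G) (X := X)) ((pathMeasure μ).prod ν)
      ((pathMeasure μ).prod ν) := by
  have hT : Measurable (skewShift (G := G) (X := X)) := by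
    refine Measurable.prodMk (measurable_pi_lambda _ fun i =>
      (measurable_pi_apply (i + 1)).comp measurable_fst) ?_
    exact hsmul.comp (f := fun z : (ℕ → G) × X => (z.1 0, z.2)) (by fun_prop)
  have h1 : MeasurePreserving (fun q : (ℕ → G) × X => q.1 0 • q.2) ((pathMeasure μ).prod ν) ν := by
    have h2 : MeasurePreserving (fun p : G × X => p.1 • p.2) (μ.prod ν) ν := ⟨hsmul, hν⟩
    exact h2.comp ((measurePreserving_eval_infinitePi (fun _ : ℕ => μ) 0).prod
      (MeasurePreserving.id ν))
  have h3 : MeasurePreserving (fun q : ((ℕ → G) × X) × (ℕ → G) => (q.2, q.1.1 0 • q.1.2))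
      (((pathMeasure μ).prod ν).prod (pathMeasure μ)) ((pathMeasure μ).prod ν) :=
    Measure.measurePreserving_swap.comp (h1.prod (MeasurePreserving.id (pathMeasure μ)))
  refine ⟨hT, ?_⟩
  -- Writing the path as one step followed by an independent path, `T` becomes `(ω', g_1 x)`, and
  -- stationarity gives the law of `g_1 x`.
  conv_lhs => rw [← (measurePreserving_concat_prod μ ν 1).map_eq]
  rw [Measure.map_map hT (measurePreserving_concat_prod μ ν 1).measurable]
  convert h3.map_eq using 2
  ext q i
  · simp [skewShift, concat]
  · simp [skewShift, concat]

end Concat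

/-! ### The cocycle walk as a fluctuating walk. -/

section Walk

variable [Monoid G]

/-- Freeze the steps of a path from time `n` on. -/
def freeze (n : ℕ) (z : (ℕ → G) × X) : (ℕ → G) × X := (splice n z.1 fun _ => 1, z.2)

theorem freeze_concat (n : ℕ) (ω ω' : ℕ → G) (x : X) :
    freeze n (concat n ω ω', x) = freeze n (ω, x) := by
  simp [freeze, splice_concat]

variable [MeasurableSpace G] [MeasurableSpace X]

theorem measurable_freeze (n : ℕ) : Measurable (freeze (G := G) (X := X) n) := by
  refine Measurable.prodMk ?_ measurable_snd
  exact (measurable_splice n).comp (f := fun z : (ℕ → G) × X => (z.1, fun _ => 1)) (by fun_prop)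

variable (G X) in
/-- The filtration generated by the starting point and the steps of the path. -/
def pathFiltration : Filtration ℕ (inferInstance : MeasurableSpace ((ℕ → G) × X)) where
  seq n := MeasurableSpace.comap (freeze n) inferInstance
  mono' n k h := by
    have : freeze (G := G) (X := X) n = freeze n ∘ freeze k := by
      ext z : 1
      simp [freeze, splice_splice h]
    change MeasurableSpace.comap (freeze n) _ ≤ _
    rw [this, ← MeasurableSpace.comap_comp]
    exact MeasurableSpace.comap_mono (measurable_freeze n).comap_le
  le' n := (measurable_freeze n).comap_le

theorem measurable_pathFiltration {n : ℕ} {h : (ℕ → G) × X → ℝ} (hm : Measurable h)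
    (hf : ∀ z, h (freeze n z) = h z) : Measurable[pathFiltration G X n] h := by
  have : h = h ∘ freeze n := funext fun z => (hf z).symm
  rw [this]
  exact hm.comp (comap_measurable _)

/-- Serves to show that a function measurable at time `n` ignores the tail `ω'` in `concat n ω ω'`.
-/
theorem eq_of_freeze_eq {n : ℕ} {h : (ℕ → G) × X → ℝ} (hm : Measurable[pathFiltration G X n] h)
    {z z' : (ℕ → G) × X} (hz : freeze n z = freeze n z') : h z = h z' :=
  Measurable.factorsThrough (f := freeze n) hm hz

theorem mem_iff_of_freeze_eq {n : ℕ} {A : Set ((ℕ → G) × X)}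
    (hA : MeasurableSet[pathFiltration G X n] A) {z z' : (ℕ → G) × X}
    (hz : freeze n z = freeze n z') : z ∈ A ↔ z' ∈ A := by
  obtain ⟨s, -, rfl⟩ := hA
  rw [Set.mem_preimage, Set.mem_preimage, hz]

variable {σ : G → X → ℝ}

theorem measurable_leftProd [MeasurableMul₂ G] (n : ℕ) :
    Measurable fun ω : ℕ → G => leftProd ω n := by
  induction n with
  | zero => exact measurable_const
  | succ n ih => exact (measurable_pi_apply n).mul ih

theorem measurable_walk [MeasurableMul₂ G] (hσm : Measurable fun p : G × X => σ p.1 p.2) (n : ℕ) :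
    Measurable fun z : (ℕ → G) × X => walk σ n z.1 z.2 :=
  hσm.comp (((measurable_leftProd n).comp measurable_fst).prodMk measurable_snd)

variable [MulAction G X]

omit [MeasurableSpace G] [MeasurableSpace X] in
theorem walk_zero (hσ : IsCocycle σ) (ω : ℕ → G) (x : X) : walk σ 0 ω x = 0 := by
  have := hσ 1 1 x
  simp only [mul_one, one_smul] at this
  change σ 1 x = 0
  linarith

omit [MeasurableSpace G] [MeasurableSpace X] in
theorem walk_concat_add (hσ : IsCocycle σ) (n l : ℕ) (ω ω' : ℕ → G) (x : X) :
    walk σ (n + l) (concat n ω ω') x = walk σ n ω x + walk σ l ω' (leftProd ω n • x) := by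
  unfold walk
  rw [leftProd_concat_add, hσ, add_comm]

omit [MeasurableSpace G] [MeasurableSpace X] in
theorem walk_concat_add_sub (hσ : IsCocycle σ) (n l : ℕ) (ω ω' : ℕ → G) (x : X) :
    walk σ (n + l) (concat n ω ω') x - walk σ n (concat n ω ω') x =
      walk σ l ω' (leftProd ω n • x) := by
  rw [walk_concat_add hσ]
  have : walk σ n (concat n ω ω') x = walk σ n ω x := by
    unfold walk
    rw [leftProd_concat le_rfl]
  rw [this, add_sub_cancel_left]

omit [MeasurableSpace G] [MeasurableSpace X] in
theorem walk_concat_succ_sub (hσ : IsCocycle σ) (n : ℕ) (ω ω' : ℕ → G) (x : X) :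
    walk σ (n + 1) (concat n ω ω') x - walk σ n (concat n ω ω') x =
      σ (ω' 0) (leftProd ω n • x) := by
  rw [walk_concat_add_sub hσ]
  simp [walk, leftProd]

variable {μ : Measure G} [IsProbabilityMeasure μ]

theorem integrable_and_integral_le {Z : Type*} [MeasurableSpace Z] {m : Measure Z} {F : Z → ℝ}
    {C : ℝ} (hF : AEStronglyMeasurable F m) (hF0 : ∀ z, 0 ≤ F z) (hC : 0 ≤ C)
    (h : ∫⁻ z, ENNReal.ofReal (F z) ∂m ≤ ENNReal.ofReal C) :
    Integrable F m ∧ ∫ z, F z ∂m ≤ C := by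
  constructor
  · refine ⟨hF, ?_⟩
    rw [hasFiniteIntegral_iff_ofReal (ae_of_all _ hF0)]
    exact h.trans_lt ENNReal.ofReal_lt_top
  · rw [integral_eq_lintegral_of_nonneg_ae (ae_of_all _ hF0) hF]
    exact ENNReal.toReal_le_of_le_ofReal hC h

theorem pow_le_mul_exp {α : ℝ} (hα : 0 < α) (x : ℝ) :
    x ^ 16 ≤ (Nat.factorial 16 / α ^ 16 : ℝ) * Real.exp (α * |x|) := by
  have h := Real.pow_div_factorial_le_exp _ (mul_nonneg hα.le (abs_nonneg x)) 16
  rw [mul_pow, Even.pow_abs (by decide), div_le_iff₀ (by positivity)] at h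
  rw [div_mul_eq_mul_div, le_div_iff₀ (by positivity)]
  linarith

omit [Monoid G] [MulAction G X] [MeasurableSpace X] [IsProbabilityMeasure μ] in
theorem exists_lintegral_pow_le (h : HasExpMoment μ σ) :
    ∃ C : ℝ, 0 ≤ C ∧ ∀ x, ∫⁻ g, ENNReal.ofReal (σ g x ^ 16) ∂μ ≤ ENNReal.ofReal C := by
  obtain ⟨α, hα, hfin⟩ := h
  set c : ℝ := Nat.factorial 16 / α ^ 16
  have hc : 0 ≤ c := by positivity
  refine ⟨c * (∫⁻ g, ⨆ x : X, ENNReal.ofReal (Real.exp (α * |σ g x|)) ∂μ).toReal,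
    by positivity, fun x => ?_⟩
  rw [ENNReal.ofReal_mul hc, ENNReal.ofReal_toReal hfin.ne,
    ← lintegral_const_mul' _ _ ENNReal.ofReal_ne_top]
  refine lintegral_mono fun g => ?_
  refine (ENNReal.ofReal_le_ofReal (pow_le_mul_exp hα (σ g x))).trans ?_
  rw [ENNReal.ofReal_mul hc]
  gcongr
  exact le_iSup (fun x => ENNReal.ofReal (Real.exp (α * |σ g x|))) x

-- The limiting normal law charges `[-1, 1]` with mass `I < 1`. Once the error in the limit theorem
-- is below `(1 - I) / 2`, the value `ρ = (1 + I) / 2` works for every starting point.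
omit [MulAction G X] [MeasurableSpace X] in
theorem exists_measureReal_abs_walk_le (h : EffectiveCLT μ σ) :
    ∃ (ρ : ℝ) (l₀ : ℕ), 0 ≤ ρ ∧ ρ < 1 ∧ ∀ l, l₀ ≤ l → ∀ x,
      (pathMeasure μ).real {ω | |walk σ l ω x| ≤ √(l : ℝ)} ≤ ρ := by
  obtain ⟨c, ε, v, hc, hε, hv, hclt⟩ := h
  have hv2 : v ^ 2 ≠ 0 := pow_ne_zero 2 hv.ne'
  set φ := ProbabilityTheory.gaussianPDFReal 0 (v ^ 2) with hφ
  have hφi : Integrable φ := ProbabilityTheory.integrable_gaussianPDFReal 0 (v ^ 2)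
  have hφ0 : ∀ u, 0 ≤ φ u := ProbabilityTheory.gaussianPDFReal_nonneg 0 (v ^ 2)
  set I := ∫ u in (-1 : ℝ)..1, φ u with hI
  have hI0 : 0 ≤ I := intervalIntegral.integral_nonneg (by norm_num) fun u _ => hφ0 u
  have hI1 : I < 1 := by
    have h1 : 0 < ∫ u in (1 : ℝ)..2, φ u :=
      intervalIntegral.intervalIntegral_pos_of_pos hφi.intervalIntegrable
        (fun u => ProbabilityTheory.gaussianPDFReal_pos 0 (v ^ 2) u hv2) (by norm_num)
    have h2 : I + ∫ u in (1 : ℝ)..2, φ u = ∫ u in (-1 : ℝ)..2, φ u :=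
      intervalIntegral.integral_add_adjacent_intervals hφi.intervalIntegrable
        hφi.intervalIntegrable
    have h3 : ∫ u in (-1 : ℝ)..2, φ u ≤ 1 := by
      rw [intervalIntegral.integral_of_le (by norm_num),
        ← ProbabilityTheory.integral_gaussianPDFReal_eq_one 0 hv2]
      exact setIntegral_le_integral hφi (ae_of_all _ hφ0)
    linarith
  have hlim : Tendsto (fun n : ℕ => c / (n : ℝ) ^ ε) atTop (𝓝 0) :=
    tendsto_const_nhds.div_atTop ((tendsto_rpow_atTop hε).comp tendsto_natCast_atTop_atTop)
  obtain ⟨l₀, hl₀⟩ := eventually_atTop.mp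
    ((hlim.eventually_le_const (show (0 : ℝ) < (1 - I) / 2 by linarith)).and
      (eventually_ge_atTop 1))
  refine ⟨(1 + I) / 2, l₀, by linarith, by linarith, fun l hl x => ?_⟩
  obtain ⟨h1, h2⟩ := hl₀ l hl
  have h3 := hclt (-1) 1 (by norm_num) x l h2
  have hl0 : (0 : ℝ) < √(l : ℝ) := Real.sqrt_pos.mpr (by exact_mod_cast h2)
  have hset : {ω | |walk σ l ω x| ≤ √(l : ℝ)} =
      {ω | walk σ l ω x / √(l : ℝ) ∈ Set.Icc (-1 : ℝ) 1} := by
    ext ω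
    simp only [Set.mem_ofPred_eq, Set.mem_Icc]
    rw [← abs_le, abs_div, abs_of_pos hl0, div_le_one hl0]
  rw [hset]
  linarith [(abs_le.mp h3).2]

variable {ν : Measure X} [IsProbabilityMeasure ν]

/-- Given the past up to `n`, later increments are those of a fresh walk started at `g_n ⋯ g_1 x`.
Moments, centering and spreading hold uniformly in the starting point, hence conditionally on the
past. The constant may be enlarged because it must be shared with the perturbation and the twist. -/
theorem exists_isFluctuatingWalk [MeasurableMul₂ G]
    (hσm : Measurable fun p : G × X => σ p.1 p.2) (hσ : IsCocycle σ) (hmom : HasExpMoment μ σ)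
    (hcen : IsCentered μ σ) (hclt : EffectiveCLT μ σ) :
    ∃ (C ρ : ℝ) (l₀ : ℕ), 0 ≤ C ∧ ∀ C', C ≤ C' →
      IsFluctuatingWalk ((pathMeasure μ).prod ν) (pathFiltration G X)
        (fun n z => walk σ n z.1 z.2) C' ρ l₀ := by
  obtain ⟨C, hC0, hC⟩ := exists_lintegral_pow_le hmom
  obtain ⟨ρ, l₀, hρ0, hρ1, hρ⟩ := exists_measureReal_abs_walk_le hclt
  have hWm := measurable_walk hσm
  have hadapt : ∀ k, Measurable[pathFiltration G X k]
      (fun z : (ℕ → G) × X => walk σ k z.1 z.2) := fun k =>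
    measurable_pathFiltration (hWm k) fun z => by
      simp only [freeze, walk, leftProd_splice le_rfl]
  have hincm : ∀ k, Measurable fun z : (ℕ → G) × X =>
      walk σ (k + 1) z.1 z.2 - walk σ k z.1 z.2 := fun k => (hWm _).sub (hWm k)
  have heval : MeasurePreserving (fun ω : ℕ → G => ω 0) (pathMeasure μ) μ :=
    measurePreserving_eval_infinitePi (fun _ : ℕ => μ) 0
  have hσx : ∀ x, Measurable fun g => σ g x := fun x =>
    hσm.comp (f := fun g => (g, x)) (by fun_prop)
  have hmom16 : ∀ k, Integrable (fun z : (ℕ → G) × X =>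
        (walk σ (k + 1) z.1 z.2 - walk σ k z.1 z.2) ^ 16) ((pathMeasure μ).prod ν) ∧
      ∫ z : (ℕ → G) × X, (walk σ (k + 1) z.1 z.2 - walk σ k z.1 z.2) ^ 16
        ∂((pathMeasure μ).prod ν) ≤ C := by
    intro k
    refine integrable_and_integral_le ((hincm k).pow_const 16).aestronglyMeasurable
      (fun z => Even.pow_nonneg (by decide) _) hC0 ?_
    have hm1 : Measurable fun z : (ℕ → G) × X =>
        ENNReal.ofReal ((walk σ (k + 1) z.1 z.2 - walk σ k z.1 z.2) ^ 16) :=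
      ((hincm k).pow_const 16).ennreal_ofReal
    have hmp := measurePreserving_concat_prod μ ν k
    rw [← hmp.lintegral_comp hm1, lintegral_prod]
    swap
    · exact (hm1.comp hmp.measurable).aemeasurable
    simp only [walk_concat_succ_sub hσ]
    calc _ ≤ ∫⁻ _ : (ℕ → G) × X, ENNReal.ofReal C ∂((pathMeasure μ).prod ν) := by
          refine lintegral_mono fun z => ?_
          rw [heval.lintegral_comp
            (f := fun g => ENNReal.ofReal (σ g (leftProd z.1 k • z.2) ^ 16))
            ((hσx _).pow_const 16).ennreal_ofReal]
          exact hC _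
      _ = _ := by simp
  have hinci : ∀ k, Integrable (fun z : (ℕ → G) × X =>
      walk σ (k + 1) z.1 z.2 - walk σ k z.1 z.2) ((pathMeasure μ).prod ν) := fun k =>
    integrable_of_integrable_pow (hincm k).aestronglyMeasurable (by decide) (by decide)
      (hmom16 k).1
  refine ⟨C, ρ, l₀, hC0, fun C' hC' => ⟨fun z => walk_zero hσ z.1 z.2, hadapt, ?_,
    fun k => (hmom16 k).1, fun k => (hmom16 k).2.trans hC', hρ0, hρ1, ?_⟩⟩
  · rintro k h hh ⟨B, hB⟩
    have hhm : Measurable h := hh.mono ((pathFiltration G X).le k) le_rfl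
    have hFi : Integrable (fun z : (ℕ → G) × X =>
        h z * (walk σ (k + 1) z.1 z.2 - walk σ k z.1 z.2)) ((pathMeasure μ).prod ν) :=
      (hinci k).bdd_mul (c := B) hhm.aestronglyMeasurable (ae_of_all _ hB)
    have hmp := measurePreserving_concat_prod μ ν k
    rw [← hmp.map_eq, integral_map hmp.measurable.aemeasurable, integral_prod]
    rotate_left
    · exact hmp.integrable_comp_of_integrable hFi
    · exact (hhm.mul (hincm k)).aestronglyMeasurable
    have hh' : ∀ (z : (ℕ → G) × X) (ω' : ℕ → G), h (concat k z.1 ω', z.2) = h z :=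
      fun z ω' => eq_of_freeze_eq hh (freeze_concat k z.1 ω' z.2)
    simp only [walk_concat_succ_sub hσ, hh']
    refine integral_eq_zero_of_ae (ae_of_all _ fun z => ?_)
    have h1 : ∫ ω' : ℕ → G, σ (ω' 0) (leftProd z.1 k • z.2) ∂(pathMeasure μ) = 0 := by
      have h2 := integral_map (μ := pathMeasure μ) heval.measurable.aemeasurable
        (hσx (leftProd z.1 k • z.2)).aestronglyMeasurable
      rw [heval.map_eq, hcen] at h2
      exact h2.symm
    simp only [integral_const_mul, h1, mul_zero, Pi.zero_apply]
  · intro l hl n A hA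
    have hAm : MeasurableSet A := (pathFiltration G X).le n _ hA
    have hVm : MeasurableSet {z : (ℕ → G) × X |
        |walk σ (n + l) z.1 z.2 - walk σ n z.1 z.2| ≤ √(l : ℝ)} :=
      (continuous_abs.measurable.comp ((hWm (n + l)).sub (hWm n))) measurableSet_Iic
    have hmp := measurePreserving_concat_prod μ ν n
    have hle : ((pathMeasure μ).prod ν) (A ∩ {z : (ℕ → G) × X |
        |walk σ (n + l) z.1 z.2 - walk σ n z.1 z.2| ≤ √(l : ℝ)}) ≤
        ENNReal.ofReal ρ * ((pathMeasure μ).prod ν) A := by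
      rw [← hmp.measure_preimage (hAm.inter hVm).nullMeasurableSet,
        Measure.prod_apply (hmp.measurable (hAm.inter hVm))]
      calc _ ≤ ∫⁻ z, A.indicator (fun _ => ENNReal.ofReal ρ) z ∂((pathMeasure μ).prod ν) := by
            refine lintegral_mono fun z => ?_
            by_cases hz : z ∈ A
            · rw [Set.indicator_of_mem hz,
                ← ENNReal.ofReal_toReal (measure_ne_top (pathMeasure μ) _)]
              refine ENNReal.ofReal_le_ofReal
                (le_trans (measureReal_mono fun ω' hω' => ?_) (hρ l hl (leftProd z.1 n • z.2)))
              have := hω'.2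
              simp only [Set.mem_ofPred_eq, walk_concat_add_sub hσ] at this
              exact this
            · rw [Set.indicator_of_notMem hz, nonpos_iff_eq_zero]
              have : Prod.mk z ⁻¹' ((fun q : ((ℕ → G) × X) × (ℕ → G) =>
                  (concat n q.1.1 q.2, q.1.2)) ⁻¹' (A ∩ {z : (ℕ → G) × X |
                  |walk σ (n + l) z.1 z.2 - walk σ n z.1 z.2| ≤ √(l : ℝ)})) = ∅ := by
                refine Set.eq_empty_of_forall_notMem fun ω' hω' => hz ?_
                exact (mem_iff_of_freeze_eq hA (freeze_concat n z.1 ω' z.2)).mp hω'.1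
              rw [this, measure_empty]
        _ = _ := by rw [lintegral_indicator_const hAm]
    have := ENNReal.toReal_mono (by finiteness) hle
    rwa [ENNReal.toReal_mul, ENNReal.toReal_ofReal hρ0] at this

end Walk

/-! ### Conditional expectations given finitely many steps. -/

section FiniteApprox

variable [MeasurableSpace G] {μ : Measure G} [IsProbabilityMeasure μ]

theorem finiteApprox_eq_of_splice_eq {p : ℕ} {ω₁ ω₂ c : ℕ → G} (h : splice p ω₁ c = splice p ω₂ c)
    (F : (ℕ → G) → ℝ) : finiteApprox μ p F ω₁ = finiteApprox μ p F ω₂ := by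
  unfold finiteApprox
  simp_rw [splice_eq_of_splice_eq h]

theorem measurable_finiteApprox [MeasurableSpace X] {F : (ℕ → G) × X → ℝ} (hF : Measurable F)
    (p : ℕ) : Measurable fun z : (ℕ → G) × X => finiteApprox μ p (fun ω' => F (ω', z.2)) z.1 := by
  have h : Measurable fun q : ((ℕ → G) × X) × (ℕ → G) => F (splice p q.1.1 q.2, q.1.2) :=
    hF.comp (((measurable_splice p).comp
      (f := fun q : ((ℕ → G) × X) × (ℕ → G) => (q.1.1, q.2)) (by fun_prop)).prodMk (by fun_prop))
  exact (h.stronglyMeasurable.integral_prod_right (ν := pathMeasure μ)).measurable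

theorem finiteApprox_nonneg {F : (ℕ → G) → ℝ} (hF : ∀ ω, 0 ≤ F ω) (p : ℕ) (ω : ℕ → G) :
    0 ≤ finiteApprox μ p F ω := integral_nonneg fun _ => hF _

theorem finiteApprox_le {F : (ℕ → G) → ℝ} {B : ℝ} (hFm : Measurable F) (hF : ∀ ω, 0 ≤ F ω)
    (hFB : ∀ ω, F ω ≤ B) (p : ℕ) (ω : ℕ → G) : finiteApprox μ p F ω ≤ B := by
  have h : Measurable fun ω' => F (splice p ω ω') :=
    hFm.comp ((measurable_splice p).comp (f := fun ω' => (ω, ω')) (by fun_prop))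
  have h1 : Integrable (fun ω' => F (splice p ω ω')) (pathMeasure μ) :=
    Integrable.mono' (integrable_const B) h.aestronglyMeasurable (ae_of_all _ fun ω' => by
      rw [Real.norm_eq_abs, abs_of_nonneg (hF _)]
      exact hFB _)
  calc finiteApprox μ p F ω ≤ ∫ _, B ∂(pathMeasure μ) :=
        integral_mono h1 (integrable_const B) fun ω' => hFB _
    _ = B := by simp

theorem finiteApprox_congr_ae {F F' : (ℕ → G) → ℝ} (h : F =ᵐ[pathMeasure μ] F') (p : ℕ) :
    finiteApprox μ p F =ᵐ[pathMeasure μ] finiteApprox μ p F' := by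
  have h1 := (measurePreserving_splice μ p).quasiMeasurePreserving.ae_eq_comp h
  filter_upwards [Measure.ae_ae_of_ae_prod h1] with ω hω
  exact integral_congr_ae hω

theorem twistApprox_congr_ae {F F' : (ℕ → G) → ℝ} (h : F =ᵐ[pathMeasure μ] F') (β : ℝ) :
    twistApprox μ F β = twistApprox μ F' β := by
  unfold twistApprox
  refine iSup_congr fun p => ?_
  congr 1
  refine lintegral_congr_ae ?_
  filter_upwards [h, finiteApprox_congr_ae h p] with ω h1 h2
  rw [h1, h2]

end FiniteApprox

/-! ### From exponential to polynomial moments. -/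

section Moments

theorem le_mul_of_ofReal_exp_mul_le {b : ℝ} {x D : ℝ≥0∞}
    (h : ENNReal.ofReal (Real.exp b) * x ≤ D) : x ≤ ENNReal.ofReal (Real.exp (-b)) * D := by
  calc x = ENNReal.ofReal (Real.exp (-b)) * (ENNReal.ofReal (Real.exp b) * x) := by
        rw [← mul_assoc, ← ENNReal.ofReal_mul (Real.exp_pos _).le, ← Real.exp_add]
        simp
    _ ≤ _ := by gcongr

variable {Z : Type*} [MeasurableSpace Z] {m : Measure Z}

theorem lintegral_pow_le {F : Z → ℝ} {α : ℝ} (hα : 0 < α) :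
    ∫⁻ z, ENNReal.ofReal (F z ^ 16) ∂m ≤ ENNReal.ofReal (Nat.factorial 16 / α ^ 16) *
      ∫⁻ z, ENNReal.ofReal (Real.exp (α * |F z|)) ∂m := by
  rw [← lintegral_const_mul' _ _ ENNReal.ofReal_ne_top]
  refine lintegral_mono fun z => ?_
  rw [← ENNReal.ofReal_mul (by positivity)]
  exact ENNReal.ofReal_le_ofReal (pow_le_mul_exp hα (F z))

/-- Since `exp u ≥ 1 + u ^ 2 / 2` for `u ≥ 0`, the excess of the exponential moment over 1 controls
the second moment. Exponential smallness of that excess thus passes to the L² error. -/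
theorem lintegral_sq_le [IsProbabilityMeasure m] {F : Z → ℝ} {α : ℝ} (hα : 0 < α) :
    ∫⁻ z, ENNReal.ofReal (F z ^ 2) ∂m ≤ ENNReal.ofReal (2 / α ^ 2) *
      (∫⁻ z, ENNReal.ofReal (Real.exp (α * |F z|)) ∂m - 1) := by
  have h1 : ∀ z, ENNReal.ofReal (α ^ 2 / 2 * F z ^ 2) + 1 ≤
      ENNReal.ofReal (Real.exp (α * |F z|)) := by
    intro z
    rw [← ENNReal.ofReal_one, ← ENNReal.ofReal_add (by positivity) zero_le_one]
    refine ENNReal.ofReal_le_ofReal ?_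
    have h2 : 0 ≤ α * |F z| := by positivity
    have h3 := Real.quadratic_le_exp_of_nonneg h2
    rw [mul_pow, sq_abs] at h3
    linarith
  have h2 : ∫⁻ z, ENNReal.ofReal (α ^ 2 / 2 * F z ^ 2) ∂m ≤
      ∫⁻ z, ENNReal.ofReal (Real.exp (α * |F z|)) ∂m - 1 := by
    refine ENNReal.le_sub_of_add_le_right ENNReal.one_ne_top ?_
    calc _ = ∫⁻ z, (ENNReal.ofReal (α ^ 2 / 2 * F z ^ 2) + 1) ∂m := by
          rw [lintegral_add_right _ measurable_const]
          simp
      _ ≤ _ := lintegral_mono h1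
  refine le_trans (le_of_eq ?_) (mul_le_mul_right h2 _)
  rw [← lintegral_const_mul' _ _ ENNReal.ofReal_ne_top]
  refine lintegral_congr fun z => ?_
  rw [← ENNReal.ofReal_mul (by positivity)]
  congr 1
  field_simp

end Moments

/-! ### The perturbation `f n ∘ T^n` and its short approximations. -/

section Perturbation

variable [Monoid G] [MulAction G X] [MeasurableSpace G] [MeasurableSpace X]
  {μ : Measure G} [IsProbabilityMeasure μ] {ν : Measure X} [IsProbabilityMeasure ν]
  {f : ℕ → (ℕ → G) × X → ℝ}

/-- The process `f_{n,p}(T^n(ω, x))`. -/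
def approxProcess (μ : Measure G) [IsProbabilityMeasure μ] (f : ℕ → (ℕ → G) × X → ℝ) (p k : ℕ)
    (z : (ℕ → G) × X) : ℝ :=
  finiteApprox μ p (fun ω => f k (ω, (skewShift^[k] z).2)) (skewShift^[k] z).1

omit [MeasurableSpace X] in
-- The first `p` steps of the path shifted by `k`, and the point `g_k ⋯ g_1 x`, involve only the
-- first `k + p` steps.
theorem approxProcess_freeze (p k : ℕ) (z : (ℕ → G) × X) :
    approxProcess μ f p k (freeze (k + p) z) = approxProcess μ f p k z := by
  obtain ⟨ω, x⟩ := z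
  simp only [approxProcess, freeze, iterate_skewShift, leftProd_splice (Nat.le_add_right k p)]
  refine finiteApprox_eq_of_splice_eq (c := fun _ => 1) ?_ _
  ext i
  by_cases hi : i < p
  · have : i + k < k + p := by omega
    simp [splice, hi, this]
  · simp [splice, hi]

omit [Monoid G] [MulAction G X] in
theorem lintegral_prod_swap {F : (ℕ → G) × X → ℝ≥0∞} (hF : Measurable F) :
    ∫⁻ z, F z ∂((pathMeasure μ).prod ν) = ∫⁻ x, ∫⁻ ω, F (ω, x) ∂(pathMeasure μ) ∂ν :=
  lintegral_prod_symm _ hF.aemeasurable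

/-- `T` preserves `(pathMeasure μ).prod ν`, so each bound for `f k` and its approximation holds for
their compositions with `T^k`, uniformly in `k`. -/
theorem exists_perturbation_bounds (hsmul : Measurable fun p : G × X => p.1 • p.2)
    (hν : IsStationary μ ν) (hf : ∀ n, Measurable (f n))
    (hmom : ∃ α : ℝ, 0 < α ∧ perturbMoment μ ν f α < ∞)
    (happ : ∃ α β : ℝ, 0 < α ∧ 0 < β ∧ perturbApprox μ ν f α β < ∞) :
    ∃ C β : ℝ, 0 ≤ C ∧ 0 < β ∧ (∀ k, Integrable (fun z => f k (skewShift^[k] z))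
        ((pathMeasure μ).prod ν)) ∧
      (∀ p C', C ≤ C' → IsShortPerturbation ((pathMeasure μ).prod ν) (pathFiltration G X)
        (approxProcess μ f p) C' p) ∧
      (∀ p k, Integrable (fun z => (f k (skewShift^[k] z) - approxProcess μ f p k z) ^ 2)
        ((pathMeasure μ).prod ν)) ∧
      ∀ p k, ∫ z, (f k (skewShift^[k] z) - approxProcess μ f p k z) ^ 2
        ∂((pathMeasure μ).prod ν) ≤ C * Real.exp (-β * p) := by
  obtain ⟨α₁, hα₁, hM⟩ := hmom
  obtain ⟨α, β, hα, hβ, hD⟩ := happ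
  set m := (pathMeasure μ).prod ν with hm
  have hT : ∀ k, MeasurePreserving (skewShift (G := G) (X := X))^[k] m m := fun k =>
    (measurePreserving_skewShift μ hsmul hν).iterate k
  let fp : ℕ → ℕ → (ℕ → G) × X → ℝ := fun p k z => finiteApprox μ p (fun ω => f k (ω, z.2)) z.1
  have hfp : ∀ p k, Measurable (fp p k) := fun p k => measurable_finiteApprox (hf k) p
  have hpm : ∀ p k, Measurable (approxProcess μ f p k) := fun p k =>
    (hfp p k).comp (hT k).measurable
  have hexp : ∀ (a : ℝ) {F : (ℕ → G) × X → ℝ}, Measurable F →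
      Measurable fun z => ENNReal.ofReal (Real.exp (a * |F z|)) := fun a F hF =>
    (Real.measurable_exp.comp ((continuous_abs.measurable.comp hF).const_mul a)).ennreal_ofReal
  have h16 : ∀ k, ∫⁻ z, ENNReal.ofReal (f k z ^ 16) ∂m ≤
      ENNReal.ofReal (Nat.factorial 16 / α₁ ^ 16) * perturbMoment μ ν f α₁ := by
    intro k
    refine (lintegral_pow_le hα₁).trans ?_
    gcongr
    rw [hm, lintegral_prod_swap (hexp α₁ (hf k))]
    exact le_iSup (fun k => ∫⁻ x, ∫⁻ ω, ENNReal.ofReal (Real.exp (α₁ * |f k (ω, x)|))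
      ∂(pathMeasure μ) ∂ν) k
  have hdiff : ∀ p k, ∫⁻ z, ENNReal.ofReal (Real.exp (α * |f k z - fp p k z|)) ∂m - 1 ≤
      ENNReal.ofReal (Real.exp (-(β * p))) * perturbApprox μ ν f α β := by
    intro p k
    have hs := hexp α ((hf k).sub (hfp p k))
    simp only [Pi.sub_apply] at hs
    rw [hm, lintegral_prod_swap hs]
    refine le_mul_of_ofReal_exp_mul_le ?_
    exact le_iSup₂ (f := fun (k p : ℕ) => ENNReal.ofReal (Real.exp (β * p)) *
      ((∫⁻ x, ∫⁻ ω, ENNReal.ofReal (Real.exp (α * |f k (ω, x) -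
        finiteApprox μ p (fun ω' => f k (ω', x)) ω|)) ∂(pathMeasure μ) ∂ν) - 1)) k p
  have hdiff16 : ∀ p k, ∫⁻ z, ENNReal.ofReal ((f k z - fp p k z) ^ 16) ∂m ≤
      ENNReal.ofReal (Nat.factorial 16 / α ^ 16) * (perturbApprox μ ν f α β + 1) := by
    intro p k
    refine (lintegral_pow_le hα).trans ?_
    gcongr
    refine le_tsub_add.trans (add_le_add ((hdiff p k).trans ?_) le_rfl)
    refine mul_le_of_le_one_left zero_le ?_
    rw [← ENNReal.ofReal_one]
    refine ENNReal.ofReal_le_ofReal (Real.exp_le_one_iff.mpr ?_)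
    have : (0 : ℝ) ≤ p := Nat.cast_nonneg p
    nlinarith
  have hdiff2 : ∀ p k, ∫⁻ z, ENNReal.ofReal ((f k z - fp p k z) ^ 2) ∂m ≤
      ENNReal.ofReal (2 / α ^ 2) *
        (ENNReal.ofReal (Real.exp (-(β * p))) * perturbApprox μ ν f α β) := fun p k =>
    (lintegral_sq_le hα).trans (mul_le_mul_right (hdiff p k) _)
  set M : ℝ := Nat.factorial 16 / α₁ ^ 16 * (perturbMoment μ ν f α₁).toReal with hMdef
  set D : ℝ := (perturbApprox μ ν f α β).toReal with hDdef
  set E : ℝ := Nat.factorial 16 / α ^ 16 * (D + 1) with hEdef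
  have hM0 : 0 ≤ M := by positivity
  have hD0 : 0 ≤ D := by positivity
  have hE0 : 0 ≤ E := by positivity
  have hD' : perturbApprox μ ν f α β = ENNReal.ofReal D := (ENNReal.ofReal_toReal hD.ne).symm
  have k1 : ∀ k, Integrable (fun z => f k z ^ 16) m ∧ ∫ z, f k z ^ 16 ∂m ≤ M := fun k =>
    integrable_and_integral_le ((hf k).pow_const 16).aestronglyMeasurable
      (fun z => Even.pow_nonneg (by decide) _) hM0 ((h16 k).trans (le_of_eq (by
        rw [hMdef, ENNReal.ofReal_mul (by positivity), ENNReal.ofReal_toReal hM.ne])))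
  have k2 : ∀ p k, Integrable (fun z => (f k z - fp p k z) ^ 16) m ∧
      ∫ z, (f k z - fp p k z) ^ 16 ∂m ≤ E := fun p k =>
    integrable_and_integral_le (((hf k).sub (hfp p k)).pow_const 16).aestronglyMeasurable
      (fun z => Even.pow_nonneg (by decide) _) hE0 ((hdiff16 p k).trans (le_of_eq (by
        rw [hEdef, ENNReal.ofReal_mul (by positivity), hD', ENNReal.ofReal_add hD0 zero_le_one,
          ENNReal.ofReal_one])))
  have k3 : ∀ p k, Integrable (fun z => (f k z - fp p k z) ^ 2) m ∧
      ∫ z, (f k z - fp p k z) ^ 2 ∂m ≤ 2 / α ^ 2 * (Real.exp (-(β * p)) * D) := fun p k =>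
    integrable_and_integral_le (((hf k).sub (hfp p k)).pow_const 2).aestronglyMeasurable
      (fun z => sq_nonneg _) (by positivity) ((hdiff2 p k).trans (le_of_eq (by
        rw [ENNReal.ofReal_mul (by positivity), hD', ENNReal.ofReal_mul (Real.exp_pos _).le])))
  -- The moment of the approximation follows from those of `f k` and of the difference.
  have k4 : ∀ p k, Integrable (fun z => fp p k z ^ 16) m ∧
      ∫ z, fp p k z ^ 16 ∂m ≤ 2 ^ 15 * (M + E) := by
    intro p k
    have hpt : ∀ z, fp p k z ^ 16 ≤ 2 ^ 15 * (f k z ^ 16 + (f k z - fp p k z) ^ 16) := by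
      intro z
      have h1 : |fp p k z| ≤ |f k z| + |f k z - fp p k z| := by
        have := abs_sub (f k z) (f k z - fp p k z)
        rwa [sub_sub_cancel] at this
      have h2 := add_pow_le (abs_nonneg (f k z)) (abs_nonneg (f k z - fp p k z)) 16
      have h3 := pow_le_pow_left₀ (abs_nonneg _) h1 16
      simp only [Even.pow_abs (by decide : Even 16)] at h2 h3
      exact h3.trans h2
    have hi := ((k1 k).1.add (k2 p k).1).const_mul (2 ^ 15)
    have hi' : Integrable (fun z => fp p k z ^ 16) m := by
      refine Integrable.mono' hi ((hfp p k).pow_const 16).aestronglyMeasurable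
        (ae_of_all _ fun z => ?_)
      rw [Real.norm_eq_abs, abs_of_nonneg (Even.pow_nonneg (by decide) _)]
      exact hpt z
    refine ⟨hi', (integral_mono hi' hi hpt).trans ?_⟩
    simp only [Pi.add_apply]
    rw [integral_const_mul, integral_add (k1 k).1 (k2 p k).1]
    exact mul_le_mul_of_nonneg_left (add_le_add (k1 k).2 (k2 p k).2) (by positivity)
  have hcomp : ∀ k {F : (ℕ → G) × X → ℝ}, Measurable F →
      ∫ z, F (skewShift^[k] z) ∂m = ∫ z, F z ∂m := fun k F hF => by
    conv_rhs => rw [← (hT k).map_eq]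
    rw [integral_map (hT k).measurable.aemeasurable hF.aestronglyMeasurable]
  refine ⟨2 ^ 15 * (M + E) + 2 / α ^ 2 * D, β, by positivity, hβ, fun k => ?_, fun p C' hC' =>
    ⟨fun k => measurable_pathFiltration (hpm p k) (approxProcess_freeze p k), fun k => ?_,
      fun k => ?_⟩, fun p k => ?_, fun p k => ?_⟩
  · exact (hT k).integrable_comp_of_integrable (integrable_of_integrable_pow
      (hf k).aestronglyMeasurable (by decide) (by decide) (k1 k).1)
  · exact (hT k).integrable_comp_of_integrable (k4 p k).1
  · refine (hcomp k ((hfp p k).pow_const 16)).le.trans ((k4 p k).2.trans ?_)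
    have : 0 ≤ 2 / α ^ 2 * D := by positivity
    linarith
  · exact (hT k).integrable_comp_of_integrable (k3 p k).1
  · refine (hcomp k (((hf k).sub (hfp p k)).pow_const 2)).le.trans ((k3 p k).2.trans ?_)
    have h1 : 0 ≤ 2 ^ 15 * (M + E) * Real.exp (-β * p) := by positivity
    rw [neg_mul] at h1 ⊢
    linarith

end Perturbation

/-! ### The twist `θ`. -/

section Twist

variable [MeasurableSpace G] {μ : Measure G} [IsProbabilityMeasure μ]

/-- Clamping a measurable version to `[0, B]`, with `B` the essential supremum, gives bounds at
every point, as the abstract argument requires. -/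
theorem exists_bounded_measurable_version {θ : (ℕ → G) → ℝ} (hθ : MemLp θ ∞ (pathMeasure μ))
    (hθ0 : 0 ≤ᵐ[pathMeasure μ] θ) :
    ∃ (θ' : (ℕ → G) → ℝ) (B : ℝ), Measurable θ' ∧ (∀ ω, 0 ≤ θ' ω) ∧ (∀ ω, θ' ω ≤ B) ∧
      θ =ᵐ[pathMeasure μ] θ' := by
  set B := (eLpNorm θ ∞ (pathMeasure μ)).toReal with hB
  refine ⟨fun ω => max 0 (min B (hθ.1.mk θ ω)), B,
    measurable_const.max (measurable_const.min hθ.1.stronglyMeasurable_mk.measurable),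
    fun ω => le_max_left _ _, fun ω => max_le ENNReal.toReal_nonneg (min_le_left _ _), ?_⟩
  have hb : ∀ᵐ ω ∂(pathMeasure μ), θ ω ≤ B := by
    filter_upwards [enorm_ae_le_eLpNormEssSup θ (pathMeasure μ)] with ω hω
    rw [← eLpNorm_exponent_top] at hω
    have h1 := ENNReal.toReal_mono hθ.2.ne hω
    rw [toReal_enorm] at h1
    exact (le_abs_self _).trans h1
  filter_upwards [hb, hθ0, hθ.1.ae_eq_mk] with ω h1 h2 h3
  rw [← h3, min_eq_right h1]
  exact (max_eq_right h2).symm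

theorem integral_abs_sub_finiteApprox_le [MeasurableSpace X] {ν : Measure X}
    [IsProbabilityMeasure ν] {θ : (ℕ → G) → ℝ} (hθ : Measurable θ) {β : ℝ}
    (h : twistApprox μ θ β < ∞) (p : ℕ) :
    ∫ z : (ℕ → G) × X, |θ z.1 - finiteApprox μ p θ z.1| ∂((pathMeasure μ).prod ν) ≤
      (twistApprox μ θ β).toReal * Real.exp (-β * p) := by
  have hm : Measurable fun z : (ℕ → G) × X => |θ z.1 - finiteApprox μ p θ z.1| :=
    continuous_abs.measurable.comp ((hθ.comp measurable_fst).sub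
      (measurable_finiteApprox (F := fun z : (ℕ → G) × X => θ z.1) (hθ.comp measurable_fst) p))
  refine (integrable_and_integral_le hm.aestronglyMeasurable (fun _ => abs_nonneg _)
    (by positivity) ?_).2
  rw [lintegral_prod_swap hm.ennreal_ofReal, mul_comm, ENNReal.ofReal_mul (Real.exp_pos _).le,
    ENNReal.ofReal_toReal h.ne, neg_mul]
  simp only [lintegral_const, measure_univ, mul_one]
  refine le_mul_of_ofReal_exp_mul_le ?_
  exact le_iSup (fun p : ℕ => ENNReal.ofReal (Real.exp (β * p)) *
    ∫⁻ ω, ENNReal.ofReal |θ ω - finiteApprox μ p θ ω| ∂(pathMeasure μ)) p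

end Twist

/-! ### Transfer to the path space and the theorem. -/

section Main

variable [Monoid G] [MulAction G X] [MeasurableSpace G] [MeasurableSpace X]
  {μ : Measure G} [IsProbabilityMeasure μ] {ν : Measure X} [IsProbabilityMeasure ν]
  {σ : G → X → ℝ} {f : ℕ → (ℕ → G) × X → ℝ} {θ : (ℕ → G) → ℝ}

theorem exists_isFluctuatingWalk_and_isApproximable [MeasurableMul₂ G]
    (hsmul : Measurable fun p : G × X => p.1 • p.2)
    (hσm : Measurable fun p : G × X => σ p.1 p.2) (hσ : IsCocycle σ) (hmom : HasExpMoment μ σ)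
    (hcen : IsCentered μ σ) (hclt : EffectiveCLT μ σ) (hν : IsStationary μ ν)
    (hf : ∀ n, Measurable (f n)) (hf_moment : ∃ α : ℝ, 0 < α ∧ perturbMoment μ ν f α < ∞)
    (hf_approx : ∃ α β : ℝ, 0 < α ∧ 0 < β ∧ perturbApprox μ ν f α β < ∞)
    {B : ℝ} (hθ : Measurable θ) (hθ0 : ∀ ω, 0 ≤ θ ω) (hθB : ∀ ω, θ ω ≤ B)
    (hθ_approx : ∃ β : ℝ, 0 < β ∧ twistApprox μ θ β < ∞) :
    ∃ (C ρ β : ℝ) (l₀ : ℕ), IsFluctuatingWalk ((pathMeasure μ).prod ν) (pathFiltration G X)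
        (fun n z => walk σ n z.1 z.2) C ρ l₀ ∧
      IsApproximable ((pathMeasure μ).prod ν) (pathFiltration G X)
        (fun n z => f n (skewShift^[n] z)) (approxProcess μ f) (fun z => θ z.1)
        (fun p z => finiteApprox μ p θ z.1) C B β := by
  obtain ⟨C₁, ρ, l₀, hC₁, hS⟩ := exists_isFluctuatingWalk (ν := ν) hσm hσ hmom hcen hclt
  obtain ⟨C₂, β₂, hC₂, hβ₂, hYi, hYs, hYe, hYb⟩ :=
    exists_perturbation_bounds hsmul hν hf hf_moment hf_approx
  obtain ⟨β₃, hβ₃, hN⟩ := hθ_approx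
  set C₃ := (twistApprox μ θ β₃).toReal
  have hC₃ : 0 ≤ C₃ := ENNReal.toReal_nonneg
  have hT : Measurable (skewShift (G := G) (X := X)) :=
    (measurePreserving_skewShift μ hsmul hν).measurable
  have hexp : ∀ b, min β₂ β₃ ≤ b → ∀ p : ℕ,
      Real.exp (-b * p) ≤ Real.exp (-min β₂ β₃ * p) := fun b hb p => by
    refine Real.exp_le_exp.mpr (mul_le_mul_of_nonneg_right ?_ (Nat.cast_nonneg p))
    linarith
  refine ⟨C₁ + C₂ + C₃, ρ, min β₂ β₃, l₀, hS _ (by linarith), ⟨lt_min hβ₂ hβ₃,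
    fun k => (hf k).comp (hT.iterate k), hYi, fun p => hYs p _ (by linarith), hYe, fun p k => ?_,
    hθ.comp measurable_fst, fun z => hθ0 _, fun z => hθB _, fun p => ?_,
    fun p z => finiteApprox_nonneg hθ0 p _, fun p z => finiteApprox_le hθ hθ0 hθB p _,
    fun p => ?_⟩⟩
  · exact (hYb p k).trans (mul_le_mul (by linarith) (hexp _ (min_le_left _ _) p)
      (Real.exp_pos _).le (by linarith))
  · refine measurable_pathFiltration (measurable_finiteApprox
      (F := fun z : (ℕ → G) × X => θ z.1) (hθ.comp measurable_fst) p) fun z => ?_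
    exact finiteApprox_eq_of_splice_eq (c := z.1) (splice_splice le_rfl _ _ _) _
  · exact (integral_abs_sub_finiteApprox_le hθ hN p).trans (mul_le_mul (by linarith)
      (hexp _ (min_le_right _ _) p) (Real.exp_pos _).le (by linarith))

omit [MeasurableSpace G] [MeasurableSpace X] in
theorem lt_exitTime_iff_mem_survivors (n : ℕ) (t : ℝ) (z : (ℕ → G) × X) :
    (n : ℕ∞) < exitTime σ f t z.1 z.2 ↔ z ∈ survivors (perturbed (fun n z => walk σ n z.1 z.2)
      fun n z => f n (skewShift^[n] z)) n t :=
  lt_exitTime_iff σ f t z.1 z.2 n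

/-- Fubini identifies the iterated integral with one over the product space. The version `θ'` may
replace `θ` because the inner integral only sees `θ` up to null sets. -/
theorem twistedU_eq_survivalMean {θ' : (ℕ → G) → ℝ} (hθ : θ =ᵐ[pathMeasure μ] θ') {n : ℕ} {t : ℝ}
    (hA : MeasurableSet (survivors (perturbed (fun n (z : (ℕ → G) × X) => walk σ n z.1 z.2)
      fun n z => f n (skewShift^[n] z)) n t))
    (hi : Integrable (fun z : (ℕ → G) × X => (t + perturbedWalk σ f n z.1 z.2) * θ' z.1)
      ((pathMeasure μ).prod ν)) :
    twistedU μ ν σ f θ n t = survivalMean ((pathMeasure μ).prod ν) (fun z => θ' z.1)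
      (perturbed (fun n z => walk σ n z.1 z.2) fun n z => f n (skewShift^[n] z)) n t := by
  set A := survivors (perturbed (fun n (z : (ℕ → G) × X) => walk σ n z.1 z.2)
      fun n z => f n (skewShift^[n] z)) n t with hAdef
  have h1 : survivalMean ((pathMeasure μ).prod ν) (fun z => θ' z.1)
      (perturbed (fun n z => walk σ n z.1 z.2) fun n z => f n (skewShift^[n] z)) n t =
      ∫ z, A.indicator (fun z => (t + perturbedWalk σ f n z.1 z.2) * θ' z.1) z
        ∂((pathMeasure μ).prod ν) := (integral_indicator hA).symm
  rw [h1, integral_prod_symm _ (hi.indicator hA), twistedU]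
  refine integral_congr_ae (ae_of_all _ fun x => ?_)
  have hset : {ω | (n : ℕ∞) < exitTime σ f t ω x} = (fun ω => (ω, x)) ⁻¹' A := by
    ext ω
    exact lt_exitTime_iff_mem_survivors n t (ω, x)
  have hm : MeasurableSet ((fun ω : ℕ → G => (ω, x)) ⁻¹' A) := measurable_prodMk_right hA
  simp only [hset]
  rw [← integral_indicator hm]
  refine integral_congr_ae ?_
  filter_upwards [hθ] with ω hω
  by_cases h : (ω, x) ∈ A
  · have h' : ω ∈ (fun ω : ℕ → G => (ω, x)) ⁻¹' A := h
    rw [Set.indicator_of_mem h, Set.indicator_of_mem h', hω]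
  · have h' : ω ∉ (fun ω : ℕ → G => (ω, x)) ⁻¹' A := h
    rw [Set.indicator_of_notMem h, Set.indicator_of_notMem h']

end Main

end FutureWalk

end

theorem mainTheorem7
    {G : Type*} [Group G] [TopologicalSpace G] [IsTopologicalGroup G]
    [SecondCountableTopology G] [LocallyCompactSpace G] [MeasurableSpace G] [BorelSpace G]
    {X : Type*} [TopologicalSpace X] [SecondCountableTopology X] [LocallyCompactSpace X]
    [MeasurableSpace X] [BorelSpace X] [MulAction G X] [ContinuousSMul G X]
    (μ : Measure G) [IsProbabilityMeasure μ]
    (ν : Measure X) [IsProbabilityMeasure ν] (hν : FutureWalk.IsStationary μ ν)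
    (σ : G → X → ℝ) (hσ_cont : Continuous (fun p : G × X => σ p.1 p.2))
    (hσ_cocycle : FutureWalk.IsCocycle σ)
    (hσ_moment : FutureWalk.HasExpMoment μ σ)
    (hσ_centered : FutureWalk.IsCentered μ σ)
    (hσ_clt : FutureWalk.EffectiveCLT μ σ)
    (f : ℕ → (ℕ → G) × X → ℝ) (hf_meas : ∀ n, Measurable (f n))
    (hf_moment : ∃ α : ℝ, 0 < α ∧ FutureWalk.perturbMoment μ ν f α < ∞)
    (hf_approx : ∃ α β : ℝ, 0 < α ∧ 0 < β ∧ FutureWalk.perturbApprox μ ν f α β < ∞)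
    (θ : (ℕ → G) → ℝ) (hθ_bdd : MemLp θ ∞ (FutureWalk.pathMeasure μ))
    (hθ_nonneg : 0 ≤ᵐ[FutureWalk.pathMeasure μ] θ)
    (hθ_approx : ∃ β : ℝ, 0 < β ∧ FutureWalk.twistApprox μ θ β < ∞) :
    -- the functions `U_n` are well defined, and locally integrable in `t`
    (∀ n : ℕ, 1 ≤ n →
      (∀ t : ℝ, IntegrableOn
        (fun z : (ℕ → G) × X => (t + FutureWalk.perturbedWalk σ f n z.1 z.2) * θ z.1)
        {z | (n : ℕ∞) < FutureWalk.exitTime σ f t z.1 z.2}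
        ((FutureWalk.pathMeasure μ).prod ν)) ∧
      LocallyIntegrable (FutureWalk.twistedU μ ν σ f θ n) volume) ∧
    ∃ U : ℝ → ℝ, Measurable U ∧ (∀ t, 0 ≤ U t) ∧ LocallyIntegrable U volume ∧
      (∀ φ : ℝ → ℝ, Continuous φ → HasCompactSupport φ →
        Tendsto (fun n : ℕ => ∫ t, φ t * FutureWalk.twistedU μ ν σ f θ n t) atTop
          (𝓝 (∫ t, φ t * U t))) ∧
      Tendsto (fun t : ℝ => U t / t) atTop (𝓝 (∫ ω, θ ω ∂(FutureWalk.pathMeasure μ))) := by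
  have hsmul : Measurable fun p : G × X => p.1 • p.2 := continuous_smul.measurable
  obtain ⟨θ', B, hθm, hθ0, hθB, hθθ⟩ :=
    FutureWalk.exists_bounded_measurable_version hθ_bdd hθ_nonneg
  obtain ⟨β, hβ, hN⟩ := hθ_approx
  -- The approximation rate survives the change of version, since `splice` maps the product of path
  -- measures to the path measure and so respects null sets.
  rw [FutureWalk.twistApprox_congr_ae hθθ] at hN
  obtain ⟨C, ρ, γ, l₀, hS, hA⟩ := FutureWalk.exists_isFluctuatingWalk_and_isApproximable hsmul
    hσ_cont.measurable hσ_cocycle hσ_moment hσ_centered hσ_clt hν hf_meas hf_moment hf_approx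
    hθm hθ0 hθB ⟨β, hβ, hN⟩
  have hi : ∀ n t, Integrable (fun z : (ℕ → G) × X =>
      (t + FutureWalk.perturbedWalk σ f n z.1 z.2) * θ' z.1)
      ((FutureWalk.pathMeasure μ).prod ν) := fun n t =>
    FutureWalk.integrable_add_mul (hA.integrable_perturbed hS n) hA.twist_measurable
      hA.abs_twist_le t
  have hU : ∀ n t, FutureWalk.twistedU μ ν σ f θ n t = _ := fun n t =>
    FutureWalk.twistedU_eq_survivalMean hθθ
      (FutureWalk.measurableSet_survivors t fun k _ => hA.measurable_perturbed hS k) (hi n t)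
  refine ⟨fun n hn => ⟨fun t => ?_, ?_⟩, ?_⟩
  · have h1 : (fun z : (ℕ → G) × X => θ' z.1) =ᵐ[(FutureWalk.pathMeasure μ).prod ν]
        fun z => θ z.1 := Measure.quasiMeasurePreserving_fst.ae_eq_comp hθθ.symm
    refine ((hi n t).congr ?_).integrableOn
    filter_upwards [h1] with z hz
    rw [hz]
  · rw [show FutureWalk.twistedU μ ν σ f θ n = _ from funext (hU n)]
    exact (hA.monotone_mean hS hn).locallyIntegrable
  · obtain ⟨U, hUm, hU0, hUi, hUφ, hUt⟩ := hA.exists_vague_limit hS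
    refine ⟨U, hUm, hU0, hUi, fun φ hφ hφc => ?_, ?_⟩
    · simp_rw [hU]
      exact hUφ φ hφ hφc
    · have h1 : ∫ z : (ℕ → G) × X, θ' z.1 ∂((FutureWalk.pathMeasure μ).prod ν) =
          ∫ ω, θ ω ∂(FutureWalk.pathMeasure μ) := by
        rw [integral_fun_fst, probReal_univ, one_smul]
        exact (integral_congr_ae hθθ).symm
      rwa [h1] at hUt
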